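/- Let $n\ge 1$, let $\Omega\subset\mathbb{R}^n$ be a bounded Lipschitz domain (a bounded open set which near each boundary point is, in suitable Cartesian coordinates, the region below the graph of a Lipschitz function; connectedness is not needed). A function $M:\Omega\times\mathbb{R}^n\to[0,\infty)$ is a \emph{weak $N$-function} if it is measurable in $x$ and continuous in $\xi$, for a.a. $x\in\Omega$ the map $\xi\mapsto M(x,\xi)$ is convex and even with $M(x,0)=0$, and there are convex $m_1,m_2:[0,\infty)\to[0,\infty)$ with $m_1(0)=0$, $m_1(s)>0$ for $s>0$, such that $m_1(|\xi|)\le M(x,\xi)\le m_2(|\xi|)$ for a.a. $x$ and all $\xi$. A function $m:\Omega\times[0,\infty)\to[0,\infty)$ is called a weak $N$-function if $(x,s)\mapsto m(x,|s|)$ satisfies these conditions on $\Omega\times\mathbb{R}$. We write $M\in\Delta_2$ if there are $c,C>0$ and a nonnegative integrable $h:\Omega\to\mathbb{R}$ with $M(x,2\xi)\le cM(x,\xi)+h(x)$ for a.a. $x\in\Omega$ and all $|\xi|>C$. For a ball $B$ let $m_B^-(t)=\operatorname{ess\,inf}_{y\in B\cap\Omega}m(y,t)$ and $m_B^+(t)=\operatorname{ess\,sup}_{y\in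 B\cap\Omega}m(y,t)$. For $\gamma\in[0,1)$: - $M$ satisfies $(\mathsf{B}^{\rm iso}_\gamma)$ if $M(x,\xi)=m(x,|\xi|)$ for a weak $N$-function $m:\Omega\times[0,\infty)\to[0,\infty)$ and there are $c,C\ge1$ such that $m_B^+(t)\le m_B^-(Ct)+1$ for every ball $B$ of radius $r\le1$ (meeting $\Omega$) and all $0\le t\le c\,r^{\gamma-1}$. - $M$ satisfies $(\mathsf{B}^{\rm ort}_\gamma)$ if $M(x,\xi)=\sum_{i=1}^n M_i(x,|\xi_i|)$ for weak $N$-functions $M_i:\Omega\times[0,\infty)\to[0,\infty)$ and there are $c,C\ge1$ such that $(M_i)_B^+(t)\le (M_i)_B^-(Ct)+1$ for every $i$, every ball $B$ of radius $r\le1$ (meeting $\Omega$) and all $0\le t\le c\,r^{\gamma-1}$. Let $L_M(\Omega;\mathbb{R}^n)$ be the smallest linear space containing all measurable $\xi:\Omega\to\mathbb{R}^n$ with $\int_\Omega M(x,\xi(x))\,dx<\infty$, and put $$V^1L_M(\Omega)=\{f\in W^{1,1}(\Omega):\nabla f\in L_M(\Omega;\mathbb{R}^n)\},\qquad V^1_0L_M(\Omega)=\{f\in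 W^{1,1}_0(\Omega):\nabla f\in L_M(\Omega;\mathbb{R}^n)\},$$ with $\nabla$ the distributional gradient and $W^{1,1}_0(\Omega)$ the closure of $C_c^\infty(\Omega)$ in $W^{1,1}(\Omega)$. For $\gamma\in(0,1]$ let $C^{0,\gamma}(\Omega)$ be the set of functions with $\sup_{x\neq y\in\Omega}|f(x)-f(y)|/|x-y|^\gamma<\infty$. \textbf{Theorem (Absence of Lavrentiev's phenomenon).} Let $M$ be a weak $N$-function that is continuous on $\Omega\times\mathbb{R}^n$ and satisfies $M\in\Delta_2$. Let $F:\Omega\times\mathbb{R}\times\mathbb{R}^n\to\mathbb{R}$ be measurable in the first variable and (for a.a. $x$) continuous in the second and third variables jointly, and suppose that there are constants $0<\nu,\beta<1<L$ with $$\nu M(x,\beta\xi)\le F(x,z,\xi)\le L\,(M(x,\xi)+1)\qquad\text{for all }x\in\Omega,\ z\in\mathbb{R},\ \xi\in\mathbb{R}^n.$$ Let $\mathcal{F}[u]=\int_\Omega F(x,u,\nabla u)\,dx$. Then: (i) If $u_0\in V^1L_M(\Omega)$ and $M$ satisfies $(\mathsf{B}^{\rm iso}_0)$ or $(\mathsf{B}^{\rm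 ort}_0)$, then $$\inf_{u_0+V^1_0L_M(\Omega)}\mathcal{F}[u]=\inf_{u_0+C_c^\infty(\Omega)}\mathcal{F}[u].$$ (ii) If $\gamma\in(0,1)$, $u_0\in V^1L_M(\Omega)\cap C^{0,\gamma}(\Omega)$ and $M$ satisfies $(\mathsf{B}^{\rm iso}_\gamma)$ or $(\mathsf{B}^{\rm ort}_\gamma)$, then $$\inf_{u_0+V^1_0L_M(\Omega)\cap C^{0,\gamma}(\Omega)}\mathcal{F}[u]=\inf_{u_0+C_c^\infty(\Omega)}\mathcal{F}[u].$$ (iii) If $u_0\in V^1L_M(\Omega)\cap C^{0,1}(\Omega)$, then $$\inf_{u_0+V^1_0L_M(\Omega)\cap C^{0,1}(\Omega)}\mathcal{F}[u]=\inf_{u_0+C_c^\infty(\Omega)}\mathcal{F}[u].$$ -/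

import Mathlib

open Set MeasureTheory TopologicalSpace Topology
open scoped NNReal ENNReal Distributions

noncomputable section

namespace Lavrentiev

/-- Euclidean space of dimension `n`. -/
abbrev E (n : ℕ) : Type := EuclideanSpace ℝ (Fin n)

variable {n : ℕ}

/-- `Ω` has Lipschitz boundary: near each boundary point, for some unit vector `e`, the set `Ω` is
the region below the graph, in direction `e`, of a Lipschitz function on the hyperplane orthogonal
to `e`. -/
def HasLipschitzBoundary (Ω : Set (E n)) : Prop :=
  ∀ x ∈ frontier Ω, ∃ e : E n, ‖e‖ = 1 ∧
    ∃ (K : ℝ≥0) (ψ : (Submodule.span ℝ {e})ᗮ → ℝ), LipschitzWith K ψ ∧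
      ∃ U ∈ 𝓝 x, ∀ y ∈ U,
        (y ∈ Ω ↔ inner ℝ e y < ψ ((Submodule.span ℝ {e})ᗮ.orthogonalProjectionOnto y))

/-! ### Weak N-functions -/

/-- `M : Ω × V → [0, ∞)` is a weak `N`-function. -/
structure IsWeakNFunction {V : Type*} [NormedAddCommGroup V] [NormedSpace ℝ V]
    (Ω : Opens (E n)) (M : E n → V → ℝ) : Prop where
  nonneg : ∀ x ∈ Ω, ∀ ξ, 0 ≤ M x ξ
  measurable : ∀ ξ, AEMeasurable (fun x => M x ξ) (volume.restrict Ω)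
  continuous : ∀ᵐ x ∂(volume.restrict Ω), Continuous (M x)
  map_zero : ∀ᵐ x ∂(volume.restrict Ω), M x 0 = 0
  convex : ∀ᵐ x ∂(volume.restrict Ω), ConvexOn ℝ univ (M x)
  even : ∀ᵐ x ∂(volume.restrict Ω), ∀ ξ, M x ξ = M x (-ξ)
  bounds : ∃ m₁ m₂ : ℝ → ℝ,
    ConvexOn ℝ (Ici 0) m₁ ∧ m₁ 0 = 0 ∧ (∀ s, 0 < s → 0 < m₁ s) ∧
    ConvexOn ℝ (Ici 0) m₂ ∧ (∀ s, 0 ≤ s → 0 ≤ m₂ s) ∧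
    ∀ᵐ x ∂(volume.restrict Ω), ∀ ξ, m₁ ‖ξ‖ ≤ M x ξ ∧ M x ξ ≤ m₂ ‖ξ‖

/-- `m : Ω × [0, ∞) → [0, ∞)` is a weak `N`-function, that is, its even extension to `Ω × ℝ` is one.
Only the values `m x t` with `t ≥ 0` matter. -/
def IsWeakNFunctionHalfLine (Ω : Opens (E n)) (m : E n → ℝ → ℝ) : Prop :=
  IsWeakNFunction Ω (fun x (s : ℝ) => m x |s|)

/-- The `Δ₂` condition close to infinity. -/
def DeltaTwo (Ω : Opens (E n)) (M : E n → E n → ℝ) : Prop :=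
  ∃ (c C : ℝ) (h : E n → ℝ), 0 < c ∧ 0 < C ∧ IntegrableOn h Ω ∧ (∀ x ∈ Ω, 0 ≤ h x) ∧
    ∀ᵐ x ∂(volume.restrict Ω), ∀ ξ : E n, C < ‖ξ‖ →
      M x ((2 : ℝ) • ξ) ≤ c * M x ξ + h x

/-! ### Balance conditions -/

/-- `m⁺_B(t)`, the essential supremum of `m(y, t)` over `y ∈ B ∩ Ω`. -/
def ballSup (Ω : Opens (E n)) (m : E n → ℝ → ℝ) (B : Set (E n)) (t : ℝ) : ℝ≥0∞ :=
  essSup (fun y => ENNReal.ofReal (m y t)) (volume.restrict (B ∩ Ω))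

/-- `m⁻_B(t)`, the essential infimum of `m(y, t)` over `y ∈ B ∩ Ω`. -/
def ballInf (Ω : Opens (E n)) (m : E n → ℝ → ℝ) (B : Set (E n)) (t : ℝ) : ℝ≥0∞ :=
  essInf (fun y => ENNReal.ofReal (m y t)) (volume.restrict (B ∩ Ω))

/-- For every ball `B` of radius `r ≤ 1` and every `0 ≤ t ≤ c r ^ (γ - 1)` there holds
`m⁺_B(t) ≤ m⁻_B(C t) + 1`. -/
def BallBalance (Ω : Opens (E n)) (m : E n → ℝ → ℝ) (γ c C : ℝ) : Prop :=
  ∀ (x₀ : E n) (r : ℝ), 0 < r → r ≤ 1 → ∀ t : ℝ, 0 ≤ t → t ≤ c * r ^ (γ - 1) →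
    ballSup Ω m (Metric.ball x₀ r) t ≤ ballInf Ω m (Metric.ball x₀ r) (C * t) + 1

/-- The isotropic balance condition. -/
def BalanceIso (Ω : Opens (E n)) (M : E n → E n → ℝ) (γ : ℝ) : Prop :=
  ∃ m : E n → ℝ → ℝ, IsWeakNFunctionHalfLine Ω m ∧
    (∀ x ∈ Ω, ∀ ξ : E n, M x ξ = m x ‖ξ‖) ∧
    ∃ c C : ℝ, 1 ≤ c ∧ 1 ≤ C ∧ BallBalance Ω m γ c C

/-- The orthotropic balance condition. -/
def BalanceOrt (Ω : Opens (E n)) (M : E n → E n → ℝ) (γ : ℝ) : Prop :=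
  ∃ m : Fin n → E n → ℝ → ℝ, (∀ i, IsWeakNFunctionHalfLine Ω (m i)) ∧
    (∀ x ∈ Ω, ∀ ξ : E n, M x ξ = ∑ i, m i x |ξ i|) ∧
    ∃ c C : ℝ, 1 ≤ c ∧ 1 ≤ C ∧ ∀ i, BallBalance Ω (m i) γ c C

/-! ### Function spaces

Functions on `Ω` are represented by functions on the whole space; only their values on `Ω` matter. -/

/-- `g` is the distributional gradient of `f` on `Ω`. -/
def HasWeakGradient (Ω : Opens (E n)) (f : E n → ℝ) (g : E n → E n) : Prop :=
  LocallyIntegrableOn f Ω ∧ LocallyIntegrableOn g Ω ∧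
    ∀ φ : 𝓓(Ω, ℝ), ∫ x in Ω, f x • gradient φ x = -∫ x in Ω, φ x • g x

open Classical in
/-- The distributional gradient of `f` on `Ω`, which is unique up to almost everywhere equality on
`Ω`; it is set to `0` if `f` has no locally integrable distributional gradient. -/
def weakGrad (Ω : Opens (E n)) (f : E n → ℝ) : E n → E n :=
  if h : ∃ g, HasWeakGradient Ω f g then h.choose else 0

/-- The Sobolev space `W^{1,1}(Ω)`. -/
def W11 (Ω : Opens (E n)) : Set (E n → ℝ) :=
  {f | IntegrableOn f Ω ∧ (∃ g, HasWeakGradient Ω f g) ∧ IntegrableOn (weakGrad Ω f) Ω}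

/-- The space `W^{1,1}_0(Ω)`, the closure of `C_c^∞(Ω)` in `W^{1,1}(Ω)`. -/
def W110 (Ω : Opens (E n)) : Set (E n → ℝ) :=
  {f | f ∈ W11 Ω ∧ ∀ ε : ℝ≥0∞, 0 < ε → ∃ φ : 𝓓(Ω, ℝ),
    eLpNorm (fun x => f x - φ x) 1 (volume.restrict Ω) +
      eLpNorm (fun x => weakGrad Ω f x - gradient φ x) 1 (volume.restrict Ω) < ε}

/-- The modular `∫_Ω M(x, ξ(x)) dx`. -/
def modular (Ω : Opens (E n)) (M : E n → E n → ℝ) (ξ : E n → E n) : ℝ≥0∞ :=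
  ∫⁻ x in Ω, ENNReal.ofReal (M x (ξ x))

/-- The generalized Musielak--Orlicz class. -/
def musielakOrliczClass (Ω : Opens (E n)) (M : E n → E n → ℝ) : Set (E n → E n) :=
  {ξ | AEStronglyMeasurable ξ (volume.restrict Ω) ∧ modular Ω M ξ < ∞}

/-- The Musielak--Orlicz space `L_M(Ω; ℝⁿ)`, the smallest linear space containing the
Musielak--Orlicz class. -/
def musielakOrliczSpace (Ω : Opens (E n)) (M : E n → E n → ℝ) : Submodule ℝ (E n → E n) :=
  Submodule.span ℝ (musielakOrliczClass Ω M)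

/-- The Musielak--Orlicz--Sobolev space `V¹L_M(Ω)`. -/
def V1L (Ω : Opens (E n)) (M : E n → E n → ℝ) : Set (E n → ℝ) :=
  {f | f ∈ W11 Ω ∧ weakGrad Ω f ∈ musielakOrliczSpace Ω M}

/-- The zero-trace Musielak--Orlicz--Sobolev space `V¹₀L_M(Ω)`. -/
def V10L (Ω : Opens (E n)) (M : E n → E n → ℝ) : Set (E n → ℝ) :=
  {f | f ∈ W110 Ω ∧ weakGrad Ω f ∈ musielakOrliczSpace Ω M}

/-- The Hölder space `C^{0,γ}(Ω)`: functions with finite `γ`-Hölder seminorm on `Ω`. -/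
def HolderSpace (Ω : Opens (E n)) (γ : ℝ≥0) : Set (E n → ℝ) :=
  {f | ∃ C : ℝ≥0, HolderOnWith C γ f Ω}

/-- The functional `u ↦ ∫_Ω F(x, u, ∇u) dx` for a nonnegative integrand `F`, as an element of
`[0, ∞]`. -/
def functional (Ω : Opens (E n)) (F : E n → ℝ → E n → ℝ) (u : E n → ℝ) : ℝ≥0∞ :=
  ∫⁻ x in Ω, ENNReal.ofReal (F x (u x) (weakGrad Ω u x))

end Lavrentiev

end

/-!
The infimum over test functions is at least the other one, because test functions belong to all the
spaces involved. For the converse, each competitor `v` has to be approximated by test functions `φ`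
such that the energy of `u₀ + φ` is almost the energy of `u₀ + v`. The upper growth bound of the
integrand and dominated convergence reduce this to an approximation of `v` in `W^{1,1}` for which
also `∫ M(x, l (∇φ - ∇v))` is small, for every `l` (`IsApproximable`,
`IsApproximable.exists_functional_lt`). By the `Δ₂` condition all multiples of `∇v` have finite
modular, so these approximations can be added and iterated.

A competitor is a limit of test functions in `W^{1,1}`. Extended by zero it is thus weakly
differentiable on the whole space (`IsZeroSobolev`), it can be multiplied by cut-off functions and
composed with smooth functions, and mollification commutes with its gradient. If the competitor is
`γ`-Hölder continuous, then so is the extension (`IsZeroSobolev.abs_sub_le_of_holderOnWith`): a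
nonzero boundary value would produce, after composition with a suitable smooth function, a function
of zero gradient on a ball that takes two values on open sets. If `γ = 0`, the competitor is
replaced by its smooth truncations `k sin (v / k)`, which are bounded, that is, `0`-Hölder
continuous.

After a localization by bump functions, mollification at the scale `r` with a kernel shifted along
the axis of the interior cones gives a test function. Its gradient is of order `r ^ (γ - 1)`, by the
Hölder condition (`IsMollifier.norm_fderiv_mollify_le`). Up to a constant factor, harmless by
`Δ₂`, this is the range in which the balance condition compares `M x` with `M y` for `|x - y| < r`.
A supporting line of the profile of `M x` at the mollified gradient then lies below a multiple of
the profile of `M y`, up to lower order terms (`IsConvexGauge.supporting_line_le`). Integration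
of this line against the kernel bounds `M x` at the mollified gradient by the mollification of a
fixed integrable function (`DirectionalBalance.hasDomination`). Such mollifications converge in
`L¹`, so that the modular convergence follows from dominated convergence. If `γ = 1`, the mollified
gradients are bounded and no balance condition is needed (`hasDomination_one`).
-/

namespace Lavrentiev

variable {n : ℕ}

/-! ### Convex even integrands -/

/-- A continuous, even, convex function `Φ ≥ 0` vanishing at the origin, such as `M x` for almost
every `x` if `M` is a weak `N`-function. -/
structure IsConvexGauge {V : Type*} [NormedAddCommGroup V] [NormedSpace ℝ V] (Φ : V → ℝ) :
    Prop where
  nonneg : ∀ ξ, 0 ≤ Φ ξ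
  map_zero : Φ 0 = 0
  convex : ConvexOn ℝ univ Φ
  even : ∀ ξ, Φ ξ = Φ (-ξ)
  continuous : Continuous Φ

namespace IsConvexGauge

variable {V : Type*} [NormedAddCommGroup V] [NormedSpace ℝ V] {Φ : V → ℝ}

theorem map_smul_le_mul (h : IsConvexGauge Φ) {t : ℝ} (ht₀ : 0 ≤ t) (ht₁ : t ≤ 1) (ξ : V) :
    Φ (t • ξ) ≤ t * Φ ξ := by
  have := h.convex.2 (mem_univ ξ) (mem_univ 0) ht₀ (sub_nonneg.2 ht₁) (by ring)
  simpa [h.map_zero] using this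

theorem map_smul_le_of_abs_le_one (h : IsConvexGauge Φ) {t : ℝ} (ht : |t| ≤ 1) (ξ : V) :
    Φ (t • ξ) ≤ Φ ξ := by
  have key : Φ (|t| • ξ) ≤ Φ ξ :=
    (h.map_smul_le_mul (abs_nonneg t) ht ξ).trans (mul_le_of_le_one_left (h.nonneg ξ) ht)
  rcases abs_cases t with ⟨h1, -⟩ | ⟨h1, -⟩
  · rwa [h1] at key
  · rw [h1, neg_smul] at key
    rwa [h.even]

theorem map_smul_le_map_smul (h : IsConvexGauge Φ) {s t : ℝ} (hst : |s| ≤ |t|) (ξ : V) :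
    Φ (s • ξ) ≤ Φ (t • ξ) := by
  rcases eq_or_ne t 0 with rfl | ht
  · have : s = 0 := by simpa using hst
    simp [this]
  · have h1 : s • ξ = (s / t) • (t • ξ) := by rw [smul_smul, div_mul_cancel₀ _ ht]
    rw [h1]
    refine h.map_smul_le_of_abs_le_one ?_ _
    rw [abs_div]
    exact div_le_one_of_le₀ hst (abs_nonneg t)

theorem map_add_le (h : IsConvexGauge Φ) (a b : V) :
    Φ (a + b) ≤ Φ ((2 : ℝ) • a) + Φ ((2 : ℝ) • b) := by
  have := h.convex.2 (mem_univ ((2 : ℝ) • a)) (mem_univ ((2 : ℝ) • b))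
    (by norm_num : (0 : ℝ) ≤ 1 / 2) (by norm_num : (0 : ℝ) ≤ 1 / 2) (by norm_num)
  simp only [smul_smul, smul_eq_mul] at this
  norm_num at this
  linarith [h.nonneg ((2 : ℝ) • a), h.nonneg ((2 : ℝ) • b)]

theorem map_sub_le (h : IsConvexGauge Φ) (a b : V) :
    Φ (a - b) ≤ Φ ((2 : ℝ) • a) + Φ ((2 : ℝ) • b) := by
  have := h.map_add_le a (-b)
  rwa [smul_neg, ← h.even, ← sub_eq_add_neg] at this

end IsConvexGauge

theorem IsWeakNFunction.ae_isConvexGauge {V : Type*} [NormedAddCommGroup V] [NormedSpace ℝ V]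
    {Ω : Opens (E n)} {M : E n → V → ℝ} (h : IsWeakNFunction Ω M) :
    ∀ᵐ x ∂(volume.restrict Ω), IsConvexGauge (M x) := by
  filter_upwards [h.continuous, h.map_zero, h.convex, h.even,
    ae_restrict_mem Ω.isOpen.measurableSet] with x h1 h2 h3 h4 h5
  exact ⟨h.nonneg x h5, h2, h3, h4, h1⟩

theorem IsWeakNFunction.exists_bound_of_norm_le {V : Type*} [NormedAddCommGroup V]
    [NormedSpace ℝ V] {Ω : Opens (E n)} {M : E n → V → ℝ} (h : IsWeakNFunction Ω M) (R : ℝ) :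
    ∃ B : ℝ, 0 ≤ B ∧ ∀ᵐ x ∂(volume.restrict Ω), ∀ ξ : V, ‖ξ‖ ≤ R → M x ξ ≤ B := by
  obtain ⟨m₁, m₂, -, -, -, hm₂, -, hb⟩ := h.bounds
  refine ⟨max 0 (max (m₂ 0) (m₂ R)), le_max_left _ _, ?_⟩
  filter_upwards [hb] with x hx ξ hξ
  have hR : 0 ≤ R := (norm_nonneg ξ).trans hξ
  exact ((hx ξ).2.trans (hm₂.le_max_of_mem_Icc (mem_Ici.2 le_rfl) (mem_Ici.2 hR)
    ⟨norm_nonneg ξ, hξ⟩)).trans (le_max_right _ _)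

theorem volume_ne_top_of_isBounded {Ω : Opens (E n)}
    (hb : Bornology.IsBounded (Ω : Set (E n))) : volume (Ω : Set (E n)) ≠ ∞ :=
  hb.measure_lt_top.ne

/-- The `Δ₂` condition close to infinity yields, for a bounded domain, an estimate for all `ξ` and
all dilation factors. -/
theorem DeltaTwo.exists_bound_smul {Ω : Opens (E n)} {M : E n → E n → ℝ}
    (hb : Bornology.IsBounded (Ω : Set (E n))) (hM : IsWeakNFunction Ω M) (hΔ : DeltaTwo Ω M)
    (l : ℝ) :
    ∃ (c : ℝ) (H : E n → ℝ), 0 ≤ c ∧ IntegrableOn H Ω ∧ ∀ᵐ x ∂(volume.restrict Ω),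
      0 ≤ H x ∧ ∀ ξ, M x (l • ξ) ≤ c * M x ξ + H x := by
  obtain ⟨c, C, h, hc, hC, hint, hpos, hbd⟩ := hΔ
  obtain ⟨B, hB0, hB⟩ := hM.exists_bound_of_norm_le (2 * C)
  have hconst : ∀ a : ℝ, IntegrableOn (fun _ : E n => a) (Ω : Set (E n)) := fun a =>
    integrableOn_const (volume_ne_top_of_isBounded hb)
  have key : ∀ k : ℕ, ∃ (c : ℝ) (H : E n → ℝ), 0 ≤ c ∧ IntegrableOn H Ω ∧
      ∀ᵐ x ∂(volume.restrict Ω), 0 ≤ H x ∧ ∀ ξ, M x ((2 : ℝ) ^ k • ξ) ≤ c * M x ξ + H x := by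
    intro k
    induction k with
    | zero =>
      refine ⟨1, fun _ => 0, zero_le_one, hconst 0, ?_⟩
      filter_upwards with x
      simp
    | succ k ih =>
      obtain ⟨c', H, hc', hH, hbd'⟩ := ih
      refine ⟨c * c', fun x => c * H x + (h x + B), by positivity,
        (hH.const_mul c).add (hint.add (hconst B)), ?_⟩
      filter_upwards [hbd', hbd, hB, hM.ae_isConvexGauge,
        ae_restrict_mem Ω.isOpen.measurableSet] with x h1 h2 h3 h4 h5
      have hx := hpos x h5
      have h6 := h1.1
      refine ⟨by positivity, fun ξ => ?_⟩
      rw [pow_succ', mul_smul]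
      have h7 : M x ((2 : ℝ) • ((2 : ℝ) ^ k • ξ)) ≤ c * M x ((2 : ℝ) ^ k • ξ) + (h x + B) := by
        rcases lt_or_ge C ‖(2 : ℝ) ^ k • ξ‖ with h8 | h8
        · linarith [h2 _ h8]
        · have h9 : ‖(2 : ℝ) • ((2 : ℝ) ^ k • ξ)‖ ≤ 2 * C := by
            rw [norm_smul]; simpa using h8
          have := h3 _ h9
          have := mul_nonneg hc.le (h4.nonneg ((2 : ℝ) ^ k • ξ))
          linarith
      have := mul_le_mul_of_nonneg_left (h1.2 ξ) hc.le
      linarith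
  obtain ⟨k, hk⟩ := pow_unbounded_of_one_lt |l| (one_lt_two : (1 : ℝ) < 2)
  obtain ⟨c', H, hc', hH, hbd'⟩ := key k
  refine ⟨c', H, hc', hH, ?_⟩
  filter_upwards [hbd', hM.ae_isConvexGauge] with x h1 h2
  refine ⟨h1.1, fun ξ => (h2.map_smul_le_map_smul ?_ ξ).trans (h1.2 ξ)⟩
  rw [abs_of_pos (by positivity : (0 : ℝ) < 2 ^ k)]
  exact hk.le

/-- A supporting line of a convex gauge on `ℝ` at a point `t₀ ≥ 0`, with nonnegative slope. -/
theorem IsConvexGauge.exists_supporting_line {Φ : ℝ → ℝ} (h : IsConvexGauge Φ) {t₀ : ℝ}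
    (ht₀ : 0 ≤ t₀) : ∃ s : ℝ, 0 ≤ s ∧ ∀ t, 0 ≤ t → Φ t₀ + s * (t - t₀) ≤ Φ t := by
  rcases ht₀.eq_or_lt with rfl | ht₀
  · exact ⟨0, le_rfl, fun t _ => by simpa [h.map_zero] using h.nonneg t⟩
  have hmem : t₀ ∈ interior (univ : Set ℝ) := by simp
  have hd := h.convex.differentiableWithinAt_Ioi_of_mem_interior hmem
  set s := derivWithin Φ (Ioi t₀) t₀
  have hl : ∀ t < t₀, slope Φ t t₀ ≤ s := fun t ht =>
    (h.convex.slope_le_leftDeriv (mem_univ _) (mem_univ _) ht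
      (h.convex.differentiableWithinAt_Iio_of_mem_interior hmem)).trans
      (h.convex.leftDeriv_le_rightDeriv_of_mem_interior hmem)
  have hl' : ∀ t < t₀, Φ t₀ + s * (t - t₀) ≤ Φ t := by
    intro t ht
    have := hl t ht
    rw [slope_def_field, div_le_iff₀ (by linarith)] at this
    linarith
  refine ⟨s, ?_, fun t _ => ?_⟩
  · have := hl 0 ht₀
    rw [slope_def_field, h.map_zero] at this
    exact le_trans (div_nonneg (by simpa using h.nonneg t₀) (by linarith)) this
  · rcases lt_trichotomy t t₀ with h1 | h1 | h1
    · exact hl' t h1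
    · simp [h1]
    · have := h.convex.rightDeriv_le_slope (mem_univ _) (mem_univ _) h1 hd
      rw [slope_def_field, le_div_iff₀ (by linarith)] at this
      linarith

/-! ### Measure-theoretic tools -/

section Measure

variable {α : Type*} [MeasurableSpace α] {μ : Measure α}

/-- A Carathéodory function composed with a measurable function is measurable. -/
theorem aemeasurable_caratheodory {X : Type*} [TopologicalSpace X] [PseudoMetrizableSpace X]
    {f : α → X → ℝ} (hf : ∀ ξ, AEMeasurable (fun x => f x ξ) μ)
    (hc : ∀ᵐ x ∂μ, Continuous (f x)) {w : α → X} (hw : AEStronglyMeasurable w μ) :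
    AEMeasurable (fun x => f x (w x)) μ := by
  have hsimple : ∀ s : SimpleFunc α X, AEMeasurable (fun x => f x (s x)) μ := by
    intro s
    have hU : (⋃ y : s.range, s ⁻¹' {(y : X)}) = univ := by
      ext x; simp
    rw [← Measure.restrict_univ (μ := μ), ← hU]
    refine aemeasurable_iUnion_iff.2 fun y => ?_
    refine ((hf y).restrict).congr ?_
    filter_upwards [ae_restrict_mem (s.measurableSet_fiber y)] with x hx
    have : s x = y := hx
    rw [this]
  have h1 : AEMeasurable (fun x => f x (hw.mk w x)) μ := by
    refine aemeasurable_of_tendsto_metrizable_ae' (fun k =>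
      hsimple (hw.stronglyMeasurable_mk.approx k)) ?_
    filter_upwards [hc] with x hx
    exact (hx.tendsto _).comp (hw.stronglyMeasurable_mk.tendsto_approx x)
  refine h1.congr ?_
  filter_upwards [hw.ae_eq_mk] with x hx
  rw [hx]

/-- Dominated convergence with a convergent sequence of dominating functions, as an upper bound for
the limit. -/
theorem eventually_lintegral_lt_of_dominated {f G : ℕ → α → ℝ≥0∞} {f₀ G₀ : α → ℝ≥0∞}
    (hf : ∀ j, AEMeasurable (f j) μ) (hG₀ : AEMeasurable G₀ μ) (hG₀' : ∫⁻ x, G₀ x ∂μ ≠ ∞)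
    (hfG : ∀ j, ∀ᵐ x ∂μ, f j x ≤ G j x)
    (hG : Filter.Tendsto (fun j => ∫⁻ x, (G j x - G₀ x) ∂μ) Filter.atTop (𝓝 0))
    (hlim : ∀ᵐ x ∂μ, Filter.Tendsto (fun j => f j x) Filter.atTop (𝓝 (f₀ x)))
    {c : ℝ≥0∞} (hc : ∫⁻ x, f₀ x ∂μ < c) :
    ∀ᶠ j in Filter.atTop, ∫⁻ x, f j x ∂μ < c := by
  have h1 : Filter.Tendsto (fun j => ∫⁻ x, min (f j x) (G₀ x) ∂μ) Filter.atTop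
      (𝓝 (∫⁻ x, min (f₀ x) (G₀ x) ∂μ)) := by
    refine tendsto_lintegral_of_dominated_convergence' G₀ (fun j => (hf j).min hG₀)
      (fun j => Filter.Eventually.of_forall fun x => min_le_right _ _) hG₀' ?_
    filter_upwards [hlim] with x hx
    exact hx.min tendsto_const_nhds
  have h2 := h1.add hG
  rw [add_zero] at h2
  have h3 : ∫⁻ x, min (f₀ x) (G₀ x) ∂μ < c :=
    (lintegral_mono fun x => min_le_left _ _).trans_lt hc
  filter_upwards [h2.eventually_lt_const h3] with j hj
  refine lt_of_le_of_lt ?_ hj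
  rw [← lintegral_add_left' ((hf j).min hG₀)]
  refine lintegral_mono_ae ?_
  filter_upwards [hfG j] with x hx
  rcases le_total (f j x) (G₀ x) with h | h
  · rw [min_eq_left h]; exact le_self_add
  · rw [min_eq_right h]; exact hx.trans le_add_tsub

theorem exists_subseq_tendsto_ae_of_lintegral {F : Type*} [NormedAddCommGroup F]
    {f : ℕ → α → F} {g : α → F} (hf : ∀ j, AEStronglyMeasurable (f j) μ)
    (hg : AEStronglyMeasurable g μ)
    (h : Filter.Tendsto (fun j => ∫⁻ x, ‖f j x - g x‖ₑ ∂μ) Filter.atTop (𝓝 0)) :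
    ∃ ns : ℕ → ℕ, StrictMono ns ∧
      ∀ᵐ x ∂μ, Filter.Tendsto (fun j => f (ns j) x) Filter.atTop (𝓝 (g x)) := by
  refine (tendstoInMeasure_of_tendsto_eLpNorm one_ne_zero hf hg ?_).exists_seq_tendsto_ae
  simpa [eLpNorm_one_eq_lintegral_enorm] using h

end Measure

/-! ### Mollification -/

/-- `κ` is a smooth probability density supported in the closed ball of radius `r` about the
origin. It need not be centred at the origin. -/
structure IsMollifier (κ : E n → ℝ) (r : ℝ) : Prop where
  contDiff : ContDiff ℝ (⊤ : ℕ∞) κ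
  nonneg : ∀ t, 0 ≤ κ t
  integral_eq_one : ∫ t, κ t = 1
  norm_le : ∀ t, κ t ≠ 0 → ‖t‖ ≤ r

/-- The convolution of a function `h` with the kernel `κ`. -/
noncomputable def mollify {F : Type*} [NormedAddCommGroup F] [NormedSpace ℝ F] (κ : E n → ℝ) (h : E n → F)
    (x : E n) : F :=
  ∫ t, κ t • h (x - t)

/-- Smooth kernels concentrated near `δ a` at the scale `δ`, for a fixed vector `a`. -/
theorem exists_isMollifier (a : E n) : ∃ D : ℝ, 0 ≤ D ∧ ∀ δ : ℝ, 0 < δ → ∃ κ : E n → ℝ,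
    IsMollifier κ (δ * (‖a‖ + 1)) ∧ (∀ t, κ t ≠ 0 → ‖t - δ • a‖ ≤ δ / 2) ∧
      ∫ t, ‖fderiv ℝ κ t‖ ≤ D / δ := by
  let b : ContDiffBump a := ⟨1 / 4, 1 / 2, by norm_num, by norm_num⟩
  set κ₁ : E n → ℝ := b.normed volume with hκ₁
  refine ⟨∫ t, ‖fderiv ℝ κ₁ t‖, integral_nonneg fun t => norm_nonneg _, fun δ hδ => ?_⟩
  have hκ₁s : ContDiff ℝ (⊤ : ℕ∞) κ₁ := b.contDiff_normed
  set N := Module.finrank ℝ (E n)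
  have hN : |δ ^ N| = δ ^ N := abs_of_pos (by positivity)
  have hne : δ ^ N ≠ 0 := by positivity
  refine ⟨fun x => (δ ^ N)⁻¹ * κ₁ (δ⁻¹ • x), ?_, ?_, ?_⟩
  rotate_left
  · intro t ht
    have h1 : κ₁ (δ⁻¹ • t) ≠ 0 := right_ne_zero_of_mul ht
    have h2 : δ⁻¹ • t ∈ Metric.ball a (1 / 2) := by
      have : δ⁻¹ • t ∈ Function.support κ₁ := h1
      rwa [hκ₁, b.support_normed_eq] at this
    rw [mem_ball_iff_norm] at h2
    have h3 : t - δ • a = δ • (δ⁻¹ • t - a) := by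
      rw [smul_sub, smul_smul, mul_inv_cancel₀ hδ.ne', one_smul]
    rw [h3, norm_smul, Real.norm_of_nonneg hδ.le]
    nlinarith
  · have h1 : ∀ t, fderiv ℝ (fun x => (δ ^ N)⁻¹ * κ₁ (δ⁻¹ • x)) t =
        (δ ^ N)⁻¹ • δ⁻¹ • fderiv ℝ κ₁ (δ⁻¹ • t) := by
      intro t
      rw [← fderiv_comp_smul]
      have : DifferentiableAt ℝ (fun x => κ₁ (δ⁻¹ • x)) t :=
        ((hκ₁s.differentiable (by simp)).comp (differentiable_id.const_smul δ⁻¹)) t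
      exact fderiv_const_mul this _
    simp_rw [h1, norm_smul]
    rw [integral_const_mul, integral_const_mul,
      Measure.integral_comp_inv_smul volume (fun t => ‖fderiv ℝ κ₁ t‖), hN, norm_inv, norm_inv,
      Real.norm_of_nonneg hδ.le, Real.norm_of_nonneg (by positivity : 0 ≤ δ ^ N), smul_eq_mul]
    field_simp
    exact le_rfl
  · refine ⟨?_, fun t => mul_nonneg (by positivity) (b.nonneg_normed _), ?_, ?_⟩
    · exact contDiff_const.mul (hκ₁s.comp (contDiff_const_smul _))
    · rw [integral_const_mul, Measure.integral_comp_inv_smul volume κ₁, hN, hκ₁,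
        b.integral_normed, smul_eq_mul, mul_one, inv_mul_cancel₀ hne]
    · intro t ht
      have h1 : κ₁ (δ⁻¹ • t) ≠ 0 := right_ne_zero_of_mul ht
      have h2 : δ⁻¹ • t ∈ Metric.ball a (1 / 2) := by
        have : δ⁻¹ • t ∈ Function.support κ₁ := h1
        rwa [hκ₁, b.support_normed_eq] at this
      rw [mem_ball_iff_norm] at h2
      have h3 : t = δ • (δ⁻¹ • t) := by rw [smul_smul, mul_inv_cancel₀ hδ.ne', one_smul]
      rw [h3, norm_smul, Real.norm_of_nonneg hδ.le]
      have h4 : ‖δ⁻¹ • t‖ ≤ ‖δ⁻¹ • t - a‖ + ‖a‖ := by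
        simpa using norm_add_le (δ⁻¹ • t - a) a
      exact mul_le_mul_of_nonneg_left (by linarith) hδ.le

namespace IsMollifier

variable {κ : E n → ℝ} {r : ℝ} {F : Type*} [NormedAddCommGroup F] [NormedSpace ℝ F]

theorem tsupport_subset (hκ : IsMollifier κ r) : tsupport κ ⊆ Metric.closedBall 0 r :=
  closure_minimal (fun t ht => by simpa using hκ.norm_le t ht) Metric.isClosed_closedBall

theorem hasCompactSupport (hκ : IsMollifier κ r) : HasCompactSupport κ :=
  HasCompactSupport.of_support_subset_isCompact (isCompact_closedBall 0 r)
    ((subset_tsupport κ).trans hκ.tsupport_subset)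

theorem integrable (hκ : IsMollifier κ r) : Integrable κ :=
  hκ.contDiff.continuous.integrable_of_hasCompactSupport hκ.hasCompactSupport

theorem lintegral_enorm_eq_one (hκ : IsMollifier κ r) : ∫⁻ t, ‖κ t‖ₑ = 1 := by
  have h : ∀ t, ‖κ t‖ₑ = ENNReal.ofReal (κ t) := fun t => Real.enorm_of_nonneg (hκ.nonneg t)
  simp_rw [h]
  rw [← ofReal_integral_eq_lintegral_ofReal hκ.integrable
    (Filter.Eventually.of_forall hκ.nonneg), hκ.integral_eq_one, ENNReal.ofReal_one]

theorem integrable_smul (hκ : IsMollifier κ r) {h : E n → F} (hh : LocallyIntegrable h)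
    (x : E n) : Integrable (fun t => κ t • h (x - t)) :=
  hκ.hasCompactSupport.convolutionExists_left (ContinuousLinearMap.lsmul ℝ ℝ)
    hκ.contDiff.continuous hh x

theorem contDiff_mollify (hκ : IsMollifier κ r) {h : E n → F} (hh : LocallyIntegrable h) :
    ContDiff ℝ (⊤ : ℕ∞) (mollify κ h) :=
  hκ.hasCompactSupport.contDiff_convolution_left (ContinuousLinearMap.lsmul ℝ ℝ) hκ.contDiff hh

theorem integrable_mollify (hκ : IsMollifier κ r) {h : E n → F} (hh : Integrable h) :
    Integrable (mollify κ h) :=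
  hκ.integrable.integrable_convolution (ContinuousLinearMap.lsmul ℝ ℝ) hh

theorem mollify_const [CompleteSpace F] (hκ : IsMollifier κ r) (c : F) (x : E n) :
    mollify κ (fun _ => c) x = c := by
  rw [mollify, integral_smul_const, hκ.integral_eq_one, one_smul]

/-- The mollification at `x` depends only on the values in the closed ball of radius `r` about
`x`. -/
theorem mollify_congr (hκ : IsMollifier κ r) {h h' : E n → F} {x : E n}
    (hh : ∀ y, ‖x - y‖ ≤ r → h y = h' y) : mollify κ h x = mollify κ h' x := by
  refine integral_congr_ae (Filter.Eventually.of_forall fun t => ?_)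
  by_cases ht : κ t = 0
  · simp [ht]
  · have := hh (x - t) (by simpa using hκ.norm_le t ht)
    simp only [this]

theorem fderiv_mollify_apply (hκ : IsMollifier κ r) {f : E n → ℝ} (hf : LocallyIntegrable f)
    (x v : E n) : fderiv ℝ (mollify κ f) x v = ∫ t, fderiv ℝ κ t v * f (x - t) := by
  have h1 := hκ.hasCompactSupport.hasFDerivAt_convolution_left (ContinuousLinearMap.lsmul ℝ ℝ)
    (hκ.contDiff.of_le (by norm_cast)) hf x
  have h2 : fderiv ℝ (mollify κ f) x = _ := h1.fderiv
  rw [h2, convolution_def]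
  rw [ContinuousLinearMap.integral_apply]
  · rfl
  · exact (hκ.hasCompactSupport.fderiv ℝ).convolutionExists_left _
      (hκ.contDiff.continuous_fderiv (by simp)) hf x

/-- The gradient of the mollification of a `γ`-Hölder continuous function is of order
`r ^ γ ‖∇κ‖₁`. -/
theorem norm_fderiv_mollify_le (hκ : IsMollifier κ r) {f : E n → ℝ} (hf : LocallyIntegrable f)
    {K γ D : ℝ} (hK : 0 ≤ K) (hγ : 0 ≤ γ) (hfK : ∀ x y, |f x - f y| ≤ K * ‖x - y‖ ^ γ)
    (hD : ∫ t, ‖fderiv ℝ κ t‖ ≤ D) (x : E n) :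
    ‖fderiv ℝ (mollify κ f) x‖ ≤ D * (K * r ^ γ) := by
  have hcs : HasCompactSupport (fderiv ℝ κ) := hκ.hasCompactSupport.fderiv ℝ
  have hcont : Continuous (fderiv ℝ κ) := hκ.contDiff.continuous_fderiv (by simp)
  have hint : Integrable (fun t => ‖fderiv ℝ κ t‖) :=
    (hcont.integrable_of_hasCompactSupport hcs).norm
  have hr : 0 ≤ r := by
    by_contra hr
    have : κ = 0 := by
      ext t
      by_contra ht
      exact hr ((norm_nonneg t).trans (hκ.norm_le t ht))
    simpa [this] using hκ.integral_eq_one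
  have hrγ : 0 ≤ K * r ^ γ := mul_nonneg hK (Real.rpow_nonneg hr _)
  have hD0 : 0 ≤ D := (integral_nonneg fun t => norm_nonneg _).trans hD
  refine ContinuousLinearMap.opNorm_le_bound _ (mul_nonneg hD0 hrγ) fun v => ?_
  -- The constant `f x` may be subtracted, as `∫ ∇κ = 0`.
  have hconst : ∫ t, fderiv ℝ κ t v * f x = 0 := by
    have h1 := hκ.fderiv_mollify_apply (locallyIntegrable_const (f x)) x v
    have h2 : mollify κ (fun _ : E n => f x) = fun _ => f x := funext (hκ.mollify_const (f x))
    rw [h2] at h1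
    simpa using h1.symm
  have hI : Integrable (fun t => fderiv ℝ κ t v * f (x - t)) := by
    have := hcs.convolutionExists_left
      ((ContinuousLinearMap.lsmul ℝ ℝ).precompL (E n)) hcont hf x
    exact this.apply_continuousLinearMap v
  have hI' : Integrable (fun t => fderiv ℝ κ t v * f x) :=
    ((hcont.integrable_of_hasCompactSupport hcs).apply_continuousLinearMap v).mul_const _
  rw [hκ.fderiv_mollify_apply hf, ← sub_zero (∫ t, _), ← hconst, ← integral_sub hI hI']
  calc ‖∫ t, (fderiv ℝ κ t v * f (x - t) - fderiv ℝ κ t v * f x)‖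
      ≤ ∫ t, ‖fderiv ℝ κ t‖ * (‖v‖ * (K * r ^ γ)) := by
        refine norm_integral_le_of_norm_le (hint.mul_const _) (Filter.Eventually.of_forall ?_)
        intro t
        rw [← mul_sub, norm_mul, ← mul_assoc]
        by_cases ht : fderiv ℝ κ t = 0
        · simp [ht]
        · have h1 : t ∈ tsupport κ := tsupport_fderiv_subset ℝ (subset_tsupport _ ht)
          have h2 : ‖t‖ ≤ r := by simpa using hκ.tsupport_subset h1
          refine mul_le_mul ((fderiv ℝ κ t).le_opNorm v) ?_ (norm_nonneg _) (by positivity)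
          have h3 := hfK (x - t) x
          rw [sub_sub_cancel_left, norm_neg] at h3
          exact h3.trans (mul_le_mul_of_nonneg_left (Real.rpow_le_rpow (norm_nonneg t) h2 hγ) hK)
    _ = (∫ t, ‖fderiv ℝ κ t‖) * (‖v‖ * (K * r ^ γ)) := integral_mul_const _ _
    _ ≤ D * (‖v‖ * (K * r ^ γ)) := mul_le_mul_of_nonneg_right hD (by positivity)
    _ = D * (K * r ^ γ) * ‖v‖ := by ring

end IsMollifier

theorem exists_lintegral_translate_sub_le {F : Type*} [NormedAddCommGroup F] [NormedSpace ℝ F]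
    {h : E n → F} (hh : Integrable h) {ε : ℝ≥0∞} (hε : 0 < ε) :
    ∃ r₀ : ℝ, 0 < r₀ ∧ ∀ t : E n, ‖t‖ < r₀ → ∫⁻ x, ‖h (x - t) - h x‖ₑ ≤ ε := by
  have hmem : MemLp h 1 volume := memLp_one_iff_integrable.2 hh
  have : Fact ((1 : ℝ≥0∞) ≠ ∞) := ⟨ENNReal.one_ne_top⟩
  have hcont : Continuous fun t : E n => DomAddAct.mk (-t) +ᵥ (hmem.toLp h) := by
    have : Continuous fun t : E n => DomAddAct.mk (-t) :=
      DomAddAct.continuous_mk.comp continuous_neg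
    exact this.vadd continuous_const
  have h0 := hcont.tendsto 0
  rw [EMetric.tendsto_nhds] at h0
  obtain ⟨r₀, hr₀, hball⟩ := Metric.eventually_nhds_iff.1 (h0 ε hε)
  refine ⟨r₀, hr₀, fun t ht => ?_⟩
  have h1 := hball (y := t) (by simpa using ht)
  have h2 : ∀ s : E n, DomAddAct.mk (-s) +ᵥ (hmem.toLp h) =
      (hmem.comp_measurePreserving (measurePreserving_vadd (-s) volume)).toLp _ := fun s =>
    DomAddAct.mk_vadd_toLp _ _
  rw [h2, h2, Lp.edist_toLp_toLp, eLpNorm_one_eq_lintegral_enorm] at h1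
  refine (le_of_eq ?_).trans h1.le
  refine lintegral_congr fun x => ?_
  simp [vadd_eq_add, sub_eq_neg_add]

/-- Mollifications converge in `L¹`, uniformly over all kernels supported in small balls. -/
theorem exists_lintegral_mollify_sub_le {F : Type*} [NormedAddCommGroup F] [NormedSpace ℝ F]
    [CompleteSpace F] {h : E n → F} (hh : Integrable h) {ε : ℝ≥0∞} (hε : 0 < ε) :
    ∃ r₀ : ℝ, 0 < r₀ ∧ ∀ (κ : E n → ℝ) (r : ℝ), r < r₀ → IsMollifier κ r →
      ∫⁻ x, ‖mollify κ h x - h x‖ₑ ≤ ε := by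
  obtain ⟨r₀, hr₀, htr⟩ := exists_lintegral_translate_sub_le hh hε
  refine ⟨r₀, hr₀, fun κ r hr hκ => ?_⟩
  have hmeas : AEMeasurable (fun p : E n × E n => ‖κ p.2 • (h (p.1 - p.2) - h p.1)‖ₑ)
      (volume.prod volume) := by
    have h1 := (hκ.integrable.aestronglyMeasurable).convolution_integrand
      (ContinuousLinearMap.lsmul ℝ ℝ) (μ := volume) hh.aestronglyMeasurable
    have h2 : AEStronglyMeasurable (fun p : E n × E n => κ p.2 • h p.1) (volume.prod volume) :=
      (hκ.integrable.aestronglyMeasurable.comp_snd).smul (hh.aestronglyMeasurable.comp_fst)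
    simp_rw [smul_sub]
    exact (h1.sub h2).enorm
  calc ∫⁻ x, ‖mollify κ h x - h x‖ₑ
      ≤ ∫⁻ x, ∫⁻ t, ‖κ t • (h (x - t) - h x)‖ₑ := by
        refine lintegral_mono fun x => ?_
        have h1 : mollify κ h x - h x = ∫ t, κ t • (h (x - t) - h x) := by
          simp_rw [smul_sub]
          rw [integral_sub (hκ.integrable_smul hh.locallyIntegrable x)
            (hκ.integrable.smul_const _)]
          congr 1
          exact (hκ.mollify_const (h x) x).symm
        simp only [h1]
        exact enorm_integral_le_lintegral_enorm _
    _ = ∫⁻ t, ∫⁻ x, ‖κ t • (h (x - t) - h x)‖ₑ := lintegral_lintegral_swap hmeas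
    _ ≤ ∫⁻ t, ‖κ t‖ₑ * ε := by
        refine lintegral_mono fun t => ?_
        simp only [enorm_smul]
        rw [lintegral_const_mul' _ _ (by simp)]
        by_cases ht : κ t = 0
        · simp [ht]
        · exact mul_le_mul_right (htr t ((hκ.norm_le t ht).trans_lt hr)) _
    _ = ε := by
        rw [lintegral_mul_const'' _ hκ.integrable.aestronglyMeasurable.enorm,
          hκ.lintegral_enorm_eq_one, one_mul]

/-! ### Gradients of test functions -/

theorem inner_gradient_eq_fderiv (f : E n → ℝ) (x v : E n) :
    inner ℝ (gradient f x) v = fderiv ℝ f x v := by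
  simp [gradient, InnerProductSpace.toDual_symm_apply]

theorem norm_gradient_eq_norm_fderiv (f : E n → ℝ) (x : E n) :
    ‖gradient f x‖ = ‖fderiv ℝ f x‖ := by
  simp [gradient]

theorem gradient_eq_zero_of_notMem_tsupport {f : E n → ℝ} {x : E n} (hx : x ∉ tsupport f) :
    gradient f x = 0 := by
  have h : fderiv ℝ f x = 0 := by
    by_contra h
    exact hx (tsupport_fderiv_subset ℝ (subset_tsupport _ h))
  simp [gradient, h]

theorem _root_.ContDiff.continuous_gradient {f : E n → ℝ} (hf : ContDiff ℝ (⊤ : ℕ∞) f) :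
    Continuous (gradient f) :=
  (InnerProductSpace.toDual ℝ (E n)).symm.continuous.comp (hf.continuous_fderiv (by simp))

theorem hasCompactSupport_gradient {f : E n → ℝ} (hf : HasCompactSupport f) :
    HasCompactSupport (gradient f) :=
  HasCompactSupport.intro hf fun _ hx => gradient_eq_zero_of_notMem_tsupport hx

theorem gradient_mul {f g : E n → ℝ} (hf : Differentiable ℝ f) (hg : Differentiable ℝ g)
    (x : E n) : gradient (fun y => f y * g y) x = f x • gradient g x + g x • gradient f x := by
  simp only [gradient]
  rw [fderiv_fun_mul (hf x) (hg x), map_add, map_smul, map_smul]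

theorem gradient_sub {f g : E n → ℝ} (hf : Differentiable ℝ f) (hg : Differentiable ℝ g)
    (x : E n) : gradient (fun y => f y - g y) x = gradient f x - gradient g x := by
  simp only [gradient]
  rw [fderiv_fun_sub (hf x) (hg x), map_sub]

theorem gradient_add {f g : E n → ℝ} (hf : Differentiable ℝ f) (hg : Differentiable ℝ g)
    (x : E n) : gradient (fun y => f y + g y) x = gradient f x + gradient g x := by
  simp only [gradient]
  rw [fderiv_fun_add (hf x) (hg x), map_add]

theorem gradient_comp {T : ℝ → ℝ} {f : E n → ℝ} (hT : Differentiable ℝ T)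
    (hf : Differentiable ℝ f) (x : E n) :
    gradient (fun y => T (f y)) x = deriv T (f x) • gradient f x := by
  have h : fderiv ℝ (fun y => T (f y)) x = deriv T (f x) • fderiv ℝ f x :=
    ((hT (f x)).hasDerivAt.comp_hasFDerivAt x (hf x).hasFDerivAt).fderiv
  simp only [gradient]
  rw [h, map_smul]

section TestFunction

variable {Ω : Opens (E n)} (φ : 𝓓(Ω, ℝ))

theorem testFunction_differentiable : Differentiable ℝ φ := φ.contDiff.differentiable (by simp)

theorem testFunction_eq_zero {x : E n} (hx : x ∉ Ω) : φ x = 0 :=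
  image_eq_zero_of_notMem_tsupport fun h => hx (φ.tsupport_subset h)

theorem testFunction_gradient_eq_zero {x : E n} (hx : x ∉ Ω) : gradient φ x = 0 :=
  gradient_eq_zero_of_notMem_tsupport fun h => hx (φ.tsupport_subset h)

theorem testFunction_continuous_gradient : Continuous (gradient φ) :=
  φ.contDiff.continuous_gradient

theorem testFunction_integrable : Integrable φ :=
  φ.continuous.integrable_of_hasCompactSupport φ.hasCompactSupport

theorem testFunction_integrable_gradient : Integrable (gradient φ) :=
  (testFunction_continuous_gradient φ).integrable_of_hasCompactSupport
    (hasCompactSupport_gradient φ.hasCompactSupport)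

theorem testFunction_exists_norm_gradient_le : ∃ B : ℝ, ∀ x, ‖gradient φ x‖ ≤ B :=
  (testFunction_continuous_gradient φ).bounded_above_of_compact_support
    (hasCompactSupport_gradient φ.hasCompactSupport)

theorem aemeasurable_enorm_testFunction_sub {f : E n → ℝ} (hf : Integrable f) :
    AEMeasurable (fun x => ‖φ x - f x‖ₑ) volume :=
  ((testFunction_integrable φ).sub hf).aestronglyMeasurable.enorm

theorem aemeasurable_enorm_gradient_sub {g : E n → E n} (hg : Integrable g) :
    AEMeasurable (fun x => ‖gradient φ x - g x‖ₑ) volume :=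
  ((testFunction_integrable_gradient φ).sub hg).aestronglyMeasurable.enorm

end TestFunction

/-! ### Sobolev functions with zero boundary values -/

/-- The function `f`, extended by zero outside `Ω`, is a limit of test functions in `W^{1,1}`, and
`g` is the limit of their gradients. -/
structure IsZeroSobolev (Ω : Opens (E n)) (f : E n → ℝ) (g : E n → E n) : Prop where
  integrable : Integrable f
  integrable_grad : Integrable g
  eq_zero : ∀ x ∉ Ω, f x = 0
  grad_eq_zero : ∀ x ∉ Ω, g x = 0
  exists_seq : ∃ φ : ℕ → 𝓓(Ω, ℝ),
    Filter.Tendsto (fun j => ∫⁻ x, ‖φ j x - f x‖ₑ) Filter.atTop (𝓝 0) ∧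
      Filter.Tendsto (fun j => ∫⁻ x, ‖gradient (φ j) x - g x‖ₑ) Filter.atTop (𝓝 0)

theorem lintegral_eq_setLIntegral_of_eq_zero {Ω : Opens (E n)} {h : E n → ℝ≥0∞}
    (hh : ∀ x ∉ Ω, h x = 0) : ∫⁻ x, h x = ∫⁻ x in Ω, h x := by
  rw [← lintegral_indicator Ω.isOpen.measurableSet]
  refine lintegral_congr fun x => ?_
  by_cases hx : x ∈ Ω
  · rw [indicator_of_mem (show x ∈ (Ω : Set (E n)) from hx)]
  · rw [indicator_of_notMem (show x ∉ (Ω : Set (E n)) from hx), hh x hx]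

theorem W110.isZeroSobolev {Ω : Opens (E n)} {v : E n → ℝ} (hv : v ∈ W110 Ω) :
    IsZeroSobolev Ω (indicator Ω v) (indicator Ω (weakGrad Ω v)) := by
  obtain ⟨hW, happ⟩ := hv
  have hΩ := Ω.isOpen.measurableSet
  refine ⟨(integrable_indicator_iff hΩ).2 hW.1, (integrable_indicator_iff hΩ).2 hW.2.2,
    fun x hx => indicator_of_notMem hx _, fun x hx => indicator_of_notMem hx _, ?_⟩
  have hε : ∀ j : ℕ, (0 : ℝ≥0∞) < ((j : ℝ≥0∞) + 1)⁻¹ := fun j => by simp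
  choose φ hφ using fun j : ℕ => happ _ (hε j)
  have h0 : Filter.Tendsto (fun j : ℕ => ((j : ℝ≥0∞) + 1)⁻¹) Filter.atTop (𝓝 0) := by
    have := ENNReal.tendsto_inv_nat_nhds_zero.comp (Filter.tendsto_add_atTop_nat 1)
    simpa [Function.comp_def] using this
  refine ⟨φ, ?_, ?_⟩
  · refine tendsto_of_tendsto_of_tendsto_of_le_of_le tendsto_const_nhds h0 (fun _ => zero_le)
      fun j => ?_
    refine le_trans (le_of_eq ?_) (le_self_add.trans (hφ j).le)
    rw [eLpNorm_one_eq_lintegral_enorm, lintegral_eq_setLIntegral_of_eq_zero (Ω := Ω)]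
    · refine setLIntegral_congr_fun hΩ fun x hx => ?_
      simp only [indicator_of_mem hx]
      rw [← enorm_neg, neg_sub]
    · intro x hx
      rw [testFunction_eq_zero _ hx, indicator_of_notMem (show x ∉ (Ω : Set (E n)) from hx)]
      simp
  · refine tendsto_of_tendsto_of_tendsto_of_le_of_le tendsto_const_nhds h0 (fun _ => zero_le)
      fun j => ?_
    refine le_trans (le_of_eq ?_) (le_add_self.trans (hφ j).le)
    rw [eLpNorm_one_eq_lintegral_enorm, lintegral_eq_setLIntegral_of_eq_zero (Ω := Ω)]
    · refine setLIntegral_congr_fun hΩ fun x hx => ?_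
      simp only [indicator_of_mem hx]
      rw [← enorm_neg, neg_sub]
    · intro x hx
      rw [testFunction_gradient_eq_zero _ hx,
        indicator_of_notMem (show x ∉ (Ω : Set (E n)) from hx)]
      simp

/-- Testing the translates of an `L¹`-convergent sequence against a bounded kernel. -/
theorem tendsto_integral_smul_translate {F : Type*} [NormedAddCommGroup F] [NormedSpace ℝ F]
    {k : E n → ℝ} (hk : Continuous k) (hkc : HasCompactSupport k) {h : ℕ → E n → F} {h₀ : E n → F}
    (hh : ∀ j, Integrable (h j)) (hh₀ : Integrable h₀)
    (hlim : Filter.Tendsto (fun j => ∫⁻ x, ‖h j x - h₀ x‖ₑ) Filter.atTop (𝓝 0)) (x : E n) :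
    Filter.Tendsto (fun j => ∫ t, k t • h j (x - t)) Filter.atTop
      (𝓝 (∫ t, k t • h₀ (x - t))) := by
  have hint : ∀ {f : E n → F}, Integrable f → Integrable (fun t => k t • f (x - t)) := fun hf =>
    hkc.convolutionExists_left (ContinuousLinearMap.lsmul ℝ ℝ) hk hf.locallyIntegrable x
  obtain ⟨C, hC⟩ := hk.bounded_above_of_compact_support hkc
  refine tendsto_integral_of_L1 _ (hint hh₀).aestronglyMeasurable
    (Filter.Eventually.of_forall fun j => hint (hh j)) ?_
  have h1 := ENNReal.Tendsto.const_mul (a := ENNReal.ofReal C) hlim (Or.inr ENNReal.ofReal_ne_top)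
  rw [mul_zero] at h1
  refine tendsto_of_tendsto_of_tendsto_of_le_of_le tendsto_const_nhds h1 (fun _ => zero_le)
    fun j => ?_
  simp only
  rw [← lintegral_sub_left_eq_self (fun t => ‖h j t - h₀ t‖ₑ) x,
    ← lintegral_const_mul' _ _ ENNReal.ofReal_ne_top]
  refine lintegral_mono fun t => ?_
  simp only
  rw [← smul_sub, enorm_smul]
  refine mul_le_mul_left ?_ _
  rw [← ofReal_norm]
  exact ENNReal.ofReal_le_ofReal (hC t)

theorem gradient_mollify_testFunction {Ω : Opens (E n)} {κ : E n → ℝ} {r : ℝ}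
    (hκ : IsMollifier κ r) (φ : 𝓓(Ω, ℝ)) (x : E n) :
    gradient (mollify κ φ) x = mollify κ (gradient φ) x := by
  refine ext_inner_right ℝ fun v => ?_
  rw [inner_gradient_eq_fderiv,
    hκ.fderiv_mollify_apply (testFunction_integrable φ).locallyIntegrable]
  have hI := hκ.integrable_smul (testFunction_integrable_gradient φ).locallyIntegrable x
  have h1 : inner ℝ (mollify κ (gradient φ) x) v =
      ∫ t, κ t * fderiv ℝ φ (x - t) v := by
    rw [mollify, real_inner_comm, ← integral_inner hI]
    refine integral_congr_ae (Filter.Eventually.of_forall fun t => ?_)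
    simp only
    rw [inner_smul_right, real_inner_comm, inner_gradient_eq_fderiv]
  rw [h1]
  set ψ : E n → ℝ := fun t => φ (x - t) with hψ
  have hψd : ∀ t, fderiv ℝ ψ t v = -fderiv ℝ φ (x - t) v := by
    intro t
    have h2 : HasFDerivAt ψ ((fderiv ℝ φ (x - t)).comp (-ContinuousLinearMap.id ℝ (E n))) t :=
      ((testFunction_differentiable φ) (x - t)).hasFDerivAt.comp t
        ((hasFDerivAt_id t).const_sub x)
    rw [h2.fderiv]
    simp
  have hψc : ContDiff ℝ (⊤ : ℕ∞) ψ := φ.contDiff.comp (contDiff_const.sub contDiff_id)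
  have hκd : Differentiable ℝ κ := hκ.contDiff.differentiable (by simp)
  have hint : ∀ {p q : E n → ℝ}, Continuous p → Continuous q → HasCompactSupport p →
      Integrable fun t => p t * q t := fun hp hq hpc =>
    (hp.mul hq).integrable_of_hasCompactSupport hpc.mul_right
  have hκ'c : Continuous fun t => fderiv ℝ κ t v :=
    (hκ.contDiff.continuous_fderiv (by simp)).clm_apply continuous_const
  have hψ'c : Continuous fun t => fderiv ℝ ψ t v :=
    (hψc.continuous_fderiv (by simp)).clm_apply continuous_const
  have hκ's : HasCompactSupport fun t => fderiv ℝ κ t v :=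
    hκ.hasCompactSupport.fderiv_apply ℝ v
  have h3 := integral_mul_fderiv_eq_neg_fderiv_mul_of_integrable (μ := volume) (f := κ) (g := ψ)
    (v := v) (hint hκ'c hψc.continuous hκ's)
    (hint hκ.contDiff.continuous hψ'c hκ.hasCompactSupport)
    (hint hκ.contDiff.continuous hψc.continuous hκ.hasCompactSupport)
    (fun t _ => hκd t) (fun t _ => hψc.differentiable (by simp) t)
  simp_rw [hψd, mul_neg, integral_neg] at h3
  exact (neg_injective h3).symm

namespace IsZeroSobolev

variable {Ω : Opens (E n)} {f f' : E n → ℝ} {g g' : E n → E n}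

theorem exists_seq_ae (h : IsZeroSobolev Ω f g) : ∃ φ : ℕ → 𝓓(Ω, ℝ),
    Filter.Tendsto (fun j => ∫⁻ x, ‖φ j x - f x‖ₑ) Filter.atTop (𝓝 0) ∧
      Filter.Tendsto (fun j => ∫⁻ x, ‖gradient (φ j) x - g x‖ₑ) Filter.atTop (𝓝 0) ∧
      ∀ᵐ x, Filter.Tendsto (fun j => φ j x) Filter.atTop (𝓝 (f x)) := by
  obtain ⟨φ, h1, h2⟩ := h.exists_seq
  obtain ⟨ns, hns, h3⟩ := exists_subseq_tendsto_ae_of_lintegral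
    (fun j => (testFunction_integrable (φ j)).aestronglyMeasurable)
    h.integrable.aestronglyMeasurable h1
  exact ⟨fun j => φ (ns j), h1.comp hns.tendsto_atTop, h2.comp hns.tendsto_atTop, h3⟩

/-- Mollification commutes with the gradient. No boundary term appears because the function is a
limit of test functions. -/
theorem gradient_mollify (h : IsZeroSobolev Ω f g) {κ : E n → ℝ} {r : ℝ} (hκ : IsMollifier κ r)
    (x : E n) : gradient (mollify κ f) x = mollify κ g x := by
  obtain ⟨φ, h1, h2⟩ := h.exists_seq
  refine ext_inner_right ℝ fun v => ?_
  rw [inner_gradient_eq_fderiv, hκ.fderiv_mollify_apply h.integrable.locallyIntegrable]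
  have hκ'c : Continuous fun t => fderiv ℝ κ t v :=
    (hκ.contDiff.continuous_fderiv (by simp)).clm_apply continuous_const
  have l1 := tendsto_integral_smul_translate hκ'c (hκ.hasCompactSupport.fderiv_apply ℝ v)
    (fun j => testFunction_integrable (φ j)) h.integrable h1 x
  have l2 := tendsto_integral_smul_translate hκ.contDiff.continuous hκ.hasCompactSupport
    (fun j => testFunction_integrable_gradient (φ j)) h.integrable_grad h2 x
  have l3 : Filter.Tendsto (fun j => inner ℝ (mollify κ (gradient (φ j)) x) v) Filter.atTop
      (𝓝 (inner ℝ (mollify κ g x) v)) := l2.inner tendsto_const_nhds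
  refine tendsto_nhds_unique l1 (l3.congr fun j => ?_)
  rw [← gradient_mollify_testFunction hκ, inner_gradient_eq_fderiv,
    hκ.fderiv_mollify_apply (testFunction_integrable (φ j)).locallyIntegrable]
  rfl

theorem sub (h : IsZeroSobolev Ω f g) (h' : IsZeroSobolev Ω f' g') :
    IsZeroSobolev Ω (fun x => f x - f' x) (fun x => g x - g' x) := by
  obtain ⟨φ, h1, h2⟩ := h.exists_seq
  obtain ⟨φ', h1', h2'⟩ := h'.exists_seq
  refine ⟨h.integrable.sub h'.integrable, h.integrable_grad.sub h'.integrable_grad,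
    fun x hx => by simp [h.eq_zero x hx, h'.eq_zero x hx],
    fun x hx => by simp [h.grad_eq_zero x hx, h'.grad_eq_zero x hx],
    fun j => φ j - φ' j, ?_, ?_⟩
  · have h3 := h1.add h1'
    rw [add_zero] at h3
    refine tendsto_of_tendsto_of_tendsto_of_le_of_le tendsto_const_nhds h3 (fun _ => zero_le)
      fun j => ?_
    simp only
    rw [← lintegral_add_left' (aemeasurable_enorm_testFunction_sub (φ j) h.integrable)]
    refine lintegral_mono fun x => ?_
    have : (φ j - φ' j) x - (f x - f' x) = (φ j x - f x) - (φ' j x - f' x) :=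
      sub_sub_sub_comm (φ j x) (φ' j x) (f x) (f' x)
    rw [this]
    exact enorm_sub_le
  · have h3 := h2.add h2'
    rw [add_zero] at h3
    refine tendsto_of_tendsto_of_tendsto_of_le_of_le tendsto_const_nhds h3 (fun _ => zero_le)
      fun j => ?_
    simp only
    rw [← lintegral_add_left' (aemeasurable_enorm_gradient_sub (φ j) h.integrable_grad)]
    refine lintegral_mono fun x => ?_
    have : gradient (φ j - φ' j : 𝓓(Ω, ℝ)) x - (g x - g' x) =
        (gradient (φ j) x - g x) - (gradient (φ' j) x - g' x) := by
      have h4 : gradient (φ j - φ' j : 𝓓(Ω, ℝ)) x = gradient (φ j) x - gradient (φ' j) x :=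
        gradient_sub (testFunction_differentiable _) (testFunction_differentiable _) x
      rw [h4]; abel
    rw [this]
    exact enorm_sub_le

/-- The product with a smooth compactly supported function. -/
theorem mul_left (h : IsZeroSobolev Ω f g) {θ : E n → ℝ} (hθ : ContDiff ℝ (⊤ : ℕ∞) θ)
    (hθc : HasCompactSupport θ) :
    IsZeroSobolev Ω (fun x => θ x * f x) (fun x => θ x • g x + f x • gradient θ x) := by
  obtain ⟨φ, h1, h2⟩ := h.exists_seq
  obtain ⟨A, hA⟩ := hθ.continuous.bounded_above_of_compact_support hθc
  obtain ⟨B, hB⟩ := hθ.continuous_gradient.bounded_above_of_compact_support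
    (hasCompactSupport_gradient hθc)
  have hA' : ∀ x, ‖θ x‖ₑ ≤ ENNReal.ofReal A := fun x => by
    rw [← ofReal_norm]; exact ENNReal.ofReal_le_ofReal (hA x)
  have hB' : ∀ x, ‖gradient θ x‖ₑ ≤ ENNReal.ofReal B := fun x => by
    rw [← ofReal_norm]; exact ENNReal.ofReal_le_ofReal (hB x)
  have hθd : Differentiable ℝ θ := hθ.differentiable (by simp)
  refine ⟨h.integrable.bdd_mul hθ.continuous.aestronglyMeasurable
      (Filter.Eventually.of_forall hA),
    (h.integrable_grad.bdd_smul A hθ.continuous.aestronglyMeasurable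
      (Filter.Eventually.of_forall hA)).add
      (h.integrable.smul_bdd B hθ.continuous_gradient.aestronglyMeasurable
        (Filter.Eventually.of_forall hB)),
    fun x hx => by simp [h.eq_zero x hx],
    fun x hx => by simp [h.eq_zero x hx, h.grad_eq_zero x hx],
    fun j => ⟨fun x => θ x * φ j x, hθ.mul (φ j).contDiff, (φ j).hasCompactSupport.mul_left,
      (tsupport_mul_subset_right).trans (φ j).tsupport_subset⟩, ?_, ?_⟩
  · have h3 := ENNReal.Tendsto.const_mul (a := ENNReal.ofReal A) h1
      (Or.inr ENNReal.ofReal_ne_top)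
    rw [mul_zero] at h3
    refine tendsto_of_tendsto_of_tendsto_of_le_of_le tendsto_const_nhds h3 (fun _ => zero_le)
      fun j => ?_
    simp only
    rw [← lintegral_const_mul' _ _ ENNReal.ofReal_ne_top]
    refine lintegral_mono fun x => ?_
    simp only [TestFunction.coe_mk]
    rw [← mul_sub, enorm_mul]
    exact mul_le_mul_left (hA' x) _
  · have h3 := (ENNReal.Tendsto.const_mul (a := ENNReal.ofReal A) h2
      (Or.inr ENNReal.ofReal_ne_top)).add (ENNReal.Tendsto.const_mul (a := ENNReal.ofReal B) h1
      (Or.inr ENNReal.ofReal_ne_top))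
    rw [mul_zero, mul_zero, add_zero] at h3
    refine tendsto_of_tendsto_of_tendsto_of_le_of_le tendsto_const_nhds h3 (fun _ => zero_le)
      fun j => ?_
    simp only
    rw [← lintegral_const_mul' _ _ ENNReal.ofReal_ne_top,
      ← lintegral_const_mul' _ _ ENNReal.ofReal_ne_top, ← lintegral_add_left' 
        ((aemeasurable_enorm_gradient_sub (φ j) h.integrable_grad).const_mul _)]
    refine lintegral_mono fun x => ?_
    simp only [TestFunction.coe_mk]
    rw [gradient_mul hθd (testFunction_differentiable _)]
    have h4 : θ x • gradient (φ j) x + φ j x • gradient θ x - (θ x • g x + f x • gradient θ x) =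
        θ x • (gradient (φ j) x - g x) + (φ j x - f x) • gradient θ x := by
      rw [smul_sub, sub_smul]; abel
    rw [h4]
    refine (enorm_add_le _ _).trans (add_le_add ?_ ?_)
    · rw [enorm_smul]
      exact mul_le_mul_left (hA' x) _
    · rw [enorm_smul, mul_comm]
      exact mul_le_mul_left (hB' x) _

/-- The chain rule for a smooth function with bounded derivative. -/
theorem comp (h : IsZeroSobolev Ω f g) {T : ℝ → ℝ} (hT : ContDiff ℝ (⊤ : ℕ∞) T) (hT₀ : T 0 = 0)
    {C : ℝ≥0} (hC : ∀ s, ‖deriv T s‖₊ ≤ C) :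
    IsZeroSobolev Ω (fun x => T (f x)) (fun x => deriv T (f x) • g x) := by
  obtain ⟨φ, h1, h2, h3⟩ := h.exists_seq_ae
  have hTd : Differentiable ℝ T := hT.differentiable (by simp)
  have hT'c : Continuous (deriv T) := hT.continuous_deriv (by simp)
  have hLip : LipschitzWith C T := lipschitzWith_of_nnnorm_deriv_le hTd hC
  have hCe : ∀ s, ‖deriv T s‖ₑ ≤ C := fun s => by
    rw [enorm_eq_nnnorm]; exact_mod_cast hC s
  have hLe : ∀ a b, ‖T a - T b‖ₑ ≤ C * ‖a - b‖ₑ := fun a b => by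
    have := hLip a b
    rwa [edist_eq_enorm_sub, edist_eq_enorm_sub] at this
  have hTf : AEStronglyMeasurable (fun x => deriv T (f x)) volume :=
    hT'c.comp_aestronglyMeasurable h.integrable.aestronglyMeasurable
  refine ⟨?_, h.integrable_grad.bdd_smul C hTf (Filter.Eventually.of_forall fun x => hC _),
    fun x hx => by simp [h.eq_zero x hx, hT₀],
    fun x hx => by simp [h.grad_eq_zero x hx],
    fun j => ⟨fun x => T (φ j x), hT.comp (φ j).contDiff, (φ j).hasCompactSupport.comp_left hT₀,
      (tsupport_comp_subset hT₀ (φ j)).trans (φ j).tsupport_subset⟩, ?_, ?_⟩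
  · refine (h.integrable.norm.const_mul (C : ℝ)).mono'
      (hT.continuous.comp_aestronglyMeasurable h.integrable.aestronglyMeasurable)
      (Filter.Eventually.of_forall fun x => ?_)
    have := hLip.norm_sub_le (f x) 0
    simpa [hT₀] using this
  · have h4 := ENNReal.Tendsto.const_mul (a := (C : ℝ≥0∞)) h1 (Or.inr ENNReal.coe_ne_top)
    rw [mul_zero] at h4
    refine tendsto_of_tendsto_of_tendsto_of_le_of_le tendsto_const_nhds h4 (fun _ => zero_le)
      fun j => ?_
    simp only
    rw [← lintegral_const_mul' _ _ ENNReal.coe_ne_top]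
    exact lintegral_mono fun x => hLe _ _
  · have hD : Filter.Tendsto (fun j => ∫⁻ x, ‖(deriv T (φ j x) - deriv T (f x)) • g x‖ₑ)
        Filter.atTop (𝓝 0) := by
      have h5 := tendsto_lintegral_of_dominated_convergence'
        (F := fun j x => ‖(deriv T (φ j x) - deriv T (f x)) • g x‖ₑ) (f := fun _ => 0)
        (μ := (volume : Measure (E n))) (fun x => ((C : ℝ≥0∞) + C) * ‖g x‖ₑ)
        (fun j => ((((hT'c.comp (φ j).continuous).aestronglyMeasurable).sub hTf).smul
          h.integrable_grad.aestronglyMeasurable).enorm)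
        (fun j => Filter.Eventually.of_forall fun x => ?_) ?_ ?_
      · simpa using h5
      · simp only [enorm_smul]
        exact mul_le_mul_left (enorm_sub_le.trans (add_le_add (hCe _) (hCe _))) _
      · rw [lintegral_const_mul' _ _ (by simp)]
        exact ENNReal.mul_ne_top (by simp) h.integrable_grad.2.ne
      · filter_upwards [h3] with x hx
        have h6 : Filter.Tendsto (fun j => (deriv T (φ j x) - deriv T (f x)) • g x) Filter.atTop
            (𝓝 ((deriv T (f x) - deriv T (f x)) • g x)) :=
          (((hT'c.tendsto _).comp hx).sub_const _).smul_const _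
        rw [sub_self, zero_smul] at h6
        simpa using h6.enorm
    have h4 := (ENNReal.Tendsto.const_mul (a := (C : ℝ≥0∞)) h2
      (Or.inr ENNReal.coe_ne_top)).add hD
    rw [mul_zero, add_zero] at h4
    refine tendsto_of_tendsto_of_tendsto_of_le_of_le tendsto_const_nhds h4 (fun _ => zero_le)
      fun j => ?_
    simp only
    rw [← lintegral_const_mul' _ _ ENNReal.coe_ne_top, ← lintegral_add_left' 
        ((aemeasurable_enorm_gradient_sub (φ j) h.integrable_grad).const_mul _)]
    refine lintegral_mono fun x => ?_
    simp only [TestFunction.coe_mk]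
    rw [gradient_comp hTd (testFunction_differentiable _)]
    have h5 : deriv T (φ j x) • gradient (φ j) x - deriv T (f x) • g x =
        deriv T (φ j x) • (gradient (φ j) x - g x) + (deriv T (φ j x) - deriv T (f x)) • g x := by
      rw [smul_sub, sub_smul]; abel
    rw [h5]
    refine (enorm_add_le _ _).trans (add_le_add_left ?_ _)
    rw [enorm_smul]
    exact mul_le_mul_left (hCe _) _

end IsZeroSobolev

/-! ### Geometry of Lipschitz domains -/

section Geometry

variable {Ω : Opens (E n)}

/-- Near each point of its closure, a Lipschitz domain contains truncated cones with a common
axis. This is what allows mollification with kernels shifted inwards. -/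
theorem HasLipschitzBoundary.exists_cone (hΩ : HasLipschitzBoundary (Ω : Set (E n))) {x₀ : E n}
    (hx₀ : x₀ ∈ closure (Ω : Set (E n))) :
    ∃ (a : E n) (ρ δ₀ : ℝ), 0 < ρ ∧ 0 < δ₀ ∧ ∀ y ∈ Ω, ‖y - x₀‖ < ρ → ∀ δ, 0 < δ → δ < δ₀ →
      ∀ z : E n, ‖z‖ ≤ 1 → y + δ • (a + z) ∈ Ω := by
  by_cases hx : x₀ ∈ Ω
  · obtain ⟨ε, hε, hball⟩ := Metric.isOpen_iff.1 Ω.isOpen x₀ hx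
    refine ⟨0, ε / 2, ε / 2, by positivity, by positivity, fun y _ hyρ δ hδ hδ' z hz => ?_⟩
    refine hball ?_
    rw [mem_ball_iff_norm]
    calc ‖y + δ • (0 + z) - x₀‖ = ‖(y - x₀) + δ • z‖ := by rw [zero_add]; congr 1; abel
      _ ≤ ‖y - x₀‖ + ‖δ • z‖ := norm_add_le _ _
      _ = ‖y - x₀‖ + δ * ‖z‖ := by rw [norm_smul, Real.norm_of_nonneg hδ.le]
      _ < ε := by nlinarith
  · have hfr : x₀ ∈ frontier (Ω : Set (E n)) := by
      rw [Ω.isOpen.frontier_eq]; exact ⟨hx₀, hx⟩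
    obtain ⟨e, he, K, ψ, hψ, U, hU, hiff⟩ := hΩ x₀ hfr
    obtain ⟨ε, hε, hball⟩ := Metric.mem_nhds_iff.1 hU
    have hK : (0 : ℝ) ≤ K := K.2
    have hden : (0 : ℝ) < 2 * (K + 2) := by positivity
    -- The slope `K + 1` of the axis outweighs both the slope of the graph and the unit vector `z`.
    refine ⟨-((K : ℝ) + 1) • e, ε / 2, ε / (2 * (K + 2)), by positivity, by positivity,
      fun y hy hyρ δ hδ hδ' z hz => ?_⟩
    rw [lt_div_iff₀ hden] at hδ'
    set y' := y + δ • (-((K : ℝ) + 1) • e + z) with hy'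
    have hyU : y ∈ U := hball (by rw [mem_ball_iff_norm]; linarith)
    have hy'U : y' ∈ U := by
      refine hball ?_
      rw [mem_ball_iff_norm]
      have h1 : ‖-((K : ℝ) + 1) • e + z‖ ≤ K + 2 := by
        refine (norm_add_le _ _).trans ?_
        rw [norm_smul, he, norm_neg, Real.norm_of_nonneg (by positivity)]
        linarith
      calc ‖y' - x₀‖ = ‖(y - x₀) + δ • (-((K : ℝ) + 1) • e + z)‖ := by
            rw [hy']; congr 1; abel
        _ ≤ ‖y - x₀‖ + δ * ‖-((K : ℝ) + 1) • e + z‖ := by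
            refine (norm_add_le _ _).trans ?_
            rw [norm_smul, Real.norm_of_nonneg hδ.le]
        _ < ε := by nlinarith
    have h2 := (hiff y hyU).1 hy
    refine (hiff y' hy'U).2 ?_
    set P := (Submodule.span ℝ {e})ᗮ.orthogonalProjectionOnto
    have hPe : P e = 0 :=
      Submodule.orthogonalProjectionOnto_orthogonalComplement_singleton_eq_zero e
    have hPy : P y' = P y + δ • P z := by
      rw [hy', map_add, map_smul, map_add, map_smul, hPe, smul_zero, zero_add]
    have h3 : |ψ (P y') - ψ (P y)| ≤ K * δ := by
      have h4 := hψ.dist_le_mul (P y') (P y)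
      rw [Real.dist_eq, dist_eq_norm, hPy, add_sub_cancel_left, norm_smul,
        Real.norm_of_nonneg hδ.le] at h4
      have h5 : ‖P z‖ ≤ 1 := (Submodule.norm_orthogonalProjectionOnto_apply_le _ z).trans hz
      rw [hPy]
      refine h4.trans (mul_le_mul_of_nonneg_left ?_ hK)
      nlinarith
    have h6 : inner ℝ e y' ≤ inner ℝ e y - δ * K := by
      have h7 : inner ℝ e z ≤ 1 := by
        have := real_inner_le_norm e z
        rw [he, one_mul] at this
        exact this.trans hz
      rw [hy', inner_add_right, inner_smul_right, inner_add_right, inner_smul_right,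
        real_inner_self_eq_norm_sq, he]
      nlinarith
    have h8 := abs_le.1 h3
    linarith [h8.1]

theorem HasLipschitzBoundary.exists_exterior_ball (hΩ : HasLipschitzBoundary (Ω : Set (E n)))
    {x₀ : E n} (hx₀ : x₀ ∈ frontier (Ω : Set (E n))) {r : ℝ} (hr : 0 < r) :
    ∃ (q : E n) (s : ℝ), 0 < s ∧ ‖q - x₀‖ < r ∧ ∀ y, ‖y - q‖ < s → y ∉ Ω := by
  obtain ⟨e, he, K, ψ, hψ, U, hU, hiff⟩ := hΩ x₀ hx₀
  obtain ⟨ε, hε, hball⟩ := Metric.mem_nhds_iff.1 hU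
  have hK : (0 : ℝ) ≤ K := K.2
  have hx : x₀ ∉ Ω := by
    rw [Ω.isOpen.frontier_eq] at hx₀; exact hx₀.2
  have h0 : ψ ((Submodule.span ℝ {e})ᗮ.orthogonalProjectionOnto x₀) ≤ inner ℝ e x₀ := by
    have := (hiff x₀ (mem_of_mem_nhds hU)).not.1 hx
    exact not_lt.1 this
  set t := min ε r / 4 with ht
  have htpos : 0 < t := by positivity
  have htε : 4 * t ≤ ε := by rw [ht]; linarith [min_le_left ε r]
  have htr : 4 * t ≤ r := by rw [ht]; linarith [min_le_right ε r]
  refine ⟨x₀ + t • e, t / (K + 1), by positivity, ?_, fun y hy => ?_⟩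
  · rw [add_sub_cancel_left, norm_smul, he, Real.norm_of_nonneg htpos.le]
    linarith
  · obtain ⟨z, rfl⟩ : ∃ z, y = x₀ + t • e + z := ⟨y - (x₀ + t • e), by abel⟩
    rw [add_sub_cancel_left, lt_div_iff₀ (by positivity)] at hy
    have hz := norm_nonneg z
    set P := (Submodule.span ℝ {e})ᗮ.orthogonalProjectionOnto
    have hPe : P e = 0 :=
      Submodule.orthogonalProjectionOnto_orthogonalComplement_singleton_eq_zero e
    have hPy : P (x₀ + t • e + z) = P x₀ + P z := by
      rw [map_add, map_add, map_smul, hPe, smul_zero, add_zero]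
    have hyU : x₀ + t • e + z ∈ U := by
      refine hball ?_
      rw [mem_ball_iff_norm, add_assoc, add_sub_cancel_left]
      refine (norm_add_le _ _).trans_lt ?_
      rw [norm_smul, he, Real.norm_of_nonneg htpos.le]
      nlinarith
    rw [show (x₀ + t • e + z ∈ Ω ↔ _) from hiff _ hyU, not_lt, hPy]
    have h4 := hψ.dist_le_mul (P x₀ + P z) (P x₀)
    rw [Real.dist_eq, dist_eq_norm, add_sub_cancel_left] at h4
    have h5 : ‖P z‖ ≤ ‖z‖ := Submodule.norm_orthogonalProjectionOnto_apply_le _ z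
    have h6 := (le_abs_self _).trans (h4.trans (mul_le_mul_of_nonneg_left h5 hK))
    have h7 : -‖z‖ ≤ inner ℝ e z := by
      have := abs_real_inner_le_norm e z
      rw [he, one_mul] at this
      exact (abs_le.1 this).1
    rw [inner_add_right, inner_add_right, inner_smul_right, real_inner_self_eq_norm_sq, he]
    nlinarith

theorem exists_mem_frontier_of_segment {x y : E n} (hx : x ∈ Ω) (hy : y ∉ Ω) :
    ∃ z ∈ segment ℝ x y, z ∈ frontier (Ω : Set (E n)) := by
  by_contra! h
  have hpre : IsPreconnected (segment ℝ x y) := (convex_segment x y).isPreconnected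
  have hsub : segment ℝ x y ⊆ (Ω : Set (E n)) ∪ (closure (Ω : Set (E n)))ᶜ := by
    intro z hz
    by_cases hzΩ : z ∈ Ω
    · exact Or.inl hzΩ
    · refine Or.inr fun hzc => h z hz ?_
      rw [Ω.isOpen.frontier_eq]
      exact ⟨hzc, hzΩ⟩
  have := hpre.subset_left_of_subset_union Ω.isOpen isClosed_closure.isOpen_compl
    (disjoint_compl_right.mono_left subset_closure) hsub ⟨x, left_mem_segment ℝ x y, hx⟩
  exact hy (this (right_mem_segment ℝ x y))

end Geometry

/-! ### Boundary values of Hölder continuous functions -/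

/-- The approximate boundary values of a function of class `W^{1,1}_0` vanish: otherwise a smooth
truncation of it would be of class `W^{1,1}` with zero gradient in a ball, while taking the two
values `0` and `1` on nonempty open subsets of that ball. -/
theorem IsZeroSobolev.exists_abs_lt_near_frontier {Ω : Opens (E n)}
    (hΩ : HasLipschitzBoundary (Ω : Set (E n))) {f : E n → ℝ} {g : E n → E n}
    (h : IsZeroSobolev Ω f g) {x₀ : E n} (hx₀ : x₀ ∈ frontier (Ω : Set (E n))) {r c : ℝ}
    (hr : 0 < r) (hc : 0 < c) : ∃ p ∈ Ω, ‖p - x₀‖ < r ∧ |f p| < c := by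
  by_contra! hcon
  -- The truncation `T` vanishes at `0` and equals `1` near the values of `f` close to `x₀`.
  let b : ContDiffBump (0 : ℝ) := ⟨c / 4, c / 2, by positivity, by linarith⟩
  set T : ℝ → ℝ := fun s => 1 - b s with hTdef
  have hT : ContDiff ℝ (⊤ : ℕ∞) T := contDiff_const.sub b.contDiff
  have hT0 : T 0 = 0 := by simp [hTdef, b.one_of_mem_closedBall (by simp [b.rIn_pos.le] :
    (0 : ℝ) ∈ Metric.closedBall (0 : ℝ) b.rIn)]
  have hb1 : ∀ s : ℝ, c / 2 < |s| → b s = 0 := fun s hs =>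
    b.zero_of_le_dist (by rw [Real.dist_eq, sub_zero]; exact hs.le)
  have hT1 : ∀ s : ℝ, c / 2 < |s| → T s = 1 := fun s hs => by simp [hTdef, hb1 s hs]
  have hT'0 : ∀ s : ℝ, c / 2 < |s| → deriv T s = 0 := by
    intro s hs
    have h1 : T =ᶠ[𝓝 s] fun _ => 1 := by
      filter_upwards [(isOpen_lt continuous_const continuous_abs).mem_nhds hs] with u hu
      exact hT1 u hu
    rw [h1.deriv_eq, deriv_const]
  have hcs : HasCompactSupport (deriv T) := by
    refine HasCompactSupport.intro (isCompact_closedBall (0 : ℝ) (c / 2)) fun s hs => hT'0 s ?_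
    simpa using hs
  obtain ⟨C, hC⟩ := (hT.continuous_deriv (by simp)).bounded_above_of_compact_support hcs
  have hC' : ∀ s, ‖deriv T s‖₊ ≤ C.toNNReal := fun s => by
    rw [← NNReal.coe_le_coe, coe_nnnorm]
    exact (hC s).trans (Real.le_coe_toNNReal C)
  have hW := h.comp hT hT0 hC'
  set W := fun x => T (f x) with hWdef
  set G := fun x => deriv T (f x) • g x with hGdef
  have hW1 : ∀ x ∈ Ω, ‖x - x₀‖ < r → W x = 1 := fun x hx hxr =>
    hT1 _ (by linarith [hcon x hx hxr])
  have hG0 : ∀ x, ‖x - x₀‖ < r → G x = 0 := by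
    intro x hxr
    by_cases hx : x ∈ Ω
    · simp [hGdef, hT'0 _ (by linarith [hcon x hx hxr] : c / 2 < |f x|)]
    · exact hW.grad_eq_zero x hx
  obtain ⟨q, s₂, hs₂, hq, hqout⟩ := hΩ.exists_exterior_ball hx₀ (half_pos hr)
  obtain ⟨p, hpΩ, hp⟩ := Metric.mem_closure_iff.1 (frontier_subset_closure hx₀) (r / 2)
    (half_pos hr)
  rw [dist_comm, dist_eq_norm] at hp
  obtain ⟨s₁, hs₁, hpball⟩ := Metric.isOpen_iff.1 Ω.isOpen p hpΩ
  set δ := min (min s₁ s₂) (r / 2) / 2 with hδ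
  have hδ0 : 0 < δ := by positivity
  have hδ1 : δ < s₁ := by
    have := (min_le_left (min s₁ s₂) (r / 2)).trans (min_le_left _ _); rw [hδ]; linarith
  have hδ2 : δ < s₂ := by
    have := (min_le_left (min s₁ s₂) (r / 2)).trans (min_le_right _ _); rw [hδ]; linarith
  have hδ3 : δ < r / 2 := by
    have := (min_le_right (min s₁ s₂) (r / 2)); rw [hδ]; linarith
  obtain ⟨D, -, hD⟩ := exists_isMollifier (0 : E n)
  obtain ⟨κ, hκ, -, -⟩ := hD δ hδ0
  rw [norm_zero, zero_add, mul_one] at hκ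
  have hgrad : ∀ x ∈ Metric.ball x₀ (r / 2), ‖fderiv ℝ (mollify κ W) x‖ ≤ 0 := by
    intro x hx
    rw [mem_ball_iff_norm] at hx
    rw [← norm_gradient_eq_norm_fderiv, hW.gradient_mollify hκ,
      hκ.mollify_congr (h' := fun _ => (0 : E n)) fun y hy => hG0 y ?_, hκ.mollify_const, norm_zero]
    have : y - x₀ = (x - x₀) - (x - y) := by abel
    rw [this]
    exact (norm_sub_le _ _).trans_lt (by linarith)
  have hconst := (convex_ball x₀ (r / 2)).norm_image_sub_le_of_norm_fderiv_le
    (fun x _ => (hκ.contDiff_mollify hW.integrable.locallyIntegrable).differentiable (by simp) x)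
    hgrad (mem_ball_iff_norm.2 hp) (mem_ball_iff_norm.2 hq)
  have hWp : mollify κ W p = 1 := by
    rw [hκ.mollify_congr (h' := fun _ => (1 : ℝ)) fun y hy => ?_, hκ.mollify_const]
    refine hW1 y (hpball ?_) ?_
    · rw [mem_ball_iff_norm, norm_sub_rev]; linarith
    · have : y - x₀ = (p - x₀) - (p - y) := by abel
      rw [this]
      exact (norm_sub_le _ _).trans_lt (by linarith)
  have hWq : mollify κ W q = 0 := by
    rw [hκ.mollify_congr (h' := fun _ => (0 : ℝ)) fun y hy => ?_, hκ.mollify_const]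
    refine hW.eq_zero y (hqout y ?_)
    rw [norm_sub_rev]; linarith
  rw [hWp, hWq] at hconst
  norm_num at hconst

/-- A Hölder continuous function of class `W^{1,1}_0` stays Hölder continuous, with the same
constant, when extended by zero. -/
theorem IsZeroSobolev.abs_sub_le_of_holderOnWith {Ω : Opens (E n)}
    (hΩ : HasLipschitzBoundary (Ω : Set (E n))) {f : E n → ℝ} {g : E n → E n}
    (h : IsZeroSobolev Ω f g) {C γ : ℝ≥0} (hf : HolderOnWith C γ f Ω) (x y : E n) :
    |f x - f y| ≤ C * ‖x - y‖ ^ (γ : ℝ) := by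
  have hin : ∀ x ∈ Ω, ∀ y ∈ Ω, |f x - f y| ≤ C * ‖x - y‖ ^ (γ : ℝ) := fun x hx y hy => by
    have := hf.dist_le hx hy
    rwa [Real.dist_eq, dist_eq_norm] at this
  have hout : ∀ x ∈ Ω, ∀ y ∉ Ω, |f x| ≤ C * ‖x - y‖ ^ (γ : ℝ) := by
    intro x hx y hy
    obtain ⟨z, hz, hzf⟩ := exists_mem_frontier_of_segment hx hy
    have hxz : ‖x - z‖ ≤ ‖x - y‖ := by
      rw [norm_sub_rev x z, norm_sub_rev x y]
      obtain ⟨a, b, ha, hb, hab, rfl⟩ := hz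
      have : a • x + b • y - x = b • (y - x) := by
        rw [eq_sub_iff_add_eq.2 hab, sub_smul, one_smul, smul_sub]; abel
      rw [this, norm_smul, Real.norm_of_nonneg hb]
      exact mul_le_of_le_one_left (norm_nonneg _) (by linarith)
    have hle : ∀ η : ℝ, 0 < η → |f x| ≤ η + C * (‖x - y‖ + η) ^ (γ : ℝ) := by
      intro η hη
      obtain ⟨p, hp, hpz, hpη⟩ := h.exists_abs_lt_near_frontier hΩ hzf hη hη
      have h1 := hin x hx p hp
      have h2 : ‖x - p‖ ≤ ‖x - y‖ + η := by
        have : x - p = (x - z) - (p - z) := by abel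
        rw [this]
        exact (norm_sub_le _ _).trans (by linarith)
      have h3 : |f x| ≤ |f p| + |f x - f p| := by
        have := abs_add_le (f p) (f x - f p)
        rwa [add_sub_cancel] at this
      have h4 := mul_le_mul_of_nonneg_left
        (Real.rpow_le_rpow (norm_nonneg (x - p)) h2 γ.2) C.2
      exact h3.trans (add_le_add hpη.le (h1.trans h4))
    have hcont : ContinuousAt (fun η : ℝ => η + C * (‖x - y‖ + η) ^ (γ : ℝ)) 0 :=
      continuousAt_id.add (continuousAt_const.mul
        ((continuousAt_const.add continuousAt_id).rpow_const (Or.inr γ.2)))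
    have htend : Filter.Tendsto (fun η : ℝ => η + C * (‖x - y‖ + η) ^ (γ : ℝ)) (𝓝[>] 0)
        (𝓝 (C * ‖x - y‖ ^ (γ : ℝ))) := by
      have := hcont.tendsto
      simp only [add_zero, zero_add] at this
      exact this.mono_left nhdsWithin_le_nhds
    exact ge_of_tendsto htend (eventually_mem_nhdsWithin.mono fun η hη => hle η hη)
  by_cases hx : x ∈ Ω <;> by_cases hy : y ∈ Ω
  · exact hin x hx y hy
  · rw [h.eq_zero y hy, sub_zero]; exact hout x hx y hy
  · rw [h.eq_zero x hx, zero_sub, abs_neg, norm_sub_rev]; exact hout y hy x hx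
  · rw [h.eq_zero x hx, h.eq_zero y hy, sub_zero, abs_zero]
    positivity

theorem exists_abs_le_of_holderOnWith {Ω : Opens (E n)}
    (hb : Bornology.IsBounded (Ω : Set (E n))) {f : E n → ℝ} {C γ : ℝ≥0}
    (hf : HolderOnWith C γ f Ω) : ∃ B, ∀ x ∈ Ω, |f x| ≤ B := by
  rcases (Ω : Set (E n)).eq_empty_or_nonempty with h | ⟨y, hy⟩
  · exact ⟨0, fun x hx => absurd (show x ∈ (Ω : Set (E n)) from hx) (by simp [h])⟩
  · obtain ⟨R, hR⟩ := Metric.isBounded_iff.1 hb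
    refine ⟨|f y| + C * R ^ (γ : ℝ), fun x hx => ?_⟩
    have h1 := hf.dist_le hx hy
    rw [Real.dist_eq] at h1
    have h2 := mul_le_mul_of_nonneg_left
      (Real.rpow_le_rpow dist_nonneg (hR hx hy) γ.2) C.2
    have h3 := abs_add_le (f y) (f x - f y)
    rw [add_sub_cancel] at h3
    exact h3.trans (add_le_add le_rfl (h1.trans h2))

/-! ### Balance conditions -/

theorem mem_of_isClosed_of_ae_restrict {X : Type*} [TopologicalSpace X] {U : Set (E n)}
    (hU : IsOpen U) {u : E n → X} (hu : ContinuousOn u U) {s : Set X} (hs : IsClosed s)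
    (h : ∀ᵐ x ∂(volume.restrict U), u x ∈ s) {x : E n} (hx : x ∈ U) : u x ∈ s := by
  by_contra hxs
  have hopen : IsOpen (U ∩ u ⁻¹' sᶜ) := hu.isOpen_inter_preimage hU hs.isOpen_compl
  have hpos : 0 < volume (U ∩ u ⁻¹' sᶜ) := hopen.measure_pos volume ⟨x, hx, hxs⟩
  rw [ae_restrict_iff' hU.measurableSet, ae_iff] at h
  refine hpos.ne' (measure_mono_null (fun y hy => ?_) h)
  exact fun hcon => hy.2 (hcon hy.1)

/-- A balance condition between `M x` and `M y` for neighbouring points `x` and `y`, along finitely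
many directions `e j` which determine `M` through the seminorms `‖P j ·‖`. -/
def DirectionalBalance (Ω : Opens (E n)) (M : E n → E n → ℝ) (γ : ℝ) : Prop :=
  ∃ (k : ℕ) (P : Fin k → E n →L[ℝ] E n) (e : Fin k → E n) (C : ℝ), 0 ≤ C ∧
    (∀ j ξ, ‖P j ξ‖ ≤ ‖ξ‖) ∧
    (∀ᵐ x ∂(volume.restrict Ω), ∀ ξ, M x ξ = ∑ j, M x (‖P j ξ‖ • e j)) ∧
    ∀ j, ∀ x ∈ Ω, ∀ y ∈ Ω, ∀ r : ℝ, 0 < r → r ≤ 1 → ‖x - y‖ < r →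
      ∀ t, 0 ≤ t → t ≤ r ^ (γ - 1) → M x (t • e j) ≤ M y ((C * t) • e j) + 1

/-- By continuity of `M`, the balance condition on essential suprema and infima over balls becomes a
pointwise one. -/
theorem le_add_one_of_ballBalance {Ω : Opens (E n)} {M : E n → E n → ℝ}
    (hM : IsWeakNFunction Ω M)
    (hMc : ContinuousOn (fun p : E n × E n => M p.1 p.2) ((Ω : Set (E n)) ×ˢ univ))
    {m : E n → ℝ → ℝ} {e : E n}
    (hm : ∀ᵐ x ∂(volume.restrict Ω), ∀ t, 0 ≤ t → m x t = M x (t • e)) {γ c C : ℝ} (hc : 1 ≤ c)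
    (hC : 0 ≤ C) (hbal : BallBalance Ω m γ c C) {x y : E n} (hx : x ∈ Ω) (hy : y ∈ Ω) {r : ℝ}
    (hr : 0 < r) (hr1 : r ≤ 1) (hxy : ‖x - y‖ < r) {t : ℝ} (ht : 0 ≤ t)
    (htr : t ≤ r ^ (γ - 1)) : M x (t • e) ≤ M y ((C * t) • e) + 1 := by
  set B := Metric.ball x r ∩ (Ω : Set (E n)) with hB
  have hBo : IsOpen B := Metric.isOpen_ball.inter Ω.isOpen
  have hxB : x ∈ B := ⟨Metric.mem_ball_self hr, hx⟩
  have hyB : y ∈ B := ⟨by rw [mem_ball_iff_norm, norm_sub_rev]; exact hxy, hy⟩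
  have hcont : ∀ ξ : E n, ContinuousOn (fun z => ENNReal.ofReal (M z ξ)) B := fun ξ => by
    refine ENNReal.continuous_ofReal.comp_continuousOn ?_
    exact hMc.comp (f := fun z : E n => (z, ξ)) (by fun_prop)
      (fun z hz => ⟨hz.2, mem_univ _⟩)
  have hmB : ∀ᵐ x ∂(volume.restrict B), ∀ t, 0 ≤ t → m x t = M x (t • e) :=
    ae_restrict_of_ae_restrict_of_subset inter_subset_right hm
  have hCt : 0 ≤ C * t := mul_nonneg hC ht
  have h1 : ENNReal.ofReal (M x (t • e)) ≤ ballSup Ω m (Metric.ball x r) t := by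
    refine mem_of_isClosed_of_ae_restrict hBo (hcont (t • e)) isClosed_Iic ?_ hxB
    filter_upwards [ENNReal.ae_le_essSup (μ := volume.restrict B)
      (fun y => ENNReal.ofReal (m y t)), hmB] with z hz hz'
    rw [mem_Iic, ← hz' t ht]
    exact hz
  have h2 : ballInf Ω m (Metric.ball x r) (C * t) ≤ ENNReal.ofReal (M y ((C * t) • e)) := by
    refine mem_of_isClosed_of_ae_restrict hBo (hcont ((C * t) • e)) isClosed_Ici ?_ hyB
    filter_upwards [ae_essInf_le (μ := volume.restrict B)
      (f := fun y => ENNReal.ofReal (m y (C * t))), hmB] with z hz hz'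
    rw [mem_Ici, ← hz' _ hCt]
    exact hz
  have h3 := hbal x r hr hr1 t ht (htr.trans (le_mul_of_one_le_left (Real.rpow_nonneg hr.le _) hc))
  have h4 := h1.trans (h3.trans (add_le_add h2 le_rfl))
  have hpos := hM.nonneg y hy ((C * t) • e)
  rw [← ENNReal.ofReal_one, ← ENNReal.ofReal_add hpos zero_le_one,
    ENNReal.ofReal_le_ofReal_iff (by linarith)] at h4
  exact h4

theorem BalanceIso.directionalBalance (hn : 1 ≤ n) {Ω : Opens (E n)} {M : E n → E n → ℝ}
    (hM : IsWeakNFunction Ω M)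
    (hMc : ContinuousOn (fun p : E n × E n => M p.1 p.2) ((Ω : Set (E n)) ×ˢ univ)) {γ : ℝ}
    (h : BalanceIso Ω M γ) : DirectionalBalance Ω M γ := by
  obtain ⟨m, -, hMm, c, C, hc, hC, hbal⟩ := h
  set e : E n := EuclideanSpace.single ⟨0, hn⟩ 1 with he
  have hen : ‖e‖ = 1 := by simp [he]
  have hm : ∀ x ∈ Ω, ∀ t, 0 ≤ t → m x t = M x (t • e) := fun x hx t ht => by
    rw [hMm x hx, norm_smul, hen, mul_one, Real.norm_of_nonneg ht]
  have hm' : ∀ᵐ x ∂(volume.restrict Ω), ∀ t, 0 ≤ t → m x t = M x (t • e) := by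
    filter_upwards [ae_restrict_mem Ω.isOpen.measurableSet] with x hx using hm x hx
  refine ⟨1, fun _ => ContinuousLinearMap.id ℝ _, fun _ => e, C, by linarith,
    fun j ξ => le_rfl, ?_, fun j x hx y hy r hr hr1 hxy t ht htr =>
      le_add_one_of_ballBalance hM hMc hm' hc (by linarith) hbal hx hy hr hr1 hxy ht htr⟩
  filter_upwards [ae_restrict_mem Ω.isOpen.measurableSet] with x hx ξ
  rw [Fin.sum_univ_one, ← hm x hx _ (norm_nonneg _), hMm x hx]
  rfl

theorem BalanceOrt.directionalBalance {Ω : Opens (E n)} {M : E n → E n → ℝ}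
    (hM : IsWeakNFunction Ω M)
    (hMc : ContinuousOn (fun p : E n × E n => M p.1 p.2) ((Ω : Set (E n)) ×ˢ univ)) {γ : ℝ}
    (h : BalanceOrt Ω M γ) : DirectionalBalance Ω M γ := by
  obtain ⟨m, hmN, hMm, c, C, hc, hC, hbal⟩ := h
  set e : Fin n → E n := fun i => EuclideanSpace.single i 1 with he
  have hm : ∀ᵐ x ∂(volume.restrict Ω), ∀ i t, 0 ≤ t → m i x t = M x (t • e i) := by
    filter_upwards [ae_restrict_mem Ω.isOpen.measurableSet,
      ae_all_iff.2 fun i => (hmN i).map_zero] with x hx h0 i t ht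
    rw [hMm x hx, Finset.sum_eq_single i]
    · simp [he, abs_of_nonneg ht]
    · intro j _ hj
      have := h0 j
      simpa [he, hj] using this
    · simp
  refine ⟨n, fun i => (EuclideanSpace.proj i : E n →L[ℝ] ℝ).smulRight (e i), e, C, by linarith,
    fun j ξ => ?_, ?_, fun j x hx y hy r hr hr1 hxy t ht htr =>
      le_add_one_of_ballBalance hM hMc (hm.mono fun x h => h j) hc (by linarith) (hbal j) hx hy hr
        hr1 hxy ht htr⟩
  · simpa [norm_smul, he] using PiLp.norm_apply_le ξ j
  · filter_upwards [hm, ae_restrict_mem Ω.isOpen.measurableSet] with x h1 hx ξ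
    rw [hMm x hx]
    refine Finset.sum_congr rfl fun i _ => ?_
    rw [← h1 i _ (norm_nonneg _)]
    simp [norm_smul, he]

/-- A supporting line of the gauge `Φ` at a moderate point `t₀ ≤ T / 2` lies below a multiple of
the gauge `Ψ`, up to lower order terms, if `Φ` is controlled by `Ψ` on `[0, T]`. -/
theorem IsConvexGauge.supporting_line_le {Φ Ψ : ℝ → ℝ} (hΦ : IsConvexGauge Φ)
    (hΨ : IsConvexGauge Ψ) {C T t₀ s : ℝ} (hT : 1 ≤ T) (ht₀T : t₀ ≤ T / 2)
    (hs₀ : 0 ≤ s) (hs : ∀ t, 0 ≤ t → Φ t₀ + s * (t - t₀) ≤ Φ t)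
    (hbal : ∀ t, 0 ≤ t → t ≤ T → Φ t ≤ Ψ (C * t) + 1) {t : ℝ} (ht : 0 ≤ t) :
    Φ t₀ + s * (t - t₀) ≤ 2 * Ψ (C * t) + 1 + 2 * t := by
  rcases le_or_gt t T with h | h
  · linarith [hs t ht, hbal t ht h, hΨ.nonneg (C * t)]
  · have hT0 : 0 < T := by linarith
    have htpos : 0 < t := by linarith
    have h1 := hs T hT0.le
    have h2 := hbal T hT0.le le_rfl
    have h3 : Ψ (C * T) ≤ T / t * Ψ (C * t) := by
      have := hΨ.map_smul_le_mul (div_nonneg hT0.le ht) (div_le_one_of_le₀ h.le ht) (C * t)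
      have h4 : (T / t) • (C * t) = C * T := by
        rw [smul_eq_mul]; field_simp
      rwa [h4] at this
    have h5 : t * Ψ (C * T) ≤ T * Ψ (C * t) := by
      have := mul_le_mul_of_nonneg_left h3 ht
      calc t * Ψ (C * T) ≤ t * (T / t * Ψ (C * t)) := this
        _ = T * Ψ (C * t) := by field_simp
    have hΦT := hΦ.nonneg T
    have hΦ₀ := hΦ.nonneg t₀
    -- The slope is at most `2 Φ(T) / T`, since the line passes below `Φ` at `T`.
    have h6 : s * T ≤ 2 * Φ T := by nlinarith
    have h7 : T * (Φ t₀ + s * (t - t₀)) ≤ 2 * t * Φ T := by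
      have h8 : T * (Φ t₀ + s * (t - t₀)) ≤ T * Φ T + (s * T) * (t - T) := by nlinarith
      nlinarith
    have h9 : T * (Φ t₀ + s * (t - t₀)) ≤ T * (2 * Ψ (C * t)) + 2 * t := by nlinarith
    have h10 : 2 * t ≤ T * (2 * t) := by nlinarith
    have h11 : T * (Φ t₀ + s * (t - t₀)) ≤ T * (2 * Ψ (C * t) + 1 + 2 * t) := by nlinarith
    exact le_of_mul_le_mul_left h11 hT0

theorem IsConvexGauge.comp_smul {V : Type*} [NormedAddCommGroup V] [NormedSpace ℝ V] {Φ : V → ℝ}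
    (h : IsConvexGauge Φ) (e : V) : IsConvexGauge fun t : ℝ => Φ (t • e) where
  nonneg t := h.nonneg _
  map_zero := by simp [h.map_zero]
  convex := by
    have := h.convex.comp_linearMap ((LinearMap.id : ℝ →ₗ[ℝ] ℝ).smulRight e)
    simpa [Function.comp_def] using this
  even t := by rw [neg_smul, ← h.even]
  continuous := h.continuous.comp (by fun_prop)

/-! ### Domination of mollified fields -/

/-- All multiples of the field `g` have finite modular. -/
def HasFiniteModulars (Ω : Opens (E n)) (M : E n → E n → ℝ) (g : E n → E n) : Prop :=
  ∀ l : ℝ, modular Ω M (fun x => l • g x) < ∞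

/-- The modular densities of mollified fields of size `r ^ (γ - 1)` are dominated by mollifications
of one integrable function. -/
def HasDomination (Ω : Opens (E n)) (M : E n → E n → ℝ) (γ : ℝ) : Prop :=
  ∀ g : E n → E n, Integrable g → (∀ x ∉ Ω, g x = 0) → HasFiniteModulars Ω M g → ∀ R : ℝ,
    ∃ (G H : E n → ℝ) (c r₀ : ℝ), Integrable G ∧ IntegrableOn H Ω ∧ 0 ≤ c ∧ 0 < r₀ ∧
      ∀ (κ : E n → ℝ) (r : ℝ), 0 < r → r < r₀ → IsMollifier κ r →
        (∀ x, ‖mollify κ g x‖ ≤ R * r ^ (γ - 1)) →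
        ∀ᵐ x ∂(volume.restrict Ω), M x (mollify κ g x) ≤ c * mollify κ G x + H x

/-- Bounded fields need no balance condition. -/
theorem hasDomination_one {Ω : Opens (E n)} {M : E n → E n → ℝ}
    (hb : Bornology.IsBounded (Ω : Set (E n))) (hM : IsWeakNFunction Ω M) :
    HasDomination Ω M 1 := by
  intro g _ _ _ R
  obtain ⟨B, -, hB⟩ := hM.exists_bound_of_norm_le R
  refine ⟨fun _ => 0, fun _ => B, 0, 1, integrable_zero _ _ _,
    integrableOn_const (volume_ne_top_of_isBounded hb), le_rfl, one_pos,
    fun κ r _ _ _ hR => ?_⟩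
  filter_upwards [hB] with x hx
  rw [zero_mul, zero_add]
  refine hx _ ((hR x).trans ?_)
  simp

theorem HasFiniteModulars.integrableOn {Ω : Opens (E n)} {M : E n → E n → ℝ}
    (hM : IsWeakNFunction Ω M) {g : E n → E n} (h : HasFiniteModulars Ω M g)
    (hg : AEStronglyMeasurable g (volume.restrict Ω)) (l : ℝ) :
    IntegrableOn (fun x => M x (l • g x)) Ω := by
  refine ⟨(aemeasurable_caratheodory hM.measurable hM.continuous
    (hg.const_smul l)).aestronglyMeasurable, ?_⟩
  rw [hasFiniteIntegral_iff_ofReal]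
  · exact h l
  · filter_upwards [hM.ae_isConvexGauge] with x hx using hx.nonneg _

theorem IsMollifier.norm_map_mollify_le {κ : E n → ℝ} {r : ℝ} (hκ : IsMollifier κ r)
    {g : E n → E n} (hg : Integrable g) (P : E n →L[ℝ] E n) (x : E n) :
    ‖P (mollify κ g x)‖ ≤ ∫ t, κ t * ‖P (g (x - t))‖ := by
  rw [mollify, ← P.integral_comp_comm (hκ.integrable_smul hg.locallyIntegrable x)]
  refine (norm_integral_le_integral_norm _).trans (le_of_eq ?_)
  refine integral_congr_ae (Filter.Eventually.of_forall fun t => ?_)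
  simp only
  rw [map_smul, norm_smul, Real.norm_of_nonneg (hκ.nonneg t)]

theorem ae_sub_left {p : E n → Prop} (h : ∀ᵐ y, p y) (x : E n) : ∀ᵐ t : E n, p (x - t) :=
  (Measure.measurePreserving_sub_left volume x).quasiMeasurePreserving.ae h

/-- Under a balance condition, the supporting line of `M x` at the mollified gradient stays below
`M y` for all `y` near `x`, and integrating it against the kernel yields the domination. The `Δ₂`
condition allows to assume that the mollified gradient is in the range of the balance condition. -/
theorem DirectionalBalance.hasDomination {Ω : Opens (E n)} {M : E n → E n → ℝ}
    (hb : Bornology.IsBounded (Ω : Set (E n))) (hM : IsWeakNFunction Ω M) (hΔ : DeltaTwo Ω M)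
    {γ : ℝ} (hγ₀ : 0 ≤ γ) (hγ₁ : γ ≤ 1) (h : DirectionalBalance Ω M γ) :
    HasDomination Ω M γ := by
  obtain ⟨k, P, e, C, hC, hP, hsum, hbal⟩ := h
  intro g hg hg0 hfin R
  -- Division by `l` brings fields of size `R r ^ (γ - 1)` below half of `T := (2 r) ^ (γ - 1)`, the
  -- bound up to which the balance condition holds on balls of radius `2 r`.
  set l : ℝ := 4 * |R| + 1 with hl
  have hl1 : 1 ≤ l := by rw [hl]; linarith [abs_nonneg R]
  have hl0 : 0 < l := by linarith
  obtain ⟨c, H, hc, hH, hΔl⟩ := hΔ.exists_bound_smul hb hM l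
  set ζ : E n → E n := fun y => (C / l) • g y with hζ
  set G : E n → ℝ := indicator Ω fun y => 2 * M y (ζ y) + 1 + 2 * ‖l⁻¹ • g y‖ with hG
  have hΩ := Ω.isOpen.measurableSet
  have hGi : Integrable G := by
    rw [hG, integrable_indicator_iff hΩ]
    exact (((hfin.integrableOn hM hg.aestronglyMeasurable.restrict (C / l)).const_mul 2).add
      (integrableOn_const (volume_ne_top_of_isBounded hb))).add
      (((hg.smul l⁻¹).norm.integrableOn).const_mul 2)
  refine ⟨G, H, c * k, 1 / 2, hGi, hH, by positivity, by norm_num,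
    fun κ r hr hr' hκ hR => ?_⟩
  set T : ℝ := (2 * r) ^ (γ - 1) with hT
  have hT1 : 1 ≤ T := Real.one_le_rpow_of_pos_of_le_one_of_nonpos (by positivity) (by linarith)
    (by linarith)
  have hTr : r ^ (γ - 1) ≤ 2 * T := by
    rw [hT, Real.mul_rpow (by norm_num) hr.le, ← mul_assoc]
    refine le_mul_of_one_le_left (Real.rpow_nonneg hr.le _) ?_
    have : (2 : ℝ) ^ (-1 : ℝ) ≤ 2 ^ (γ - 1) :=
      Real.rpow_le_rpow_of_exponent_le (by norm_num) (by linarith)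
    rw [Real.rpow_neg_one] at this
    linarith
  -- Points at which everything that holds almost everywhere on `Ω` does hold.
  have hgood : ∀ᵐ y, y ∈ (Ω : Set (E n)) → IsConvexGauge (M y) ∧
      ∀ ξ, M y ξ = ∑ j, M y (‖P j ξ‖ • e j) := by
    rw [← ae_restrict_iff' hΩ]
    exact hM.ae_isConvexGauge.and hsum
  filter_upwards [hΔl, hM.ae_isConvexGauge, hsum, ae_restrict_mem hΩ] with x hx1 hx2 hx3 hxΩ
  set ξ : E n := l⁻¹ • mollify κ g x with hξ
  have hlξ : mollify κ g x = l • ξ := by rw [hξ, smul_smul, mul_inv_cancel₀ hl0.ne', one_smul]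
  have hξn : ‖ξ‖ ≤ T / 2 := by
    rw [hξ, norm_smul, norm_inv, Real.norm_of_nonneg hl0.le, inv_mul_le_iff₀ hl0]
    have h1 : R * r ^ (γ - 1) ≤ |R| * (2 * T) :=
      mul_le_mul (le_abs_self R) hTr (Real.rpow_nonneg hr.le _) (abs_nonneg R)
    refine ((hR x).trans h1).trans ?_
    rw [hl]; nlinarith [abs_nonneg R]
  have hξm : ξ = mollify κ (fun y => l⁻¹ • g y) x := by
    rw [hξ, mollify, mollify, ← integral_smul]
    refine integral_congr_ae (Filter.Eventually.of_forall fun t => smul_comm _ _ _)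
  have hgl : Integrable fun y => l⁻¹ • g y := hg.smul l⁻¹
  have key : ∀ j, M x (‖P j ξ‖ • e j) ≤ mollify κ G x := by
    intro j
    have hΦ := hx2.comp_smul (e j)
    set t₀ := ‖P j ξ‖ with ht₀
    have ht₀T : t₀ ≤ T / 2 := (hP j ξ).trans hξn
    obtain ⟨s, hs0, hs⟩ := hΦ.exists_supporting_line (norm_nonneg (P j ξ))
    have hI1 : Integrable fun t => κ t * ‖P j (l⁻¹ • g (x - t))‖ := by
      have := hκ.integrable_smul ((P j).integrable_comp hgl).norm.locallyIntegrable x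
      exact this
    have hI2 : Integrable fun t => κ t * (M x (t₀ • e j) - s * t₀) := hκ.integrable.mul_const _
    have hle : t₀ ≤ ∫ t, κ t * ‖P j (l⁻¹ • g (x - t))‖ := by
      rw [ht₀, hξm]
      exact hκ.norm_map_mollify_le hgl (P j) x
    calc M x (t₀ • e j) ≤ (M x (t₀ • e j) - s * t₀) +
          s * ∫ t, κ t * ‖P j (l⁻¹ • g (x - t))‖ := by nlinarith
      _ = ∫ t, (κ t * (M x (t₀ • e j) - s * t₀) + s * (κ t * ‖P j (l⁻¹ • g (x - t))‖)) := by
          rw [integral_add hI2 (hI1.const_mul s), integral_mul_const, hκ.integral_eq_one, one_mul,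
            integral_const_mul]
      _ ≤ mollify κ G x := by
          refine integral_mono_ae (hI2.add (hI1.const_mul s))
            (hκ.integrable_smul hGi.locallyIntegrable x) ?_
          filter_upwards [ae_sub_left hgood x] with t ht
          have hrw : κ t * (M x (t₀ • e j) - s * t₀) + s * (κ t * ‖P j (l⁻¹ • g (x - t))‖) =
              κ t * (M x (t₀ • e j) + s * (‖P j (l⁻¹ • g (x - t))‖ - t₀)) := by ring
          simp only [smul_eq_mul]
          rw [hrw]
          by_cases hκt : κ t = 0
          · simp [hκt]
          refine mul_le_mul_of_nonneg_left ?_ (hκ.nonneg t)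
          by_cases hy : x - t ∈ Ω
          · obtain ⟨hy1, hy2⟩ := ht hy
            have hxy : ‖x - (x - t)‖ < 2 * r := by
              rw [sub_sub_cancel]
              linarith [hκ.norm_le t hκt]
            have h1 := hΦ.supporting_line_le (hy1.comp_smul (e j)) hT1 ht₀T hs0 hs
              (fun t' ht' ht'T => hbal j x hxΩ (x - t) hy (2 * r) (by positivity) (by linarith)
                hxy t' ht' ht'T) (norm_nonneg (P j (l⁻¹ • g (x - t))))
            have h2 : M (x - t) ((C * ‖P j (l⁻¹ • g (x - t))‖) • e j) ≤ M (x - t) (ζ (x - t)) := by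
              have h3 : C * ‖P j (l⁻¹ • g (x - t))‖ = ‖P j (ζ (x - t))‖ := by
                simp only [hζ, map_smul, norm_smul, norm_div, norm_inv, Real.norm_of_nonneg hC]
                ring
              rw [h3, hy2 (ζ (x - t))]
              exact Finset.single_le_sum (f := fun i => M (x - t) (‖P i (ζ (x - t))‖ • e i))
                (fun i _ => hy1.nonneg _) (Finset.mem_univ j)
            rw [hG, indicator_of_mem (show x - t ∈ (Ω : Set (E n)) from hy)]
            have h4 := hP j (l⁻¹ • g (x - t))
            linarith
          · rw [hG, indicator_of_notMem (show x - t ∉ (Ω : Set (E n)) from hy), hg0 _ hy]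
            have := hs 0 le_rfl
            simpa [hΦ.map_zero, hx2.map_zero] using this
  have hsumle : M x ξ ≤ k * mollify κ G x := by
    rw [hx3 ξ]
    refine (Finset.sum_le_sum fun j _ => key j).trans (le_of_eq ?_)
    simp
  rw [hlξ]
  refine (hx1.2 ξ).trans ?_
  have := mul_le_mul_of_nonneg_left hsumle hc
  linarith

/-! ### Modular approximation by test functions -/

section Approximation

variable {Ω : Opens (E n)} {M : E n → E n → ℝ} {f f' : E n → ℝ} {g g' : E n → E n}

/-- The pair of `f` and its gradient `g` can be approximated by test functions in `W^{1,1}` and,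
simultaneously, with respect to all dilations of the modular. -/
def IsApproximable (Ω : Opens (E n)) (M : E n → E n → ℝ) (f : E n → ℝ) (g : E n → E n) : Prop :=
  ∀ ε : ℝ≥0∞, 0 < ε → ∀ l : ℝ, ∃ φ : 𝓓(Ω, ℝ), ∫⁻ x in Ω, ‖φ x - f x‖ₑ < ε ∧
    ∫⁻ x in Ω, ‖gradient φ x - g x‖ₑ < ε ∧ modular Ω M (fun x => l • (gradient φ x - g x)) < ε

theorem lintegral_enorm_add_le_add {F : Type*} [NormedAddCommGroup F] {μ : Measure (E n)}
    {a b : E n → F} (ha : AEStronglyMeasurable a μ) :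
    ∫⁻ x, ‖a x + b x‖ₑ ∂μ ≤ ∫⁻ x, ‖a x‖ₑ ∂μ + ∫⁻ x, ‖b x‖ₑ ∂μ := by
  rw [← lintegral_add_left' ha.enorm]
  exact lintegral_mono fun x => enorm_add_le _ _

theorem modular_smul_add_le (hM : IsWeakNFunction Ω M) {a : E n → E n} (b : E n → E n)
    (ha : AEStronglyMeasurable a (volume.restrict Ω)) (l : ℝ) :
    modular Ω M (fun x => l • (a x + b x)) ≤
      modular Ω M (fun x => (2 * l) • a x) + modular Ω M (fun x => (2 * l) • b x) := by
  have hm : AEMeasurable (fun x => M x ((2 * l) • a x)) (volume.restrict Ω) :=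
    aemeasurable_caratheodory hM.measurable hM.continuous (ha.const_smul (2 * l))
  rw [modular, modular, modular, ← lintegral_add_left' hm.ennreal_ofReal]
  refine lintegral_mono_ae ?_
  filter_upwards [hM.ae_isConvexGauge] with x hx
  rw [← ENNReal.ofReal_add (hx.nonneg _) (hx.nonneg _)]
  refine ENNReal.ofReal_le_ofReal ?_
  rw [smul_add, mul_smul, mul_smul]
  exact hx.map_add_le _ _

theorem modular_mono_of_abs_le (hM : IsWeakNFunction Ω M) {s t : E n → ℝ}
    (hst : ∀ x, |s x| ≤ |t x|) (g : E n → E n) :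
    modular Ω M (fun x => s x • g x) ≤ modular Ω M (fun x => t x • g x) := by
  refine lintegral_mono_ae ?_
  filter_upwards [hM.ae_isConvexGauge] with x hx
  exact ENNReal.ofReal_le_ofReal (hx.map_smul_le_map_smul (hst x) _)

theorem HasFiniteModulars.add (hM : IsWeakNFunction Ω M)
    (hgm : AEStronglyMeasurable g (volume.restrict Ω)) (hg : HasFiniteModulars Ω M g)
    (hg' : HasFiniteModulars Ω M g') : HasFiniteModulars Ω M fun x => g x + g' x := fun l =>
  (modular_smul_add_le hM g' hgm l).trans_lt (ENNReal.add_lt_top.2 ⟨hg _, hg' _⟩)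

theorem HasFiniteModulars.smul (hM : IsWeakNFunction Ω M) (hg : HasFiniteModulars Ω M g)
    {s : E n → ℝ} {A : ℝ} (hs : ∀ x, |s x| ≤ A) : HasFiniteModulars Ω M fun x => s x • g x := by
  intro l
  have h := modular_mono_of_abs_le hM (s := fun x => l * s x) (t := fun _ => l * A) (fun x => ?_) g
  · simp_rw [mul_smul l] at h
    refine h.trans_lt ?_
    simp_rw [← mul_smul l]
    exact hg _
  · rw [abs_mul, abs_mul]
    exact mul_le_mul_of_nonneg_left ((hs x).trans (le_abs_self A)) (abs_nonneg l)

theorem hasFiniteModulars_of_bounded (hb : Bornology.IsBounded (Ω : Set (E n)))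
    (hM : IsWeakNFunction Ω M) {R : ℝ} (hg : ∀ x, ‖g x‖ ≤ R) : HasFiniteModulars Ω M g := by
  intro l
  obtain ⟨B, -, hB⟩ := hM.exists_bound_of_norm_le (|l| * R)
  have h : modular Ω M (fun x => l • g x) ≤ ∫⁻ _ in (Ω : Set (E n)), ENNReal.ofReal B := by
    refine lintegral_mono_ae ?_
    filter_upwards [hB] with x hx
    refine ENNReal.ofReal_le_ofReal (hx _ ?_)
    rw [norm_smul, Real.norm_eq_abs]
    exact mul_le_mul_of_nonneg_left (hg x) (abs_nonneg l)
  refine h.trans_lt ?_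
  rw [setLIntegral_const]
  exact ENNReal.mul_lt_top ENNReal.ofReal_lt_top (volume_ne_top_of_isBounded hb).lt_top

/-- The approximable functions form a closed set. -/
theorem IsApproximable.of_forall_close (hM : IsWeakNFunction Ω M)
    (h : ∀ ε : ℝ≥0∞, 0 < ε → ∀ l : ℝ, ∃ (f' : E n → ℝ) (g' : E n → E n),
      AEStronglyMeasurable f' (volume.restrict Ω) ∧ AEStronglyMeasurable g' (volume.restrict Ω) ∧
      IsApproximable Ω M f' g' ∧ ∫⁻ x in Ω, ‖f' x - f x‖ₑ < ε ∧
      ∫⁻ x in Ω, ‖g' x - g x‖ₑ < ε ∧ modular Ω M (fun x => l • (g' x - g x)) < ε) :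
    IsApproximable Ω M f g := by
  intro ε hε l
  have hε2 : 0 < ε / 2 := ENNReal.half_pos hε.ne'
  obtain ⟨f', g', hf', hg', happ, h1, h2, h3⟩ := h (ε / 2) hε2 (2 * l)
  obtain ⟨φ, h1', h2', h3'⟩ := happ (ε / 2) hε2 (2 * l)
  have hφ : AEStronglyMeasurable (fun x => φ x - f' x) (volume.restrict Ω) :=
    φ.continuous.aestronglyMeasurable.sub hf'
  have hφ' : AEStronglyMeasurable (fun x => gradient φ x - g' x) (volume.restrict Ω) :=
    (testFunction_continuous_gradient φ).aestronglyMeasurable.sub hg'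
  refine ⟨φ, ?_, ?_, ?_⟩
  · have := lintegral_enorm_add_le_add (b := fun x => f' x - f x) hφ
    simp only [sub_add_sub_cancel] at this
    exact (this.trans_lt (ENNReal.add_lt_add h1' h1)).trans_eq (ENNReal.add_halves ε)
  · have := lintegral_enorm_add_le_add (b := fun x => g' x - g x) hφ'
    simp only [sub_add_sub_cancel] at this
    exact (this.trans_lt (ENNReal.add_lt_add h2' h2)).trans_eq (ENNReal.add_halves ε)
  · have := modular_smul_add_le hM (fun x => g' x - g x) hφ' l
    simp only [sub_add_sub_cancel] at this
    exact (this.trans_lt (ENNReal.add_lt_add h3' h3)).trans_eq (ENNReal.add_halves ε)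

theorem IsApproximable.add (hM : IsWeakNFunction Ω M)
    (hf : AEStronglyMeasurable f (volume.restrict Ω))
    (hg : AEStronglyMeasurable g (volume.restrict Ω)) (h : IsApproximable Ω M f g)
    (h' : IsApproximable Ω M f' g') :
    IsApproximable Ω M (fun x => f x + f' x) (fun x => g x + g' x) := by
  intro ε hε l
  have hε2 : 0 < ε / 2 := ENNReal.half_pos hε.ne'
  obtain ⟨φ, h1, h2, h3⟩ := h (ε / 2) hε2 (2 * l)
  obtain ⟨φ', h1', h2', h3'⟩ := h' (ε / 2) hε2 (2 * l)
  have hφ : AEStronglyMeasurable (fun x => φ x - f x) (volume.restrict Ω) :=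
    φ.continuous.aestronglyMeasurable.sub hf
  have hφ' : AEStronglyMeasurable (fun x => gradient φ x - g x) (volume.restrict Ω) :=
    (testFunction_continuous_gradient φ).aestronglyMeasurable.sub hg
  have e1 : ∀ x, (φ + φ') x - (f x + f' x) = (φ x - f x) + (φ' x - f' x) := fun x =>
    add_sub_add_comm (φ x) (φ' x) (f x) (f' x)
  have e2 : ∀ x, gradient (φ + φ' : 𝓓(Ω, ℝ)) x - (g x + g' x) =
      (gradient φ x - g x) + (gradient φ' x - g' x) := fun x => by
    have h4 : gradient (φ + φ' : 𝓓(Ω, ℝ)) x = gradient φ x + gradient φ' x :=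
      gradient_add (testFunction_differentiable _) (testFunction_differentiable _) x
    rw [h4, add_sub_add_comm]
  refine ⟨φ + φ', ?_, ?_, ?_⟩
  · simp_rw [e1]
    exact ((lintegral_enorm_add_le_add hφ).trans_lt (ENNReal.add_lt_add h1 h1')).trans_eq
      (ENNReal.add_halves ε)
  · simp_rw [e2]
    exact ((lintegral_enorm_add_le_add hφ').trans_lt (ENNReal.add_lt_add h2 h2')).trans_eq
      (ENNReal.add_halves ε)
  · simp_rw [e2]
    exact ((modular_smul_add_le hM _ hφ' l).trans_lt (ENNReal.add_lt_add h3 h3')).trans_eq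
      (ENNReal.add_halves ε)

theorem isApproximable_zero (hM : IsWeakNFunction Ω M) :
    IsApproximable Ω M (fun _ => 0) (fun _ => 0) := by
  intro ε hε l
  have h0 : ∀ x, gradient (⇑(0 : 𝓓(Ω, ℝ))) x = 0 := fun x => by
    have : ((0 : 𝓓(Ω, ℝ)) : E n → ℝ) = fun _ => 0 := rfl
    rw [this, gradient_fun_const]
  refine ⟨0, ?_, ?_, ?_⟩
  · have : ∀ x, (0 : 𝓓(Ω, ℝ)) x = 0 := fun _ => rfl
    simpa [this] using hε
  · simp_rw [h0]
    simpa using hε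
  · have : modular Ω M (fun x => l • (gradient (0 : 𝓓(Ω, ℝ)) x - 0)) = 0 := by
      rw [modular, ← lintegral_zero (μ := volume.restrict (Ω : Set (E n)))]
      refine lintegral_congr_ae ?_
      filter_upwards [hM.ae_isConvexGauge] with x hx
      rw [h0, sub_zero, smul_zero, hx.map_zero, ENNReal.ofReal_zero]
    rwa [this]

/-! ### Approximation near a point of the closure -/

theorem tendsto_lintegral_mollify_sub {F : Type*} [NormedAddCommGroup F] [NormedSpace ℝ F]
    [CompleteSpace F] {h : E n → F} (hh : Integrable h) {κ : ℕ → E n → ℝ} {r : ℕ → ℝ}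
    (hκ : ∀ j, IsMollifier (κ j) (r j)) (hr : Filter.Tendsto r Filter.atTop (𝓝 0)) :
    Filter.Tendsto (fun j => ∫⁻ x, ‖mollify (κ j) h x - h x‖ₑ) Filter.atTop (𝓝 0) := by
  rw [ENNReal.tendsto_nhds_zero]
  intro ε hε
  obtain ⟨r₀, hr₀, h1⟩ := exists_lintegral_mollify_sub_le hh hε
  filter_upwards [hr.eventually_lt_const hr₀] with j hj
  exact h1 _ _ hj (hκ j)

theorem tendsto_setLIntegral_of_tendsto {u : ℕ → E n → ℝ≥0∞}
    (h : Filter.Tendsto (fun j => ∫⁻ x, u j x) Filter.atTop (𝓝 0)) :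
    Filter.Tendsto (fun j => ∫⁻ x in Ω, u j x) Filter.atTop (𝓝 0) :=
  tendsto_of_tendsto_of_tendsto_of_le_of_le tendsto_const_nhds h (fun _ => zero_le)
    fun _ => setLIntegral_le_lintegral _ _

/-- Mollification with an inward shifted kernel produces test functions. -/
theorem exists_testFunction_eq_mollify {a x₀ : E n} {ρ δ₀ δ r : ℝ}
    (hcone : ∀ y ∈ Ω, ‖y - x₀‖ < ρ → ∀ δ, 0 < δ → δ < δ₀ →
      ∀ z : E n, ‖z‖ ≤ 1 → y + δ • (a + z) ∈ Ω)
    (hf : Integrable f) (hf0 : ∀ x ∉ Ω, f x = 0) (hfρ : ∀ x, ρ ≤ ‖x - x₀‖ → f x = 0)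
    (hδ : 0 < δ) (hδ' : δ < δ₀) {κ : E n → ℝ} (hκ : IsMollifier κ r)
    (hκs : ∀ t, κ t ≠ 0 → ‖t - δ • a‖ ≤ δ / 2) :
    ∃ φ : 𝓓(Ω, ℝ), ⇑φ = mollify κ f := by
  -- The support of the mollification lies in the Minkowski sum `S`, a compact subset of `Ω`.
  set S : Set (E n) := (fun p : E n × E n => p.1 + p.2) ''
    (closure ((Ω : Set (E n)) ∩ Metric.ball x₀ ρ) ×ˢ Metric.closedBall (δ • a) (δ / 2)) with hS
  have hScomp : IsCompact S := by
    refine IsCompact.image (IsCompact.prod ?_ (isCompact_closedBall _ _)) continuous_add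
    exact (Metric.isBounded_ball.subset inter_subset_right).isCompact_closure
  have hSΩ : S ⊆ Ω := by
    rintro _ ⟨⟨y, t⟩, ⟨hy, ht⟩, rfl⟩
    simp only at hy ht ⊢
    obtain ⟨y', ⟨hy'Ω, hy'ρ⟩, hyy'⟩ := Metric.mem_closure_iff.1 hy (δ / 2) (half_pos hδ)
    rw [mem_ball_iff_norm] at hy'ρ
    rw [mem_closedBall_iff_norm] at ht
    rw [dist_eq_norm] at hyy'
    have h1 := hcone y' hy'Ω hy'ρ δ hδ hδ' (δ⁻¹ • ((y - y') + (t - δ • a))) (by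
      rw [norm_smul, norm_inv, Real.norm_of_nonneg hδ.le, inv_mul_le_iff₀ hδ]
      exact (norm_add_le _ _).trans (by linarith))
    have h2 : y' + δ • (a + δ⁻¹ • ((y - y') + (t - δ • a))) = y + t := by
      rw [smul_add, smul_smul, mul_inv_cancel₀ hδ.ne', one_smul]; abel
    rwa [h2] at h1
  have hsupp : Function.support (mollify κ f) ⊆ S := by
    intro x hx
    by_contra hxS
    refine hx ?_
    rw [mollify]
    refine integral_eq_zero_of_ae (Filter.Eventually.of_forall fun t => ?_)
    by_contra ht
    have hκt : κ t ≠ 0 := left_ne_zero_of_smul ht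
    have hft : f (x - t) ≠ 0 := right_ne_zero_of_smul ht
    refine hxS ⟨(x - t, t), ⟨subset_closure ⟨?_, ?_⟩, mem_closedBall_iff_norm.2 (hκs t hκt)⟩,
      sub_add_cancel x t⟩
    · by_contra hcon; exact hft (hf0 _ hcon)
    · rw [mem_ball_iff_norm]
      by_contra hcon; exact hft (hfρ _ (not_lt.1 hcon))
  exact ⟨⟨mollify κ f, hκ.contDiff_mollify hf.locallyIntegrable,
    HasCompactSupport.of_support_subset_isCompact hScomp hsupp,
    (closure_minimal hsupp hScomp.isClosed).trans hSΩ⟩, rfl⟩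

/-- Mollification with kernels shifted inwards approximates a Hölder continuous function supported
near a point, in the sense of the modular. -/
theorem IsZeroSobolev.isApproximable_of_cone (hb : Bornology.IsBounded (Ω : Set (E n)))
    (hM : IsWeakNFunction Ω M) (hΔ : DeltaTwo Ω M) {γ : ℝ} (hγ : 0 ≤ γ)
    (hdom : HasDomination Ω M γ) (h : IsZeroSobolev Ω f g) (hg : HasFiniteModulars Ω M g)
    {K : ℝ} (hK : 0 ≤ K) (hfK : ∀ x y, |f x - f y| ≤ K * ‖x - y‖ ^ γ)
    {a x₀ : E n} {ρ δ₀ : ℝ} (hδ₀ : 0 < δ₀)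
    (hcone : ∀ y ∈ Ω, ‖y - x₀‖ < ρ → ∀ δ, 0 < δ → δ < δ₀ →
      ∀ z : E n, ‖z‖ ≤ 1 → y + δ • (a + z) ∈ Ω)
    (hfρ : ∀ x, ρ ≤ ‖x - x₀‖ → f x = 0) : IsApproximable Ω M f g := by
  intro ε hε l
  obtain ⟨D, hD0, hD⟩ := exists_isMollifier a
  set A : ℝ := ‖a‖ + 1 with hA
  have hA0 : 0 < A := by positivity
  obtain ⟨G, H, c, r₀, hG, hH, hc, hr₀, hGH⟩ :=
    hdom g h.integrable_grad h.grad_eq_zero hg (D * A * K)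
  obtain ⟨c₁, H₁, hc₁, hH₁, hΔl⟩ := hΔ.exists_bound_smul hb hM (2 * l)
  set δ : ℕ → ℝ := fun j => min δ₀ (r₀ / A) / (j + 2) with hδdef
  have hmin : 0 < min δ₀ (r₀ / A) := by positivity
  have hδ : ∀ j, 0 < δ j := fun j => by positivity
  have hδlt : ∀ j, δ j < min δ₀ (r₀ / A) := fun j => by
    refine div_lt_self hmin ?_
    have : (0 : ℝ) ≤ j := Nat.cast_nonneg j
    linarith
  have hδt : Filter.Tendsto δ Filter.atTop (𝓝 0) := by
    refine Filter.Tendsto.div_atTop tendsto_const_nhds ?_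
    exact Filter.tendsto_atTop_add_const_right _ _ tendsto_natCast_atTop_atTop
  choose κ hκ hκs hκD using fun j => hD (δ j) (hδ j)
  have hrt : Filter.Tendsto (fun j => δ j * A) Filter.atTop (𝓝 0) := by
    simpa using hδt.mul_const A
  choose φ hφ using fun j => exists_testFunction_eq_mollify hcone h.integrable h.eq_zero hfρ (hδ j)
    ((hδlt j).trans_le (min_le_left _ _)) (hκ j) (hκs j)
  have hgradφ : ∀ j x, gradient (φ j) x = mollify (κ j) g x := fun j x => by
    rw [hφ, h.gradient_mollify (hκ j)]
  -- The factor `D / δ j` from the kernel and the Hölder condition combine to the power `γ - 1`.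
  have hsize : ∀ j x, ‖mollify (κ j) g x‖ ≤ D * A * K * (δ j * A) ^ (γ - 1) := by
    intro j x
    rw [← h.gradient_mollify (hκ j), norm_gradient_eq_norm_fderiv]
    refine ((hκ j).norm_fderiv_mollify_le h.integrable.locallyIntegrable hK hγ hfK
      (hκD j) x).trans (le_of_eq ?_)
    have hpos : 0 < δ j * A := mul_pos (hδ j) hA0
    rw [Real.rpow_sub_one hpos.ne']
    have := (hδ j).ne'
    field_simp
  have hae := fun j => hGH (κ j) (δ j * A) (mul_pos (hδ j) hA0)
    ((lt_div_iff₀ hA0).1 ((hδlt j).trans_le (min_le_right _ _))) (hκ j) (hsize j)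
  have l1 := tendsto_lintegral_mollify_sub h.integrable hκ hrt
  have l2 := tendsto_lintegral_mollify_sub h.integrable_grad hκ hrt
  have l3 := tendsto_lintegral_mollify_sub hG hκ hrt
  obtain ⟨ns, hns, hlim⟩ := exists_subseq_tendsto_ae_of_lintegral
    (fun j => ((hκ j).integrable_mollify h.integrable_grad).aestronglyMeasurable)
    h.integrable_grad.aestronglyMeasurable l2
  have hgm : AEStronglyMeasurable g (volume.restrict Ω) :=
    h.integrable_grad.aestronglyMeasurable.restrict
  have hMg := hg.integrableOn hM hgm (2 * l)
  -- The dominating functions and their limit.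
  set A₀ : E n → ℝ := fun x => c₁ * (c * G x + H x) + H₁ x + M x ((2 * l) • g x) with hA₀
  set Aj : ℕ → E n → ℝ := fun j x =>
    c₁ * (c * mollify (κ (ns j)) G x + H x) + H₁ x + M x ((2 * l) • g x) with hAj
  have hA₀i : IntegrableOn A₀ Ω :=
    ((((hG.integrableOn.const_mul c).add hH).const_mul c₁).add hH₁).add hMg
  have hbound : ∀ j, ∀ᵐ x ∂(volume.restrict Ω),
      ENNReal.ofReal (M x (l • (mollify (κ (ns j)) g x - g x))) ≤ ENNReal.ofReal (Aj j x) := by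
    intro j
    filter_upwards [hae (ns j), hΔl, hM.ae_isConvexGauge] with x h1 h2 h3
    refine ENNReal.ofReal_le_ofReal ?_
    have h4 := h3.map_sub_le (l • mollify (κ (ns j)) g x) (l • g x)
    rw [← smul_sub, ← mul_smul, ← mul_smul] at h4
    have h5 := h2.2 (mollify (κ (ns j)) g x)
    have h6 := mul_le_mul_of_nonneg_left h1 hc₁
    simp only [hAj]
    linarith
  have hdiff : Filter.Tendsto (fun j => ∫⁻ x in Ω,
      (ENNReal.ofReal (Aj j x) - ENNReal.ofReal (A₀ x))) Filter.atTop (𝓝 0) := by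
    have l4 := ENNReal.Tendsto.const_mul (a := ENNReal.ofReal (c₁ * c))
      (tendsto_setLIntegral_of_tendsto (Ω := Ω) (l3.comp hns.tendsto_atTop))
      (Or.inr ENNReal.ofReal_ne_top)
    rw [mul_zero] at l4
    refine tendsto_of_tendsto_of_tendsto_of_le_of_le tendsto_const_nhds l4 (fun _ => zero_le)
      fun j => ?_
    simp only
    rw [← lintegral_const_mul' _ _ ENNReal.ofReal_ne_top]
    refine lintegral_mono fun x => ?_
    simp only
    have h1 : Aj j x ≤ A₀ x + c₁ * c * ‖mollify (κ (ns j)) G x - G x‖ := by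
      have := mul_le_mul_of_nonneg_left (le_abs_self (mollify (κ (ns j)) G x - G x))
        (mul_nonneg hc₁ hc)
      simp only [hAj, hA₀, Real.norm_eq_abs]
      linarith
    rw [tsub_le_iff_left, ← ofReal_norm, ← ENNReal.ofReal_mul (mul_nonneg hc₁ hc)]
    exact (ENNReal.ofReal_le_ofReal h1).trans ENNReal.ofReal_add_le
  have hlim0 : ∀ᵐ x ∂(volume.restrict Ω), Filter.Tendsto
      (fun j => ENNReal.ofReal (M x (l • (mollify (κ (ns j)) g x - g x)))) Filter.atTop
      (𝓝 0) := by
    filter_upwards [ae_restrict_of_ae hlim, hM.ae_isConvexGauge] with x h1 h2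
    have h3 : Filter.Tendsto (fun j => l • (mollify (κ (ns j)) g x - g x)) Filter.atTop
        (𝓝 (l • (g x - g x))) := (h1.sub_const _).const_smul l
    have h4 := (ENNReal.continuous_ofReal.tendsto _).comp ((h2.continuous.tendsto _).comp h3)
    simpa [Function.comp_def, h2.map_zero] using h4
  have hev := eventually_lintegral_lt_of_dominated
    (fun j => (aemeasurable_caratheodory hM.measurable hM.continuous
      (((((hκ (ns j)).integrable_mollify h.integrable_grad).aestronglyMeasurable.restrict).sub
        hgm).const_smul l)).ennreal_ofReal)
    hA₀i.aestronglyMeasurable.aemeasurable.ennreal_ofReal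
    (hA₀i.lintegral_lt_top.ne) hbound hdiff hlim0 (c := ε) (by simpa using hε)
  have l1' := tendsto_setLIntegral_of_tendsto (Ω := Ω) (l1.comp hns.tendsto_atTop)
  have l2' := tendsto_setLIntegral_of_tendsto (Ω := Ω) (l2.comp hns.tendsto_atTop)
  obtain ⟨j, hj1, hj2, hj3⟩ :=
    ((l1'.eventually_lt_const hε).and ((l2'.eventually_lt_const hε).and hev)).exists
  refine ⟨φ (ns j), ?_, ?_, ?_⟩
  · rw [hφ]; exact hj1
  · simp_rw [hgradφ]; exact hj2
  · rw [modular]; simp_rw [hgradφ]; exact hj3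

end Approximation

/-! ### Localization and truncation -/

section Localization

variable {Ω : Opens (E n)} {M : E n → E n → ℝ} {f f' : E n → ℝ} {g g' : E n → E n} {γ : ℝ}

/-- A bounded, globally `γ`-Hölder continuous function with zero boundary values whose gradient has
finite modulars. For `γ = 0` the Hölder condition follows from boundedness. -/
structure IsAdmissible (Ω : Opens (E n)) (M : E n → E n → ℝ) (γ : ℝ) (f : E n → ℝ)
    (g : E n → E n) : Prop where
  sobolev : IsZeroSobolev Ω f g
  modulars : HasFiniteModulars Ω M g
  bounded : ∃ B, ∀ x, |f x| ≤ B
  holder : ∃ K, 0 ≤ K ∧ ∀ x y, |f x - f y| ≤ K * ‖x - y‖ ^ γ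

theorem IsAdmissible.sub (hM : IsWeakNFunction Ω M) (h : IsAdmissible Ω M γ f g)
    (h' : IsAdmissible Ω M γ f' g') :
    IsAdmissible Ω M γ (fun x => f x - f' x) (fun x => g x - g' x) := by
  obtain ⟨B, hB⟩ := h.bounded
  obtain ⟨B', hB'⟩ := h'.bounded
  obtain ⟨K, hK0, hK⟩ := h.holder
  obtain ⟨K', hK0', hK'⟩ := h'.holder
  refine ⟨h.sobolev.sub h'.sobolev, ?_,
    ⟨B + B', fun x => (abs_sub _ _).trans (add_le_add (hB x) (hB' x))⟩,
    ⟨K + K', add_nonneg hK0 hK0', fun x y => ?_⟩⟩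
  · have h1 : HasFiniteModulars Ω M fun x => (-1 : ℝ) • g' x :=
      h'.modulars.smul hM (s := fun _ => -1) (A := 1) (by simp)
    have h2 := h.modulars.add hM h.sobolev.integrable_grad.aestronglyMeasurable.restrict h1
    simpa [sub_eq_add_neg] using h2
  · rw [sub_sub_sub_comm, add_mul]
    exact (abs_sub _ _).trans (add_le_add (hK x y) (hK' x y))

theorem exists_abs_sub_le_rpow {θ : E n → ℝ} (hθ : ContDiff ℝ (⊤ : ℕ∞) θ)
    (hθc : HasCompactSupport θ) (hγ₀ : 0 ≤ γ) (hγ₁ : γ ≤ 1) :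
    ∃ K, 0 ≤ K ∧ ∀ x y, |θ x - θ y| ≤ K * ‖x - y‖ ^ γ := by
  obtain ⟨A, hA⟩ := hθ.continuous.bounded_above_of_compact_support hθc
  obtain ⟨B, hB⟩ := (hθ.continuous_fderiv (by simp)).bounded_above_of_compact_support
    (hθc.fderiv ℝ)
  have hA0 : 0 ≤ A := (norm_nonneg _).trans (hA 0)
  have hB0 : 0 ≤ B := (norm_nonneg _).trans (hB 0)
  refine ⟨2 * A + B, by positivity, fun x y => ?_⟩
  rcases le_or_gt ‖x - y‖ 1 with h | h
  · have h1 : |θ x - θ y| ≤ B * ‖x - y‖ :=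
      convex_univ.norm_image_sub_le_of_norm_fderiv_le
        (fun z _ => hθ.differentiable (by simp) z) (fun z _ => hB z) (mem_univ y) (mem_univ x)
    have h2 : ‖x - y‖ ≤ ‖x - y‖ ^ γ := by
      rcases (norm_nonneg (x - y)).eq_or_lt with h0 | h0
      · rw [← h0]; exact Real.rpow_nonneg le_rfl _
      · simpa using Real.rpow_le_rpow_of_exponent_ge h0 h hγ₁
    have h3 := Real.rpow_nonneg (norm_nonneg (x - y)) γ
    nlinarith
  · have h1 : |θ x - θ y| ≤ 2 * A := by
      refine (abs_sub _ _).trans ?_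
      have := hA x; have := hA y
      simp only [Real.norm_eq_abs] at *
      linarith
    have h2 : 1 ≤ ‖x - y‖ ^ γ := Real.one_le_rpow h.le hγ₀
    nlinarith

theorem IsAdmissible.mul_left (hb : Bornology.IsBounded (Ω : Set (E n)))
    (hM : IsWeakNFunction Ω M) (hγ₀ : 0 ≤ γ) (hγ₁ : γ ≤ 1) (h : IsAdmissible Ω M γ f g)
    {θ : E n → ℝ} (hθ : ContDiff ℝ (⊤ : ℕ∞) θ) (hθc : HasCompactSupport θ) :
    IsAdmissible Ω M γ (fun x => θ x * f x) (fun x => θ x • g x + f x • gradient θ x) := by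
  obtain ⟨B, hB⟩ := h.bounded
  obtain ⟨K, hK0, hK⟩ := h.holder
  obtain ⟨K', hK0', hK'⟩ := exists_abs_sub_le_rpow hθ hθc hγ₀ hγ₁
  obtain ⟨A, hA⟩ := hθ.continuous.bounded_above_of_compact_support hθc
  obtain ⟨A', hA'⟩ := hθ.continuous_gradient.bounded_above_of_compact_support
    (hasCompactSupport_gradient hθc)
  have hA0 : 0 ≤ A := (norm_nonneg _).trans (hA 0)
  have hB0 : 0 ≤ B := (abs_nonneg _).trans (hB 0)
  refine ⟨h.sobolev.mul_left hθ hθc, ?_, ⟨A * B, fun x => ?_⟩,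
    ⟨A * K + B * K', by positivity, fun x y => ?_⟩⟩
  · refine (h.modulars.smul hM hA).add hM ?_ (hasFiniteModulars_of_bounded hb hM (R := B * A')
      fun x => ?_)
    · exact hθ.continuous.aestronglyMeasurable.smul
        h.sobolev.integrable_grad.aestronglyMeasurable.restrict
    · rw [norm_smul]
      exact mul_le_mul (hB x) (hA' x) (norm_nonneg _) hB0
  · rw [abs_mul]
    exact mul_le_mul (hA x) (hB x) (abs_nonneg _) hA0
  · have h1 : θ x * f x - θ y * f y = θ x * (f x - f y) + f y * (θ x - θ y) := by ring
    rw [h1]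
    refine (abs_add_le _ _).trans ?_
    rw [abs_mul, abs_mul, add_mul, mul_assoc, mul_assoc]
    exact add_le_add (mul_le_mul (hA x) (hK x y) (abs_nonneg _) hA0)
      (mul_le_mul (hB y) (hK' x y) (abs_nonneg _) hB0)

/-- Admissible functions are approximable. The function is split by finitely many bump functions
into pieces supported near a point each, and `f = b f + (1 - b) f` takes care of one bump function
`b` at a time. -/
theorem IsAdmissible.isApproximable (hb : Bornology.IsBounded (Ω : Set (E n)))
    (hΩ : HasLipschitzBoundary (Ω : Set (E n))) (hM : IsWeakNFunction Ω M)
    (hΔ : DeltaTwo Ω M) (hγ₀ : 0 ≤ γ) (hγ₁ : γ ≤ 1) (hdom : HasDomination Ω M γ)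
    (h : IsAdmissible Ω M γ f g) : IsApproximable Ω M f g := by
  have hcone : ∀ x₀ : E n, ∃ ρ : ℝ, 0 < ρ ∧ (x₀ ∈ closure (Ω : Set (E n)) →
      ∀ (f : E n → ℝ) (g : E n → E n), IsAdmissible Ω M γ f g →
        (∀ x, ρ ≤ ‖x - x₀‖ → f x = 0) → IsApproximable Ω M f g) := by
    intro x₀
    by_cases hx₀ : x₀ ∈ closure (Ω : Set (E n))
    · obtain ⟨a, ρ, δ₀, hρ, hδ₀, hc⟩ := hΩ.exists_cone hx₀
      refine ⟨ρ, hρ, fun _ f g hfg hfρ => ?_⟩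
      obtain ⟨K, hK0, hK⟩ := hfg.holder
      exact hfg.sobolev.isApproximable_of_cone hb hM hΔ hγ₀ hdom hfg.modulars hK0 hK hδ₀ hc hfρ
    · exact ⟨1, one_pos, fun hcon => absurd hcon hx₀⟩
  choose ρ hρ happ using hcone
  let b : ∀ x₀ : E n, ContDiffBump x₀ := fun x₀ =>
    ⟨ρ x₀ / 3, ρ x₀ / 2, by linarith [hρ x₀], by linarith [hρ x₀]⟩
  have key : ∀ t : Finset (E n), (∀ x₀ ∈ t, x₀ ∈ closure (Ω : Set (E n))) →
      ∀ (f : E n → ℝ) (g : E n → E n), IsAdmissible Ω M γ f g →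
        (∀ x, (∀ x₀ ∈ t, x ∉ Metric.ball x₀ (ρ x₀ / 3)) → f x = 0 ∧ g x = 0) →
          IsApproximable Ω M f g := by
    classical
    intro t
    induction t using Finset.induction_on with
    | empty =>
      intro _ f g _ h0
      have hf : f = fun _ => 0 := funext fun x => (h0 x (by simp)).1
      have hg : g = fun _ => 0 := funext fun x => (h0 x (by simp)).2
      rw [hf, hg]
      exact isApproximable_zero hM
    | insert x₀ t _ ih =>
      intro ht f g hfg h0
      have hbs : ContDiff ℝ (⊤ : ℕ∞) (b x₀) := (b x₀).contDiff
      have h1 := hfg.mul_left hb hM hγ₀ hγ₁ hbs (b x₀).hasCompactSupport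
      have h2 := hfg.sub hM h1
      -- The piece `b f` is supported near `x₀`, and the rest vanishes where `b = 1`.
      have happ1 := happ x₀ (ht x₀ (Finset.mem_insert_self x₀ t)) _ _ h1 (fun x hx => by
        rw [(b x₀).zero_of_le_dist, zero_mul]
        rw [dist_eq_norm]
        exact le_trans (show ρ x₀ / 2 ≤ ρ x₀ by linarith [hρ x₀]) hx)
      have happ2 := ih (fun x hx => ht x (Finset.mem_insert_of_mem hx)) _ _ h2 (fun x hx => by
        by_cases hxb : x ∈ Metric.ball x₀ (ρ x₀ / 3)
        · have hev : (b x₀ : E n → ℝ) =ᶠ[𝓝 x] fun _ => 1 := by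
            filter_upwards [Metric.isOpen_ball.mem_nhds hxb] with y hy
            exact (b x₀).one_of_mem_closedBall (Metric.ball_subset_closedBall hy)
          rw [hev.gradient_eq, hev.eq_of_nhds, gradient_fun_const]
          simp
        · obtain ⟨h3, h4⟩ := h0 x (fun y hy => by
            rcases Finset.mem_insert.1 hy with rfl | hy
            · exact hxb
            · exact hx y hy)
          simp [h3, h4])
      have h3 := happ1.add hM h1.sobolev.integrable.aestronglyMeasurable.restrict
        h1.sobolev.integrable_grad.aestronglyMeasurable.restrict happ2
      simpa using h3
  obtain ⟨t, ht, hcov⟩ := hb.isCompact_closure.elim_nhds_subcover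
    (fun x₀ => Metric.ball x₀ (ρ x₀ / 3))
    (fun x₀ _ => Metric.ball_mem_nhds x₀ (by linarith [hρ x₀]))
  refine key t ht f g h fun x hx => ?_
  have hxΩ : x ∉ Ω := fun hcon => by
    have := hcov (subset_closure hcon)
    simp only [mem_iUnion] at this
    obtain ⟨x₀, hx₀, hxx⟩ := this
    exact hx x₀ hx₀ hxx
  exact ⟨h.sobolev.eq_zero x hxΩ, h.sobolev.grad_eq_zero x hxΩ⟩

/-- If `γ = 0`, no boundedness is needed: the smooth truncations `(k + 1) sin (f / (k + 1))` are
bounded and converge to `f` together with their gradients. -/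
theorem IsZeroSobolev.isApproximable (hb : Bornology.IsBounded (Ω : Set (E n)))
    (hΩ : HasLipschitzBoundary (Ω : Set (E n))) (hM : IsWeakNFunction Ω M)
    (hΔ : DeltaTwo Ω M) (hdom : HasDomination Ω M 0) (h : IsZeroSobolev Ω f g)
    (hg : HasFiniteModulars Ω M g) : IsApproximable Ω M f g := by
  set T : ℕ → ℝ → ℝ := fun k s => ((k : ℝ) + 1) * Real.sin (s / ((k : ℝ) + 1)) with hTdef
  have hk : ∀ k : ℕ, (0 : ℝ) < (k : ℝ) + 1 := fun k => by positivity
  have hTs : ∀ k, ContDiff ℝ (⊤ : ℕ∞) (T k) := fun k =>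
    contDiff_const.mul (Real.contDiff_sin.comp (contDiff_id.div_const _))
  have hT0 : ∀ k, T k 0 = 0 := fun k => by simp [hTdef]
  have hT' : ∀ k s, deriv (T k) s = Real.cos (s / ((k : ℝ) + 1)) := by
    intro k s
    have h1 : HasDerivAt (T k)
        (((k : ℝ) + 1) * (Real.cos (s / ((k : ℝ) + 1)) * (1 / ((k : ℝ) + 1)))) s :=
      (((hasDerivAt_id s).div_const _).sin).const_mul _
    rw [h1.deriv]
    have := (hk k).ne'
    field_simp
  have hT'1 : ∀ k s, |deriv (T k) s| ≤ 1 := fun k s => by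
    rw [hT']; exact Real.abs_cos_le_one _
  have hTle : ∀ k s, |T k s| ≤ |s| := fun k s => by
    have h1 : |Real.sin (s / ((k : ℝ) + 1))| ≤ |s / ((k : ℝ) + 1)| := Real.abs_sin_le_abs
    rw [abs_div, abs_of_pos (hk k), le_div_iff₀ (hk k)] at h1
    rw [hTdef]
    simp only
    rw [abs_mul, abs_of_pos (hk k)]
    linarith
  have hdiv : ∀ s : ℝ, Filter.Tendsto (fun k : ℕ => s / ((k : ℝ) + 1)) Filter.atTop (𝓝 0) :=
    fun s => Filter.Tendsto.div_atTop tendsto_const_nhds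
      (Filter.tendsto_atTop_add_const_right _ _ tendsto_natCast_atTop_atTop)
  have hTlim : ∀ s, Filter.Tendsto (fun k => T k s) Filter.atTop (𝓝 s) := by
    intro s
    have h1 : ∀ k : ℕ, T k s = s * Real.sinc (s / ((k : ℝ) + 1)) := by
      intro k
      rcases eq_or_ne s 0 with rfl | hs
      · simp [hTdef]
      · have := (hk k).ne'
        rw [Real.sinc_of_ne_zero (by positivity)]
        simp only [hTdef]
        field_simp
    simp_rw [h1]
    have h2 := ((Real.continuous_sinc.tendsto 0).comp (hdiv s)).const_mul s
    simpa [Function.comp_def] using h2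
  have hT'lim : ∀ s, Filter.Tendsto (fun k => deriv (T k) s) Filter.atTop (𝓝 1) := by
    intro s
    simp_rw [hT']
    have h2 := (Real.continuous_cos.tendsto 0).comp (hdiv s)
    simpa [Function.comp_def] using h2
  have hTf : ∀ k, AEStronglyMeasurable (fun x => T k (f x)) volume := fun k =>
    (hTs k).continuous.comp_aestronglyMeasurable h.integrable.aestronglyMeasurable
  have hT'f : ∀ k, AEStronglyMeasurable (fun x => deriv (T k) (f x)) volume := fun k =>
    ((hTs k).continuous_deriv (by simp)).comp_aestronglyMeasurable
      h.integrable.aestronglyMeasurable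
  have hsob : ∀ k, IsZeroSobolev Ω (fun x => T k (f x)) (fun x => deriv (T k) (f x) • g x) :=
    fun k => h.comp (hTs k) (hT0 k) (C := 1) fun s => by
      rw [← NNReal.coe_le_coe, coe_nnnorm]
      exact hT'1 k s
  have hadm : ∀ k, IsAdmissible Ω M 0 (fun x => T k (f x)) (fun x => deriv (T k) (f x) • g x) := by
    intro k
    have hbd : ∀ s, |T k s| ≤ (k : ℝ) + 1 := fun s => by
      simp only [hTdef]
      rw [abs_mul, abs_of_pos (hk k)]
      exact mul_le_of_le_one_right (hk k).le (Real.abs_sin_le_one _)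
    refine ⟨hsob k, hg.smul hM fun x => hT'1 k (f x), ⟨_, fun x => hbd (f x)⟩,
      ⟨2 * ((k : ℝ) + 1), by positivity, fun x y => ?_⟩⟩
    rw [Real.rpow_zero, mul_one]
    refine (abs_sub _ _).trans ?_
    linarith [hbd (f x), hbd (f y)]
  have happ := fun k => (hadm k).isApproximable hb hΩ hM hΔ le_rfl zero_le_one hdom
  have hgm : AEStronglyMeasurable g (volume.restrict Ω) :=
    h.integrable_grad.aestronglyMeasurable.restrict
  refine IsApproximable.of_forall_close hM fun ε hε l => ?_
  have l1 : Filter.Tendsto (fun k => ∫⁻ x in Ω, ‖T k (f x) - f x‖ₑ) Filter.atTop (𝓝 0) := by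
    have := tendsto_lintegral_of_dominated_convergence' (μ := volume.restrict (Ω : Set (E n)))
      (F := fun k x => ‖T k (f x) - f x‖ₑ) (f := fun _ => 0) (fun x => 2 * ‖f x‖ₑ)
      (fun k => ((hTf k).sub h.integrable.aestronglyMeasurable).restrict.enorm)
      (fun k => Filter.Eventually.of_forall fun x => ?_) ?_ ?_
    · simpa using this
    · refine enorm_sub_le.trans ((add_le_add ?_ le_rfl).trans_eq (two_mul _).symm)
      rw [enorm_le_iff_norm_le]
      exact hTle k (f x)
    · rw [lintegral_const_mul' _ _ (by simp)]
      exact ENNReal.mul_ne_top (by simp) h.integrable.integrableOn.2.ne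
    · refine Filter.Eventually.of_forall fun x => ?_
      have := ((hTlim (f x)).sub_const (f x)).enorm
      simpa using this
  have hdiffg : ∀ k x, deriv (T k) (f x) • g x - g x = (deriv (T k) (f x) - 1) • g x :=
    fun k x => by rw [sub_smul, one_smul]
  have hd2 : ∀ k s, |deriv (T k) s - 1| ≤ 2 := fun k s => by
    refine (abs_sub _ _).trans ?_
    rw [abs_one]; linarith [hT'1 k s]
  have l2 : Filter.Tendsto (fun k => ∫⁻ x in Ω, ‖deriv (T k) (f x) • g x - g x‖ₑ) Filter.atTop
      (𝓝 0) := by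
    simp_rw [hdiffg]
    have := tendsto_lintegral_of_dominated_convergence' (μ := volume.restrict (Ω : Set (E n)))
      (F := fun k x => ‖(deriv (T k) (f x) - 1) • g x‖ₑ) (f := fun _ => 0)
      (fun x => ENNReal.ofReal 2 * ‖g x‖ₑ)
      (fun k => ((((hT'f k).restrict).sub aestronglyMeasurable_const).smul hgm).enorm)
      (fun k => Filter.Eventually.of_forall fun x => ?_) ?_ ?_
    · simpa using this
    · simp only [enorm_smul]
      refine mul_le_mul_left ?_ _
      rw [← ofReal_norm]
      exact ENNReal.ofReal_le_ofReal (hd2 k (f x))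
    · rw [lintegral_const_mul' _ _ (by simp)]
      exact ENNReal.mul_ne_top (by simp) h.integrable_grad.integrableOn.2.ne
    · refine Filter.Eventually.of_forall fun x => ?_
      have := (((hT'lim (f x)).sub_const 1).smul_const (g x)).enorm
      simpa using this
  have l3 : Filter.Tendsto
      (fun k => modular Ω M fun x => l • (deriv (T k) (f x) • g x - g x)) Filter.atTop (𝓝 0) := by
    simp_rw [hdiffg]
    have := tendsto_lintegral_of_dominated_convergence' (μ := volume.restrict (Ω : Set (E n)))
      (F := fun k x => ENNReal.ofReal (M x (l • (deriv (T k) (f x) - 1) • g x)))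
      (f := fun _ => 0) (fun x => ENNReal.ofReal (M x ((l * 2) • g x)))
      (fun k => (aemeasurable_caratheodory hM.measurable hM.continuous
        (((((hT'f k).restrict).sub aestronglyMeasurable_const).smul hgm).const_smul
          l)).ennreal_ofReal) (fun k => ?_) (hg (l * 2)).ne ?_
    · simpa [modular] using this
    · filter_upwards [hM.ae_isConvexGauge] with x hx
      refine ENNReal.ofReal_le_ofReal ?_
      rw [smul_smul]
      refine hx.map_smul_le_map_smul ?_ _
      rw [abs_mul, abs_mul, abs_two]
      exact mul_le_mul_of_nonneg_left (hd2 k (f x)) (abs_nonneg l)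
    · filter_upwards [hM.ae_isConvexGauge] with x hx
      have h1 := (((hT'lim (f x)).sub_const 1).smul_const (g x)).const_smul l
      have h2 := (ENNReal.continuous_ofReal.tendsto _).comp ((hx.continuous.tendsto _).comp h1)
      simpa [Function.comp_def, hx.map_zero] using h2
  obtain ⟨k, hk1, hk2, hk3⟩ := ((l1.eventually_lt_const hε).and
    ((l2.eventually_lt_const hε).and (l3.eventually_lt_const hε))).exists
  exact ⟨_, _, (hTf k).restrict, (hsob k).integrable_grad.aestronglyMeasurable.restrict, happ k,
    hk1, hk2, hk3⟩

end Localization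

/-! ### Weak gradients -/

section WeakGradient

variable {Ω : Opens (E n)} {f f' : E n → ℝ} {g g' : E n → E n}

theorem integrableOn_smul_of_locallyIntegrableOn {F : Type*} [NormedAddCommGroup F]
    [NormedSpace ℝ F] {h : E n → F} (hh : LocallyIntegrableOn h (Ω : Set (E n))) {η : E n → ℝ}
    (hη : Continuous η) (hηc : HasCompactSupport η) (hηΩ : tsupport η ⊆ Ω) :
    Integrable (fun x => η x • h x) := by
  have h1 : IntegrableOn h (tsupport η) := hh.integrableOn_compact_subset hηΩ hηc
  have h2 : IntegrableOn (fun x => η x • h x) (tsupport η) :=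
    h1.continuousOn_smul hη.continuousOn hηc
  refine (integrableOn_iff_integrable_of_support_subset ?_).1 h2
  intro x hx
  exact subset_tsupport η (left_ne_zero_of_smul hx)

/-- Weak gradients are unique, so that the choice made in `weakGrad` does not matter. -/
theorem HasWeakGradient.ae_eq (h : HasWeakGradient Ω f g) (h' : HasWeakGradient Ω f g') :
    g =ᵐ[volume.restrict Ω] g' := by
  have h0 := Ω.isOpen.ae_eq_zero_of_integral_contDiff_smul_eq_zero (μ := volume)
    (f := fun x => g x - g' x) (h.2.1.sub h'.2.1) fun η hη hηc hηΩ => by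
      set φ : 𝓓(Ω, ℝ) := ⟨η, hη, hηc, hηΩ⟩
      have h1 := h.2.2 φ
      rw [h'.2.2 φ] at h1
      have hoff : ∀ (k : E n → E n), ∀ x ∉ (Ω : Set (E n)), η x • k x = 0 := fun k x hx => by
        have : η x = 0 := testFunction_eq_zero φ hx
        rw [this, zero_smul]
      have e1 : ∫ x in Ω, φ x • g x = ∫ x, η x • g x :=
        setIntegral_eq_integral_of_forall_compl_eq_zero (hoff g)
      have e2 : ∫ x in Ω, φ x • g' x = ∫ x, η x • g' x :=
        setIntegral_eq_integral_of_forall_compl_eq_zero (hoff g')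
      simp_rw [smul_sub]
      rw [integral_sub (integrableOn_smul_of_locallyIntegrableOn h.2.1 hη.continuous hηc hηΩ)
        (integrableOn_smul_of_locallyIntegrableOn h'.2.1 hη.continuous hηc hηΩ), ← e1, ← e2,
        neg_injective h1, sub_self]
  rw [Filter.EventuallyEq, ae_restrict_iff' Ω.isOpen.measurableSet]
  filter_upwards [h0] with x hx hxΩ
  exact sub_eq_zero.1 (hx hxΩ)

theorem hasWeakGradient_weakGrad (h : ∃ g, HasWeakGradient Ω f g) :
    HasWeakGradient Ω f (weakGrad Ω f) := by
  rw [weakGrad, dif_pos h]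
  exact h.choose_spec

theorem HasWeakGradient.weakGrad_ae_eq (h : HasWeakGradient Ω f g) :
    weakGrad Ω f =ᵐ[volume.restrict Ω] g :=
  (hasWeakGradient_weakGrad ⟨g, h⟩).ae_eq h

theorem HasWeakGradient.add (h : HasWeakGradient Ω f g) (h' : HasWeakGradient Ω f' g') :
    HasWeakGradient Ω (f + f') (g + g') := by
  refine ⟨h.1.add h'.1, h.2.1.add h'.2.1, fun φ => ?_⟩
  have hi : ∀ {k : E n → E n}, LocallyIntegrableOn k (Ω : Set (E n)) →
      IntegrableOn (fun x => φ x • k x) Ω := fun hk =>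
    (integrableOn_smul_of_locallyIntegrableOn hk φ.continuous φ.hasCompactSupport
      φ.tsupport_subset).integrableOn
  have hi' : ∀ {k : E n → ℝ}, LocallyIntegrableOn k (Ω : Set (E n)) →
      IntegrableOn (fun x => k x • gradient φ x) Ω := by
    intro k hk
    have hc : IsCompact (tsupport φ) := φ.hasCompactSupport
    have h1 : IntegrableOn k (tsupport φ) := hk.integrableOn_compact_subset φ.tsupport_subset hc
    have h2 : IntegrableOn (fun x => k x • gradient φ x) (tsupport φ) :=
      h1.smul_continuousOn (testFunction_continuous_gradient φ).continuousOn hc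
    refine ((integrableOn_iff_integrable_of_support_subset ?_).1 h2).integrableOn
    intro x hx
    by_contra hcon
    exact hx (by simp only [gradient_eq_zero_of_notMem_tsupport hcon, smul_zero])
  simp only [Pi.add_apply, add_smul, smul_add]
  rw [integral_add (hi' h.1) (hi' h'.1), integral_add (hi h.2.1) (hi h'.2.1), h.2.2 φ, h'.2.2 φ,
    neg_add]

theorem hasWeakGradient_testFunction (φ : 𝓓(Ω, ℝ)) : HasWeakGradient Ω φ (gradient φ) := by
  refine ⟨(testFunction_integrable φ).locallyIntegrable.locallyIntegrableOn _,
    (testFunction_integrable_gradient φ).locallyIntegrable.locallyIntegrableOn _, fun η => ?_⟩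
  have hi : ∀ a b : 𝓓(Ω, ℝ), Integrable fun x => a x • gradient b x := fun a b =>
    (a.continuous.smul (testFunction_continuous_gradient b)).integrable_of_hasCompactSupport
      a.hasCompactSupport.smul_right
  have hset : ∀ a b : 𝓓(Ω, ℝ), ∫ x in Ω, a x • gradient b x = ∫ x, a x • gradient b x :=
    fun a b => setIntegral_eq_integral_of_forall_compl_eq_zero fun x hx => by
      rw [testFunction_eq_zero a hx, zero_smul]
  rw [hset, hset]
  refine ext_inner_right ℝ fun v => ?_
  have hin : ∀ a b : 𝓓(Ω, ℝ), inner ℝ (∫ x, a x • gradient b x) v =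
      ∫ x, a x * fderiv ℝ b x v := fun a b => by
    rw [real_inner_comm, ← integral_inner (hi a b)]
    refine integral_congr_ae (Filter.Eventually.of_forall fun x => ?_)
    simp only
    rw [inner_smul_right, real_inner_comm, inner_gradient_eq_fderiv]
  rw [inner_neg_left, hin, hin]
  have hfc : ∀ a : 𝓓(Ω, ℝ), Continuous fun x => fderiv ℝ a x v := fun a =>
    (a.contDiff.continuous_fderiv (by simp)).clm_apply continuous_const
  rw [integral_mul_fderiv_eq_neg_fderiv_mul_of_integrable
    (((hfc φ).mul η.continuous).integrable_of_hasCompactSupport η.hasCompactSupport.mul_left)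
    ((φ.continuous.mul (hfc η)).integrable_of_hasCompactSupport φ.hasCompactSupport.mul_right)
    ((φ.continuous.mul η.continuous).integrable_of_hasCompactSupport
      φ.hasCompactSupport.mul_right)
    (fun x _ => testFunction_differentiable φ x) (fun x _ => testFunction_differentiable η x)]
  simp_rw [mul_comm]

theorem weakGrad_add_ae_eq {u v : E n → ℝ} (hu : u ∈ W11 Ω) (hv : v ∈ W11 Ω) :
    weakGrad Ω (u + v) =ᵐ[volume.restrict Ω] weakGrad Ω u + weakGrad Ω v :=
  ((hasWeakGradient_weakGrad hu.2.1).add (hasWeakGradient_weakGrad hv.2.1)).weakGrad_ae_eq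

theorem testFunction_mem_W110 (φ : 𝓓(Ω, ℝ)) : ⇑φ ∈ W110 Ω := by
  have hw := hasWeakGradient_testFunction φ
  have hae := hw.weakGrad_ae_eq
  refine ⟨⟨(testFunction_integrable φ).integrableOn, ⟨_, hw⟩,
    ((testFunction_integrable_gradient φ).integrableOn).congr hae.symm⟩, fun ε hε => ⟨φ, ?_⟩⟩
  have h1 : eLpNorm (fun x => weakGrad Ω φ x - gradient φ x) 1 (volume.restrict Ω) = 0 := by
    rw [← eLpNorm_zero (p := 1) (μ := volume.restrict (Ω : Set (E n))) (ε := E n)]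
    refine eLpNorm_congr_ae ?_
    filter_upwards [hae] with x hx
    rw [hx, sub_self]; rfl
  rw [h1]
  simpa using hε

end WeakGradient

/-! ### Musielak–Orlicz spaces under the `Δ₂` condition -/

section Final

variable {Ω : Opens (E n)} {M : E n → E n → ℝ}

/-- Under the `Δ₂` condition the Musielak–Orlicz class is already a linear space. -/
theorem hasFiniteModulars_of_mem_musielakOrliczSpace
    (hb : Bornology.IsBounded (Ω : Set (E n))) (hM : IsWeakNFunction Ω M) (hΔ : DeltaTwo Ω M)
    {ξ : E n → E n} (hξ : ξ ∈ musielakOrliczSpace Ω M) :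
    AEStronglyMeasurable ξ (volume.restrict Ω) ∧ HasFiniteModulars Ω M ξ := by
  induction hξ using Submodule.span_induction with
  | mem ξ hξ =>
    refine ⟨hξ.1, fun l => ?_⟩
    obtain ⟨c, H, hc, hH, hbd⟩ := hΔ.exists_bound_smul hb hM l
    have h1 : modular Ω M (fun x => l • ξ x) ≤
        ∫⁻ x in Ω, (ENNReal.ofReal c * ENNReal.ofReal (M x (ξ x)) + ENNReal.ofReal (H x)) := by
      refine lintegral_mono_ae ?_
      filter_upwards [hbd, hM.ae_isConvexGauge] with x h1 h2
      rw [← ENNReal.ofReal_mul hc, ← ENNReal.ofReal_add (mul_nonneg hc (h2.nonneg _)) h1.1]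
      exact ENNReal.ofReal_le_ofReal (h1.2 _)
    refine h1.trans_lt ?_
    rw [lintegral_add_right' _ hH.aestronglyMeasurable.aemeasurable.ennreal_ofReal,
      lintegral_const_mul' _ _ ENNReal.ofReal_ne_top]
    exact ENNReal.add_lt_top.2 ⟨ENNReal.mul_lt_top ENNReal.ofReal_lt_top hξ.2,
      hH.lintegral_lt_top⟩
  | zero =>
    exact ⟨aestronglyMeasurable_const, hasFiniteModulars_of_bounded hb hM (R := 0) (by simp)⟩
  | add ξ ζ _ _ h1 h2 => exact ⟨h1.1.add h2.1, h1.2.add hM h1.1 h2.2⟩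
  | smul a ξ _ h =>
    exact ⟨h.1.const_smul a, h.2.smul hM (s := fun _ => a) (A := |a|) fun _ => le_rfl⟩

theorem testFunction_mem_V10L (hb : Bornology.IsBounded (Ω : Set (E n)))
    (hM : IsWeakNFunction Ω M) (φ : 𝓓(Ω, ℝ)) : ⇑φ ∈ V10L Ω M := by
  have hae := (hasWeakGradient_testFunction φ).weakGrad_ae_eq
  refine ⟨testFunction_mem_W110 φ, Submodule.subset_span ⟨?_, ?_⟩⟩
  · exact (testFunction_continuous_gradient φ).aestronglyMeasurable.congr hae.symm
  · obtain ⟨B, hB⟩ := testFunction_exists_norm_gradient_le φ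
    have h1 := hasFiniteModulars_of_bounded hb hM hB 1
    refine lt_of_le_of_lt (le_of_eq ?_) h1
    refine lintegral_congr_ae ?_
    filter_upwards [hae] with x hx
    rw [hx, one_smul]

theorem testFunction_mem_holderSpace (φ : 𝓓(Ω, ℝ)) {γ : ℝ≥0} (hγ : γ ≤ 1) :
    ⇑φ ∈ HolderSpace Ω γ := by
  obtain ⟨K, hK0, hK⟩ := exists_abs_sub_le_rpow φ.contDiff φ.hasCompactSupport γ.2
    (show (γ : ℝ) ≤ 1 by exact_mod_cast hγ)
  refine ⟨K.toNNReal, fun x _ y _ => ?_⟩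
  have h := hK x y
  rw [edist_dist, edist_dist, ENNReal.ofReal_rpow_of_nonneg dist_nonneg γ.coe_nonneg, dist_eq_norm x y,
    Real.dist_eq]
  exact (ENNReal.ofReal_le_ofReal h).trans_eq (ENNReal.ofReal_mul hK0)

theorem IsApproximable.congr {f f' : E n → ℝ} {g g' : E n → E n} (h : IsApproximable Ω M f g)
    (hf : ∀ x ∈ Ω, f x = f' x) (hg : ∀ x ∈ Ω, g x = g' x) : IsApproximable Ω M f' g' := by
  have hΩ := Ω.isOpen.measurableSet
  intro ε hε l
  obtain ⟨φ, h1, h2, h3⟩ := h ε hε l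
  refine ⟨φ, ?_, ?_, ?_⟩
  · refine lt_of_eq_of_lt (setLIntegral_congr_fun hΩ fun x hx => ?_) h1
    simp only [hf x hx]
  · refine lt_of_eq_of_lt (setLIntegral_congr_fun hΩ fun x hx => ?_) h2
    simp only [hg x hx]
  · refine lt_of_eq_of_lt (setLIntegral_congr_fun hΩ fun x hx => ?_) h3
    simp only [hg x hx]

theorem hasFiniteModulars_indicator {g : E n → E n} (h : HasFiniteModulars Ω M g) :
    HasFiniteModulars Ω M (indicator Ω g) := by
  intro l
  refine lt_of_le_of_lt (le_of_eq ?_) (h l)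
  refine setLIntegral_congr_fun Ω.isOpen.measurableSet fun x hx => ?_
  simp only [indicator_of_mem hx]

/-! ### Convergence of the energies -/

/-- The energy of `u + v` may be computed with any representative `g` of the weak gradient of `v`. -/
theorem functional_add_eq {F : E n → ℝ → E n → ℝ} {u v : E n → ℝ} {g : E n → E n}
    (hu : u ∈ W11 Ω) (hv : v ∈ W11 Ω) (hg : weakGrad Ω v =ᵐ[volume.restrict Ω] g) :
    functional Ω F (u + v) =
      ∫⁻ x in Ω, ENNReal.ofReal (F x (u x + v x) (weakGrad Ω u x + g x)) := by
  refine lintegral_congr_ae ?_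
  filter_upwards [weakGrad_add_ae_eq hu hv, hg] with x h1 h2
  rw [h1, Pi.add_apply, Pi.add_apply, h2]

/-- Along a modular approximation by test functions the upper growth bound of the integrand yields
dominating functions which converge in `L¹`. -/
theorem IsApproximable.exists_functional_lt (hb : Bornology.IsBounded (Ω : Set (E n)))
    (hM : IsWeakNFunction Ω M) (hΔ : DeltaTwo Ω M) {F : E n → ℝ → E n → ℝ}
    (hF_meas : ∀ z ξ, AEMeasurable (fun x => F x z ξ) (volume.restrict Ω))
    (hF_cont : ∀ᵐ x ∂(volume.restrict Ω), Continuous (fun p : ℝ × E n => F x p.1 p.2))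
    {L : ℝ} (hL : 0 ≤ L)
    (hF : ∀ x ∈ Ω, ∀ (z : ℝ) (ξ : E n), F x z ξ ≤ L * (M x ξ + 1)) {u v : E n → ℝ}
    (hu : u ∈ V1L Ω M) (hv : v ∈ V10L Ω M) (happ : IsApproximable Ω M v (weakGrad Ω v))
    {c : ℝ≥0∞} (hc : functional Ω F (u + v) < c) :
    ∃ φ : 𝓓(Ω, ℝ), functional Ω F (u + φ) < c := by
  obtain ⟨hum, hufin⟩ := hasFiniteModulars_of_mem_musielakOrliczSpace hb hM hΔ hu.2
  obtain ⟨hvm, hvfin⟩ := hasFiniteModulars_of_mem_musielakOrliczSpace hb hM hΔ hv.2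
  have hε : ∀ j : ℕ, (0 : ℝ≥0∞) < ((j : ℝ≥0∞) + 1)⁻¹ := fun j => by simp
  have h0 : Filter.Tendsto (fun j : ℕ => ((j : ℝ≥0∞) + 1)⁻¹) Filter.atTop (𝓝 0) := by
    have := ENNReal.tendsto_inv_nat_nhds_zero.comp (Filter.tendsto_add_atTop_nat 1)
    simpa [Function.comp_def] using this
  choose φ h1 h2 h3 using fun j : ℕ => happ _ (hε j) 2
  have l1 := tendsto_of_tendsto_of_tendsto_of_le_of_le tendsto_const_nhds h0
    (fun _ => zero_le) fun j => (h1 j).le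
  have l2 := tendsto_of_tendsto_of_tendsto_of_le_of_le tendsto_const_nhds h0
    (fun _ => zero_le) fun j => (h2 j).le
  have l3 := tendsto_of_tendsto_of_tendsto_of_le_of_le tendsto_const_nhds h0
    (fun _ => zero_le) fun j => (h3 j).le
  obtain ⟨ns, hns, a1⟩ := exists_subseq_tendsto_ae_of_lintegral
    (fun j => (φ j).continuous.aestronglyMeasurable) hv.1.1.1.aestronglyMeasurable l1
  obtain ⟨ms, hms, a2⟩ := exists_subseq_tendsto_ae_of_lintegral
    (fun j => (testFunction_continuous_gradient (φ (ns j))).aestronglyMeasurable) hvm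
    (l2.comp hns.tendsto_atTop)
  set ks : ℕ → ℕ := fun j => ns (ms j) with hks
  have hkst : Filter.Tendsto ks Filter.atTop Filter.atTop :=
    hns.tendsto_atTop.comp hms.tendsto_atTop
  have hsum : HasFiniteModulars Ω M fun x => weakGrad Ω u x + weakGrad Ω v x :=
    hufin.add hM hum hvfin
  have hsumi := hsum.integrableOn hM (hum.add hvm) 2
  set A₀ : E n → ℝ := fun x => L * (M x ((2 : ℝ) • (weakGrad Ω u x + weakGrad Ω v x)) + 1) with hA₀
  set Aj : ℕ → E n → ℝ := fun j x => L * (M x ((2 : ℝ) • (weakGrad Ω u x + weakGrad Ω v x)) +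
    M x ((2 : ℝ) • (gradient (φ (ks j)) x - weakGrad Ω v x)) + 1) with hAj
  have hA₀i : IntegrableOn A₀ Ω :=
    (hsumi.add (integrableOn_const (volume_ne_top_of_isBounded hb))).const_mul L
  have hmeas : ∀ j, AEMeasurable (fun x => ENNReal.ofReal
      (F x (u x + φ (ks j) x) (weakGrad Ω u x + gradient (φ (ks j)) x))) (volume.restrict Ω) := by
    intro j
    refine AEMeasurable.ennreal_ofReal ?_
    exact aemeasurable_caratheodory (f := fun x (p : ℝ × E n) => F x p.1 p.2)
      (fun p => hF_meas p.1 p.2) hF_cont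
      (w := fun x => (u x + φ (ks j) x, weakGrad Ω u x + gradient (φ (ks j)) x))
      ((hu.1.1.aestronglyMeasurable.add (φ (ks j)).continuous.aestronglyMeasurable).prodMk
        (hum.add (testFunction_continuous_gradient (φ (ks j))).aestronglyMeasurable))
  have hbound : ∀ j, ∀ᵐ x ∂(volume.restrict Ω), ENNReal.ofReal
      (F x (u x + φ (ks j) x) (weakGrad Ω u x + gradient (φ (ks j)) x)) ≤
        ENNReal.ofReal (Aj j x) := by
    intro j
    filter_upwards [hM.ae_isConvexGauge, ae_restrict_mem Ω.isOpen.measurableSet] with x hx hxΩ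
    refine ENNReal.ofReal_le_ofReal ((hF x hxΩ _ _).trans (mul_le_mul_of_nonneg_left ?_ hL))
    have := hx.map_add_le (weakGrad Ω u x + weakGrad Ω v x)
      (gradient (φ (ks j)) x - weakGrad Ω v x)
    have e : weakGrad Ω u x + weakGrad Ω v x + (gradient (φ (ks j)) x - weakGrad Ω v x) =
        weakGrad Ω u x + gradient (φ (ks j)) x := by abel
    rw [e] at this
    linarith
  have hdiff : Filter.Tendsto (fun j => ∫⁻ x in Ω,
      (ENNReal.ofReal (Aj j x) - ENNReal.ofReal (A₀ x))) Filter.atTop (𝓝 0) := by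
    have l4 := ENNReal.Tendsto.const_mul (a := ENNReal.ofReal L) (l3.comp hkst)
      (Or.inr ENNReal.ofReal_ne_top)
    rw [mul_zero] at l4
    refine tendsto_of_tendsto_of_tendsto_of_le_of_le tendsto_const_nhds l4 (fun _ => zero_le)
      fun j => ?_
    simp only [Function.comp_apply, modular]
    rw [← lintegral_const_mul' _ _ ENNReal.ofReal_ne_top]
    refine lintegral_mono fun x => ?_
    simp only
    rw [tsub_le_iff_left, ← ENNReal.ofReal_mul hL]
    refine le_trans (le_of_eq ?_) ENNReal.ofReal_add_le
    congr 1
    simp only [hAj, hA₀]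
    ring
  have hlim : ∀ᵐ x ∂(volume.restrict Ω), Filter.Tendsto (fun j => ENNReal.ofReal
      (F x (u x + φ (ks j) x) (weakGrad Ω u x + gradient (φ (ks j)) x))) Filter.atTop
      (𝓝 (ENNReal.ofReal (F x (u x + v x) (weakGrad Ω u x + weakGrad Ω v x)))) := by
    filter_upwards [a1, a2, hF_cont] with x b1 b2 b3
    have b4 : Filter.Tendsto
        (fun j => (u x + φ (ks j) x, weakGrad Ω u x + gradient (φ (ks j)) x)) Filter.atTop
        (𝓝 (u x + v x, weakGrad Ω u x + weakGrad Ω v x)) :=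
      ((b1.comp hms.tendsto_atTop).const_add _).prodMk_nhds (b2.const_add _)
    exact (ENNReal.continuous_ofReal.tendsto _).comp ((b3.tendsto _).comp b4)
  rw [functional_add_eq hu.1 hv.1.1 Filter.EventuallyEq.rfl] at hc
  obtain ⟨j, hj⟩ := (eventually_lintegral_lt_of_dominated hmeas
    hA₀i.aestronglyMeasurable.aemeasurable.ennreal_ofReal hA₀i.lintegral_lt_top.ne hbound hdiff
    hlim hc).exists
  refine ⟨φ (ks j), ?_⟩
  rwa [functional_add_eq hu.1 (testFunction_mem_W110 (φ (ks j))).1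
    (hasWeakGradient_testFunction (φ (ks j))).weakGrad_ae_eq]

theorem iInf_functional_eq_of_isApproximable (hb : Bornology.IsBounded (Ω : Set (E n)))
    (hM : IsWeakNFunction Ω M) (hΔ : DeltaTwo Ω M) {F : E n → ℝ → E n → ℝ}
    (hF_meas : ∀ z ξ, AEMeasurable (fun x => F x z ξ) (volume.restrict Ω))
    (hF_cont : ∀ᵐ x ∂(volume.restrict Ω), Continuous (fun p : ℝ × E n => F x p.1 p.2))
    {L : ℝ} (hL : 0 ≤ L)
    (hF : ∀ x ∈ Ω, ∀ (z : ℝ) (ξ : E n), F x z ξ ≤ L * (M x ξ + 1)) {u : E n → ℝ}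
    (hu : u ∈ V1L Ω M) {S : Set (E n → ℝ)} (hS : ∀ φ : 𝓓(Ω, ℝ), ⇑φ ∈ S)
    (happ : ∀ v ∈ S, v ∈ V10L Ω M ∧ IsApproximable Ω M v (weakGrad Ω v)) :
    (⨅ v ∈ S, functional Ω F (u + v)) = ⨅ φ : 𝓓(Ω, ℝ), functional Ω F (u + φ) := by
  refine le_antisymm (le_iInf fun φ => iInf₂_le _ (hS φ)) (le_iInf₂ fun v hv => ?_)
  refine le_of_forall_gt fun c hc => ?_
  obtain ⟨φ, hφ⟩ := (happ v hv).2.exists_functional_lt hb hM hΔ hF_meas hF_cont hL hF hu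
    (happ v hv).1 hc
  exact (iInf_le _ φ).trans_lt hφ

/-- Zero boundary values of the extended function keep it Hölder continuous, so that it is
admissible. -/
theorem isApproximable_of_mem_holderSpace (hb : Bornology.IsBounded (Ω : Set (E n)))
    (hΩ : HasLipschitzBoundary (Ω : Set (E n))) (hM : IsWeakNFunction Ω M) (hΔ : DeltaTwo Ω M)
    {γ : ℝ≥0} (hγ : γ ≤ 1) (hdom : HasDomination Ω M γ) {v : E n → ℝ} (hv : v ∈ V10L Ω M)
    (hvγ : v ∈ HolderSpace Ω γ) : IsApproximable Ω M v (weakGrad Ω v) := by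
  have hsob := W110.isZeroSobolev hv.1
  have hfin := (hasFiniteModulars_of_mem_musielakOrliczSpace hb hM hΔ hv.2).2
  obtain ⟨C, hC⟩ := hvγ
  have hin : ∀ x ∈ (Ω : Set (E n)), indicator (Ω : Set (E n)) v x = v x := fun x hx =>
    indicator_of_mem hx _
  have hC' : HolderOnWith C γ (indicator (Ω : Set (E n)) v) Ω := fun x hx y hy => by
    rw [hin x hx, hin y hy]; exact hC x hx y hy
  obtain ⟨B, hB⟩ := exists_abs_le_of_holderOnWith hb hC
  have hadm : IsAdmissible Ω M γ (indicator Ω v) (indicator Ω (weakGrad Ω v)) := by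
    refine ⟨hsob, hasFiniteModulars_indicator hfin, ⟨max B 0, fun x => ?_⟩,
      ⟨C, C.2, hsob.abs_sub_le_of_holderOnWith hΩ hC'⟩⟩
    by_cases hx : x ∈ (Ω : Set (E n))
    · rw [hin x hx]; exact (hB x hx).trans (le_max_left _ _)
    · rw [indicator_of_notMem hx, abs_zero]; exact le_max_right _ _
  exact (hadm.isApproximable hb hΩ hM hΔ γ.2 (by exact_mod_cast hγ) hdom).congr
    (fun x hx => indicator_of_mem (show x ∈ (Ω : Set (E n)) from hx) _)
    (fun x hx => indicator_of_mem (show x ∈ (Ω : Set (E n)) from hx) _)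

theorem isApproximable_of_hasDomination_zero (hb : Bornology.IsBounded (Ω : Set (E n)))
    (hΩ : HasLipschitzBoundary (Ω : Set (E n))) (hM : IsWeakNFunction Ω M) (hΔ : DeltaTwo Ω M)
    (hdom : HasDomination Ω M 0) {v : E n → ℝ} (hv : v ∈ V10L Ω M) :
    IsApproximable Ω M v (weakGrad Ω v) :=
  ((W110.isZeroSobolev hv.1).isApproximable hb hΩ hM hΔ hdom (hasFiniteModulars_indicator
    (hasFiniteModulars_of_mem_musielakOrliczSpace hb hM hΔ hv.2).2)).congr
    (fun x hx => indicator_of_mem (show x ∈ (Ω : Set (E n)) from hx) _)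
    (fun x hx => indicator_of_mem (show x ∈ (Ω : Set (E n)) from hx) _)

end Final

end Lavrentiev

theorem mainTheorem1 (n : ℕ) (hn : 1 ≤ n)
    (Ω : Opens (Lavrentiev.E n))
    (hΩ_bdd : Bornology.IsBounded (Ω : Set (Lavrentiev.E n)))
    (hΩ_lip : Lavrentiev.HasLipschitzBoundary (Ω : Set (Lavrentiev.E n)))
    (M : Lavrentiev.E n → Lavrentiev.E n → ℝ)
    (hM : Lavrentiev.IsWeakNFunction Ω M)
    (hM_cont : ContinuousOn (fun p : Lavrentiev.E n × Lavrentiev.E n => M p.1 p.2)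
      ((Ω : Set (Lavrentiev.E n)) ×ˢ univ))
    (hM_delta : Lavrentiev.DeltaTwo Ω M)
    (F : Lavrentiev.E n → ℝ → Lavrentiev.E n → ℝ)
    (hF_meas : ∀ z ξ, AEMeasurable (fun x => F x z ξ) (volume.restrict Ω))
    (hF_cont : ∀ᵐ x ∂(volume.restrict Ω),
      Continuous (fun p : ℝ × Lavrentiev.E n => F x p.1 p.2))
    (ν β L : ℝ) (hν : 0 < ν ∧ ν < 1) (hβ : 0 < β ∧ β < 1) (hL : 1 < L)
    (hF : ∀ x ∈ Ω, ∀ (z : ℝ) (ξ : Lavrentiev.E n),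
      ν * M x (β • ξ) ≤ F x z ξ ∧ F x z ξ ≤ L * (M x ξ + 1)) :
    (∀ u₀ ∈ Lavrentiev.V1L Ω M,
      Lavrentiev.BalanceIso Ω M 0 ∨ Lavrentiev.BalanceOrt Ω M 0 →
      (⨅ v ∈ Lavrentiev.V10L Ω M, Lavrentiev.functional Ω F (u₀ + v)) =
        (⨅ φ : 𝓓(Ω, ℝ), Lavrentiev.functional Ω F (u₀ + φ))) ∧
    (∀ γ : ℝ≥0, 0 < γ → γ < 1 →
      ∀ u₀ ∈ Lavrentiev.V1L Ω M ∩ Lavrentiev.HolderSpace Ω γ,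
      Lavrentiev.BalanceIso Ω M γ ∨ Lavrentiev.BalanceOrt Ω M γ →
      (⨅ v ∈ Lavrentiev.V10L Ω M ∩ Lavrentiev.HolderSpace Ω γ,
          Lavrentiev.functional Ω F (u₀ + v)) =
        (⨅ φ : 𝓓(Ω, ℝ), Lavrentiev.functional Ω F (u₀ + φ))) ∧
    (∀ u₀ ∈ Lavrentiev.V1L Ω M ∩ Lavrentiev.HolderSpace Ω 1,
      (⨅ v ∈ Lavrentiev.V10L Ω M ∩ Lavrentiev.HolderSpace Ω 1,
          Lavrentiev.functional Ω F (u₀ + v)) =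
        (⨅ φ : 𝓓(Ω, ℝ), Lavrentiev.functional Ω F (u₀ + φ))) := by
  have hub : ∀ x ∈ Ω, ∀ (z : ℝ) (ξ : Lavrentiev.E n), F x z ξ ≤ L * (M x ξ + 1) :=
    fun x hx z ξ => (hF x hx z ξ).2
  have hL0 : 0 ≤ L := by linarith
  have hbal : ∀ γ : ℝ, Lavrentiev.BalanceIso Ω M γ ∨ Lavrentiev.BalanceOrt Ω M γ →
      Lavrentiev.DirectionalBalance Ω M γ := fun γ h =>
    h.elim (fun h => h.directionalBalance hn hM hM_cont) fun h => h.directionalBalance hM hM_cont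
  refine ⟨fun u₀ hu₀ hB => ?_, fun γ _ hγ₁ u₀ hu₀ hB => ?_, fun u₀ hu₀ => ?_⟩
  · have hdom := (hbal 0 hB).hasDomination hΩ_bdd hM hM_delta le_rfl zero_le_one
    exact Lavrentiev.iInf_functional_eq_of_isApproximable hΩ_bdd hM hM_delta hF_meas hF_cont hL0
      hub hu₀ (Lavrentiev.testFunction_mem_V10L hΩ_bdd hM) fun v hv =>
        ⟨hv, Lavrentiev.isApproximable_of_hasDomination_zero hΩ_bdd hΩ_lip hM hM_delta hdom hv⟩
  · have hdom := (hbal γ hB).hasDomination hΩ_bdd hM hM_delta γ.2 (by exact_mod_cast hγ₁.le)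
    exact Lavrentiev.iInf_functional_eq_of_isApproximable hΩ_bdd hM hM_delta hF_meas hF_cont hL0
      hub hu₀.1 (fun φ => ⟨Lavrentiev.testFunction_mem_V10L hΩ_bdd hM φ,
        Lavrentiev.testFunction_mem_holderSpace φ hγ₁.le⟩) fun v hv =>
        ⟨hv.1, Lavrentiev.isApproximable_of_mem_holderSpace hΩ_bdd hΩ_lip hM hM_delta hγ₁.le hdom
          hv.1 hv.2⟩
  · have hdom : Lavrentiev.HasDomination Ω M ((1 : ℝ≥0) : ℝ) := by
      rw [NNReal.coe_one]
      exact Lavrentiev.hasDomination_one hΩ_bdd hM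
    exact Lavrentiev.iInf_functional_eq_of_isApproximable hΩ_bdd hM hM_delta hF_meas hF_cont hL0
      hub hu₀.1 (fun φ => ⟨Lavrentiev.testFunction_mem_V10L hΩ_bdd hM φ,
        Lavrentiev.testFunction_mem_holderSpace φ le_rfl⟩) fun v hv =>
        ⟨hv.1, Lavrentiev.isApproximable_of_mem_holderSpace hΩ_bdd hΩ_lip hM hM_delta le_rfl hdom
          hv.1 hv.2⟩
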